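/- Let $n\ge 1$ and order $\mathbb Z^n$ by the right lexicographic order; for $k\le n$ regard $\mathbb Z^k$ as the convex subgroup of $\mathbb Z^n$ formed by the first $k$ coordinates, and write $1=(1,0,\dots,0)$. Let $X$ be a set. A $\mathbb Z^n$-word is a function $w:[1,|w|]\to X\cup X^{-1}$ with $0\le |w|\in\mathbb Z^n$; concatenation, inverses and reduced words are defined as for ordinary words. For reduced words $u,v$ let $\operatorname{com}(u,v)$ be the longest common initial segment, if it exists, and let $c(u,v)$ be its length; if $u^{-1}=\operatorname{com}(u^{-1},v)\,\tilde u$ and $v=\operatorname{com}(u^{-1},v)\,\tilde v$, put $u*v=\tilde u^{-1}\tilde v$. Let $R(\mathbb Z^n,X)$ be the set of reduced words, and $CDR(\mathbb Z^n,X)$ the set of reduced words of the form $c^{-1}uc$ with $c$ reduced and $u$ cyclically reduced. A subgroup of $CDR(\mathbb Z^n,X)$ is a subset on which $*$ is everywhere defined and which is a group under $*$ and inversion of words. Let $G$ be a finitely generated non-abelian subgroup of $CDR(\mathbb Z^n,X)$ which is irreducible, that is, not conjugate by an element of $R(\mathbb Z^n,X)$ to a subgroup of $CDR(\mathbb Z^k,X)$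 for any $k<n$. Its universal tree is the $\mathbb Z^n$-tree $$\Gamma_G=\{(\alpha,g)\mid g\in G,\ \alpha\in[0,|g|]\}/\sim,\qquad (\alpha,f)\sim(\beta,g)\iff \alpha=\beta\le c(f,g),$$ with $d(\langle\alpha,f\rangle,\langle\beta,g\rangle)=\alpha+\beta-2\min\{\alpha,\beta,c(f,g)\}$. The group $G$ acts on it by isometries: $h\cdot\langle\alpha,g\rangle=\langle|h|-\alpha,h\rangle$ if $\alpha\le c(h^{-1},g)$, and $h\cdot\langle\alpha,g\rangle=\langle|h|+\alpha-2c(h^{-1},g),h*g\rangle$ otherwise. A $\mathbb Z^k$-subtree is a class of the relation $d(v,w)\in\mathbb Z^k$; the $\mathbb Z^{k}$-subtrees contained in a $\mathbb Z^{k+1}$-subtree are the vertices of a simplicial tree. For $1\le k\le n$ let $\partial_k\Gamma_G$ be the set of ends of $\mathbb Z^k$-type: isometries $[0,\infty)_{\mathbb Z^k}\to\Gamma_G$, two of them being equivalent if they coincide from some points on. Let $\overline\Gamma_G$ be obtained from $\Gamma_G\cup\bigcup_{k=1}^n\partial_k\Gamma_G$ by identifying, for all $k<n$ and all pairs of $\mathbb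 Z^k$-subtrees $T,T'$ that are adjacent in a $\mathbb Z^{k+1}$-subtree, the end of $T$ and the end of $T'$ (both of $\mathbb Z^k$-type) through which the geodesics from $T$ to $T'$ pass. The group $G$ acts on $\overline\Gamma_G$. The space $\overline\Gamma_G$ carries the topology of the following metric $d_{\overline\Gamma_G}$, defined inductively on the compactifications $\overline S$ of $\mathbb Z^k$-subtrees $S$, $k=1,\dots,n$. If $k=1$, choose a base vertex $w\in S$ and let the distance of $x\ne y$ in $\overline S$ be $e^{-(x\cdot y)_w}$, where the Gromov product $(x\cdot y)_w$ is the distance from $w$ to the geodesic $[x,y]$. If $k\ge2$, choose a $\mathbb Z^{k-1}$-subtree $T_0$ of $S$ and number the $\mathbb Z^{k-1}$-subtrees $T$ of $S$ of each level $l$ (their distance to $T_0$ in the simplicial tree of $\mathbb Z^{k-1}$-subtrees of $S$) without repetition by natural numbers $i$; multiply the metric of $\overline T$ by $2^{-(l+i)}$ for $T\ne T_0$, and let the distance of $x,y\in\overline S$ be the sum, over the $\mathbb Z^{k-1}$-subtrees $T$ met by the geodesic $[x,y]$, of the rescaled distances between the points of $\overline T$ at which $[x,y]$ enters and leaves $\overline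 T$. The choices are arbitrary. Let $\mu$ be a probability measure on $G$ whose support generates $G$ as a semigroup, and let $\nu$ be a Borel probability measure on $\overline\Gamma_G$ that is $\mu$-stationary, i.e. $\nu(E)=\sum_{g\in G}\mu(g)\,\nu(g^{-1}E)$ for all Borel sets $E$. Then: (i) $\nu(\{x\})=0$ for every $x\in\overline\Gamma_G$; (ii) $\partial_n\Gamma_G$ is a Borel set and $\nu(\partial_n\Gamma_G)=1$; (iii) $\nu(E)>0$ for every open set $E\subset\overline\Gamma_G$ with $E\cap\partial_n\Gamma_G\neq\varnothing$. -/

import Mathlib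

open scoped ENNReal

noncomputable section

/-! ### The group `ℤⁿ` with the right lexicographic order -/

/-- `ℤⁿ` with the right lexicographic order: tuples are compared at the last coordinate at which
they differ. -/
def ZLex (n : ℕ) : Type := Colex (Fin n → ℤ)

namespace ZLex

variable {n : ℕ}

instance : AddCommGroup (ZLex n) := inferInstanceAs (AddCommGroup (Colex (Fin n → ℤ)))

instance : LinearOrder (ZLex n) := inferInstanceAs (LinearOrder (Colex (Fin n → ℤ)))

theorem lt_iff {a b : ZLex n} :
    a < b ↔ ∃ i : Fin n, (∀ j, i < j → ofColex a j = ofColex b j) ∧ ofColex a i < ofColex b i :=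
  Iff.rfl

instance : IsOrderedAddMonoid (ZLex n) where
  add_le_add_left a b hab c := by
    rcases hab.eq_or_lt with rfl | h
    · exact le_rfl
    · obtain ⟨i, hi, hlt⟩ := h
      refine le_of_lt ⟨i, fun j hj => ?_, ?_⟩
      · exact congrArg (fun z : ℤ => z + c j) (hi j hj)
      · exact Int.add_lt_add_right hlt (c i)

/-- The `j`-th coordinate (counted from `0`), with value `0` for `j ≥ n`. -/
def coord (a : ZLex n) (j : ℕ) : ℤ := if h : j < n then ofColex a ⟨j, h⟩ else 0

/-- `a` lies in the convex subgroup `ℤᵏ` of `ℤⁿ` formed by the first `k` coordinates. -/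
def InZ (k : ℕ) (a : ZLex n) : Prop := ∀ j, k ≤ j → coord a j = 0

/-- The minimal positive element `(1, 0, …, 0)`. -/
def one [NeZero n] : ZLex n := toColex fun i => if i = 0 then 1 else 0

/-- The half-line `[0, ∞)` of `ℤᵏ`, inside `ℤⁿ`. -/
def halfLine (n k : ℕ) : AddSubmonoid (ZLex n) where
  carrier := {a | 0 ≤ a ∧ InZ k a}
  zero_mem' := ⟨le_rfl, fun j _ => by simp only [coord]; split <;> rfl⟩
  add_mem' := by
    rintro a b ⟨ha, ha'⟩ ⟨hb, hb'⟩
    refine ⟨add_nonneg ha hb, fun j hj => ?_⟩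
    have h1 := ha' j hj
    have h2 := hb' j hj
    simp only [coord] at h1 h2 ⊢
    split at h1
    · rename_i h
      rw [dif_pos h] at h2 ⊢
      change ofColex a ⟨j, h⟩ + ofColex b ⟨j, h⟩ = 0
      rw [h1, h2, add_zero]
    · rename_i h
      rw [dif_neg h]

theorem one_pos [NeZero n] : (0 : ZLex n) < one := by
  refine lt_iff.mpr ⟨0, fun j hj => ?_, ?_⟩
  · exact (if_neg (ne_of_gt hj)).symm
  · have h00 : (if (0 : Fin n) = 0 then 1 else 0 : ℤ) = 1 := if_pos rfl
    exact lt_of_lt_of_eq Int.one_pos h00.symm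

theorem one_le_of_pos [NeZero n] {a : ZLex n} (h : 0 < a) : one ≤ a := by
  obtain ⟨i, hi, hlt⟩ := lt_iff.mp h
  have hlt' : (0 : ℤ) < ofColex a i := hlt
  have hi' : ∀ j, i < j → 0 = ofColex a j := hi
  by_cases h0 : i = 0
  · subst h0
    have hj0 : ∀ j : Fin n, 0 < j → (if j = 0 then 1 else 0 : ℤ) = ofColex a j :=
      fun j hj => (if_neg (ne_of_gt hj)).trans (hi' j hj)
    have h00 : (if (0 : Fin n) = 0 then 1 else 0 : ℤ) = 1 := if_pos rfl
    rcases (Int.add_one_le_iff.mpr hlt').eq_or_lt with h1 | h1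
    · refine le_of_eq (funext fun j => ?_)
      by_cases hj : j = 0
      · subst hj
        exact h00.trans ((zero_add 1).symm.trans h1)
      · exact hj0 j (Fin.pos_iff_ne_zero.mpr hj)
    · exact le_of_lt (lt_iff.mpr ⟨0, hj0, lt_of_eq_of_lt (h00.trans (zero_add 1).symm) h1⟩)
  · have hpos : 0 < i := Fin.pos_iff_ne_zero.mpr h0
    exact le_of_lt (lt_iff.mpr ⟨i,
      fun j hj => (if_neg (ne_of_gt (hpos.trans hj))).trans (hi' j hj),
      lt_of_eq_of_lt (if_neg h0) hlt'⟩)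

theorem one_le_iff [NeZero n] {a : ZLex n} : one ≤ a ↔ 0 < a :=
  ⟨fun h => one_pos.trans_le h, one_le_of_pos⟩

end ZLex

/-! ### Elementary arithmetic in ordered abelian groups -/

section Arith

variable {Λ : Type*} [AddCommGroup Λ] [LinearOrder Λ] [IsOrderedAddMonoid Λ]

theorem add_self_inj_of_ordered {a b : Λ} (h : a + a = b + b) : a = b := by
  rcases lt_trichotomy a b with h' | h' | h'
  · exact absurd h (add_lt_add h' h').ne
  · exact h'
  · exact absurd h (add_lt_add h' h').ne'

theorem tripod_aux₁ (α β A B C H : Λ) (h1 : min A B ≤ C) (h0 : 0 ≤ min α β)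
    (hα : α ≤ A) (hβ : β ≤ B) :
    (H - α - min (min (H - α) (H - β)) H) + (H - β - min (min (H - α) (H - β)) H) =
      (α - min (min α β) C) + (β - min (min α β) C) := by
  grind

theorem tripod_aux₂ (α β A B C H : Λ) (h1 : min A B ≤ C) (h2 : min A C ≤ B)
    (hα : α ≤ A) (hβ : ¬ β ≤ B) :
    (H - α - min (min (H - α) (H - B + (β - B))) (H - B)) +
        (H - B + (β - B) - min (min (H - α) (H - B + (β - B))) (H - B)) =
      (α - min (min α β) C) + (β - min (min α β) C) := by
  grind

theorem tripod_aux₃ (α β A B C H : Λ) (h1 : min A B ≤ C) (h2 : min A C ≤ B) (h3 : min B C ≤ A)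
    (hα : ¬ α ≤ A) (hβ : ¬ β ≤ B) :
    (H - A + (α - A) - min (min (H - A + (α - A)) (H - B + (β - B))) (H - A - B + C)) +
        (H - B + (β - B) - min (min (H - A + (α - A)) (H - B + (β - B))) (H - A - B + C)) =
      (α - min (min α β) C) + (β - min (min α β) C) := by
  grind

end Arith

/-! ### Infinite words -/

/-- A `ℤⁿ`-word over `X^±`: a function from the segment `[1, len]` of `ℤⁿ` to `X^±`. The letter `x`
is `(x, true)` and the letter `x⁻¹` is `(x, false)`; `letter` is `none` off the domain. -/
@[ext]
structure ZWord (n : ℕ) [NeZero n] (X : Type*) where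
  len : ZLex n
  len_nonneg : 0 ≤ len
  letter : ZLex n → Option (X × Bool)
  isSome_iff : ∀ β, (letter β).isSome ↔ ZLex.one ≤ β ∧ β ≤ len

namespace ZWord

variable {n : ℕ} [NeZero n] {X : Type*}

open ZLex

/-- The inverse of a letter. -/
def invLetter (x : X × Bool) : X × Bool := (x.1, !x.2)

/-- Concatenation of words. -/
def append (u v : ZWord n X) : ZWord n X where
  len := u.len + v.len
  len_nonneg := add_nonneg u.len_nonneg v.len_nonneg
  letter α := if α ≤ u.len then u.letter α else v.letter (α - u.len)
  isSome_iff β := by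
    split
    · rename_i h
      rw [u.isSome_iff]
      exact ⟨fun h' => ⟨h'.1, h.trans (le_add_of_nonneg_right v.len_nonneg)⟩, fun h' => ⟨h'.1, h⟩⟩
    · rename_i h
      rw [v.isSome_iff, one_le_iff, one_le_iff, sub_pos, sub_le_iff_le_add']
      rw [not_le] at h
      exact ⟨fun h' => ⟨u.len_nonneg.trans_lt h, h'.2⟩, fun h' => ⟨h, h'.2⟩⟩

/-- The inverse word. -/
def inv (w : ZWord n X) : ZWord n X where
  len := w.len
  len_nonneg := w.len_nonneg
  letter β := (w.letter (w.len + one - β)).map invLetter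
  isSome_iff β := by
    rw [Option.isSome_map, w.isSome_iff, le_sub_iff_add_le', add_le_add_iff_right,
      sub_le_iff_le_add', add_comm β, ← sub_le_iff_le_add', add_sub_cancel_left]
    exact and_comm

/-- `w(β + 1) ≠ w(β)⁻¹` whenever `1 ≤ β < |w|`. -/
def IsReduced (w : ZWord n X) : Prop :=
  ∀ β, one ≤ β → β < w.len → w.letter (β + one) ≠ (w.letter β).map invLetter

/-- A reduced word is cyclically reduced if `w(1)⁻¹ ≠ w(|w|)` (the empty word is). -/
def IsCyclicallyReduced (w : ZWord n X) : Prop :=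
  w.IsReduced ∧ (0 < w.len → (w.letter one).map invLetter ≠ w.letter w.len)

/-- The set `CDR(ℤⁿ, X)`: reduced words with a cyclic decomposition `w = c⁻¹ ∘ u ∘ c`. -/
def IsCDR (w : ZWord n X) : Prop :=
  w.IsReduced ∧ ∃ c u : ZWord n X, c.IsReduced ∧ u.IsCyclicallyReduced ∧
    w = (c.inv.append u).append c

/-- The words `u` and `v` do not begin with the same letter (true if one of them is empty). -/
def NoCommonStart (u v : ZWord n X) : Prop :=
  ∀ x, u.letter one = some x → v.letter one ≠ some x

/-- `c = com(u, v)` is the longest common initial segment of `u` and `v`. -/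
def IsCom (u v c : ZWord n X) : Prop :=
  ∃ a b : ZWord n X, u = c.append a ∧ v = c.append b ∧ NoCommonStart a b

/-- The partial product: `u * v` is defined and equal to `w`. -/
def IsProd (u v w : ZWord n X) : Prop :=
  ∃ c a b : ZWord n X, u.inv = c.append a ∧ v = c.append b ∧ NoCommonStart a b ∧
    w = a.inv.append b

open Classical in
/-- `c(u, v) = |com(u, v)|` (with value `0` if `com(u, v)` does not exist). -/
def comLen (u v : ZWord n X) : ZLex n :=
  if h : ∃ c, IsCom u v c then h.choose.len else 0

theorem letter_eq_none {u : ZWord n X} {β : ZLex n} (h : ¬ (one ≤ β ∧ β ≤ u.len)) :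
    u.letter β = none := by
  rw [← u.isSome_iff] at h
  simpa using h

theorem inv_inv_word (u : ZWord n X) : u.inv.inv = u := by
  ext1
  · rfl
  · funext β
    change ((u.letter (u.len + one - (u.len + one - β))).map invLetter).map invLetter = _
    rw [sub_sub_cancel, Option.map_map]
    have : (invLetter ∘ invLetter : X × Bool → X × Bool) = id := by
      funext x; simp [invLetter]
    rw [this, Option.map_id, id]

/-- `u` and `v` have the same letters up to the position `α`. -/
def Agree (u v : ZWord n X) (α : ZLex n) : Prop := ∀ β, β ≤ α → u.letter β = v.letter β

theorem IsCom.le_iff {u v c : ZWord n X} (h : IsCom u v c) (α : ZLex n) :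
    α ≤ c.len ↔ α ≤ u.len ∧ α ≤ v.len ∧ Agree u v α := by
  obtain ⟨a, b, rfl, rfl, hab⟩ := h
  constructor
  · intro hα
    refine ⟨hα.trans (le_add_of_nonneg_right a.len_nonneg),
      hα.trans (le_add_of_nonneg_right b.len_nonneg), fun β hβ => ?_⟩
    change (if _ then _ else _) = (if _ then _ else _)
    rw [if_pos (hβ.trans hα), if_pos (hβ.trans hα)]
  · rintro ⟨h1, h2, h3⟩
    by_contra hlt
    rw [not_le] at hlt
    have h4 : c.len + one ≤ α := by
      rw [← le_sub_iff_add_le', one_le_iff, sub_pos]; exact hlt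
    have h5 := h3 _ h4
    have h6 : ¬ c.len + one ≤ c.len := by
      rw [not_le]; exact lt_add_of_pos_right _ one_pos
    change (if _ then _ else _) = (if _ then _ else _) at h5
    rw [if_neg h6, if_neg h6, add_sub_cancel_left] at h5
    have h7 : (a.letter one).isSome := by
      rw [a.isSome_iff]
      exact ⟨le_rfl, le_of_add_le_add_left (h4.trans h1)⟩
    obtain ⟨x, hx⟩ := Option.isSome_iff_exists.mp h7
    exact hab x hx (h5 ▸ hx)

theorem comLen_eq {u v c : ZWord n X} (h : IsCom u v c) : comLen u v = c.len := by
  have hex : ∃ c, IsCom u v c := ⟨c, h⟩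
  rw [comLen, dif_pos hex]
  have h' := hex.choose_spec
  apply le_antisymm
  · rw [h.le_iff, ← h'.le_iff]
  · rw [h'.le_iff, ← h.le_iff]

theorem IsProd.isCom {u v w : ZWord n X} (h : IsProd u v w) :
    ∃ c, IsCom u.inv v c ∧ w.len = u.len + v.len - (c.len + c.len) := by
  obtain ⟨c, a, b, h1, h2, h3, rfl⟩ := h
  refine ⟨c, ⟨a, b, h1, h2, h3⟩, ?_⟩
  have h4 : u.len = c.len + a.len := congrArg ZWord.len h1
  have h5 : v.len = c.len + b.len := congrArg ZWord.len h2
  change a.len + b.len = _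
  rw [h4, h5]; abel

/-- `w⁻¹ * u * w` is defined and equal to `v`. -/
def IsConj (w u v : ZWord n X) : Prop := ∃ p, IsProd w.inv u p ∧ IsProd p w v

end ZWord

/-! ### Subgroups of `CDR(ℤⁿ, X)` and their universal trees -/

/-- A realization of the group `G` as a subgroup of `CDR(ℤⁿ, X)`: an injective map from `G` to
`CDR(ℤⁿ, X)` such that all products of words in the image are defined, and which takes products
and inverses in `G` to products and inverses of words. -/
structure CDREmbedding (n : ℕ) [NeZero n] (X G : Type*) [Group G] where
  word : G → ZWord n X
  injective : Function.Injective word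
  isCDR : ∀ g, (word g).IsCDR
  map_mul : ∀ g h, ZWord.IsProd (word g) (word h) (word (g * h))
  map_inv : ∀ g, word g⁻¹ = (word g).inv

namespace CDREmbedding

variable {n : ℕ} [NeZero n] {X G : Type*} [Group G] (Φ : CDREmbedding n X G)

open ZWord

/-- `G` is irreducible: it is not conjugate, by an element `w` of `R(ℤⁿ, X)`, to a subgroup of
`CDR(ℤᵏ, X)` with `k < n`. -/
def Irreducible : Prop :=
  ¬ ∃ k < n, ∃ (Ψ : CDREmbedding n X G) (w : ZWord n X), w.IsReduced ∧
    (∀ g, ZLex.InZ k (Ψ.word g).len) ∧ ∀ g, IsConj w (Φ.word g) (Ψ.word g)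

/-- The length `|g|`. -/
def len (g : G) : ZLex n := (Φ.word g).len

/-- `c(f, g) = |com(f, g)|`. -/
def com (f g : G) : ZLex n := comLen (Φ.word f) (Φ.word g)

theorem com_spec (f g : G) : ∃ c, IsCom (Φ.word f) (Φ.word g) c ∧
    Φ.com f g = c.len ∧ Φ.len (f⁻¹ * g) = Φ.len f + Φ.len g - (Φ.com f g + Φ.com f g) := by
  obtain ⟨c, h1, h2⟩ := (Φ.map_mul f⁻¹ g).isCom
  rw [Φ.map_inv, inv_inv_word] at h1
  have h3 : Φ.com f g = c.len := comLen_eq h1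
  refine ⟨c, h1, h3, ?_⟩
  rw [h3]
  change (Φ.word (f⁻¹ * g)).len = _
  rw [h2, Φ.map_inv]
  rfl

theorem le_com_iff (f g : G) (α : ZLex n) :
    α ≤ Φ.com f g ↔ α ≤ Φ.len f ∧ α ≤ Φ.len g ∧ Agree (Φ.word f) (Φ.word g) α := by
  obtain ⟨c, h1, h2, -⟩ := Φ.com_spec f g
  rw [h2, h1.le_iff]
  rfl

theorem len_nonneg (g : G) : 0 ≤ Φ.len g := (Φ.word g).len_nonneg

theorem len_inv (g : G) : Φ.len g⁻¹ = Φ.len g := by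
  change (Φ.word g⁻¹).len = _
  rw [Φ.map_inv]; rfl

theorem com_le_left (f g : G) : Φ.com f g ≤ Φ.len f := ((Φ.le_com_iff f g _).mp le_rfl).1

theorem com_le_right (f g : G) : Φ.com f g ≤ Φ.len g := ((Φ.le_com_iff f g _).mp le_rfl).2.1

theorem com_nonneg (f g : G) : 0 ≤ Φ.com f g := by
  rw [le_com_iff]
  refine ⟨Φ.len_nonneg f, Φ.len_nonneg g, fun β hβ => ?_⟩
  have : ¬ ZLex.one ≤ β := not_le.mpr (hβ.trans_lt ZLex.one_pos)
  rw [letter_eq_none (fun h => this h.1), letter_eq_none (fun h => this h.1)]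

theorem com_comm (f g : G) : Φ.com f g = Φ.com g f := by
  apply le_antisymm <;>
  · rw [le_com_iff]
    obtain ⟨h1, h2, h3⟩ := (Φ.le_com_iff _ _ _).mp le_rfl
    exact ⟨h2, h1, fun β hβ => (h3 β hβ).symm⟩

theorem com_self (f : G) : Φ.com f f = Φ.len f :=
  le_antisymm (Φ.com_le_left f f) ((Φ.le_com_iff _ _ _).mpr ⟨le_rfl, le_rfl, fun _ _ => rfl⟩)

theorem le_com_trans {f g h : G} {α : ZLex n} (h1 : α ≤ Φ.com f g) (h2 : α ≤ Φ.com g h) :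
    α ≤ Φ.com f h := by
  rw [le_com_iff] at *
  exact ⟨h1.1, h2.2.1, fun β hβ => (h1.2.2 β hβ).trans (h2.2.2 β hβ)⟩

theorem len_mul (f g : G) :
    Φ.len (f * g) = Φ.len f + Φ.len g - (Φ.com f⁻¹ g + Φ.com f⁻¹ g) := by
  obtain ⟨c, -, -, h⟩ := Φ.com_spec f⁻¹ g
  rwa [inv_inv f, Φ.len_inv] at h

theorem two_com (f g : G) :
    Φ.com f g + Φ.com f g = Φ.len f + Φ.len g - Φ.len (f⁻¹ * g) := by
  obtain ⟨c, -, -, h⟩ := Φ.com_spec f g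
  rw [h]; abel

theorem com_mul_left (h k : G) : Φ.com h (h * k) = Φ.len h - Φ.com h⁻¹ k := by
  apply add_self_inj_of_ordered
  rw [two_com, inv_mul_cancel_left, len_mul]; abel

theorem com_mul_mul (h g k : G) :
    Φ.com (h * g) (h * k) = Φ.len h - Φ.com h⁻¹ g - Φ.com h⁻¹ k + Φ.com g k := by
  apply add_self_inj_of_ordered
  have h1 : (h * g)⁻¹ * (h * k) = g⁻¹ * k := by group
  have h2 := Φ.two_com g k
  rw [two_com, h1, len_mul, len_mul]
  have h3 : Φ.len (g⁻¹ * k) = Φ.len g + Φ.len k - (Φ.com g k + Φ.com g k) := by rw [h2]; abel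
  rw [h3]; abel

/-- The pairs `(α, g)` with `g ∈ G` and `α ∈ [0, |g|]`. -/
@[ext]
structure PreVertex where
  pos : ZLex n
  elt : G
  pos_nonneg : 0 ≤ pos
  pos_le : pos ≤ Φ.len elt

/-- `(α, f) ∼ (β, g)` if and only if `α = β ∈ [0, c(f, g)]`. -/
instance vertexSetoid : Setoid Φ.PreVertex where
  r p q := p.pos = q.pos ∧ p.pos ≤ Φ.com p.elt q.elt
  iseqv :=
    { refl := fun p => ⟨rfl, by rw [com_self]; exact p.pos_le⟩
      symm := fun {p q} h => ⟨h.1.symm, by rw [com_comm, ← h.1]; exact h.2⟩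
      trans := fun {p q r} h h' =>
        ⟨h.1.trans h'.1, Φ.le_com_trans h.2 (h.1 ▸ h'.2)⟩ }

/-- The set of points of the universal tree `Γ_G`. -/
def Tree : Type _ := Quotient Φ.vertexSetoid

/-- The base point `ε = ⟨0, 1⟩`. -/
def root : Φ.Tree := Quotient.mk _ ⟨0, 1, le_rfl, Φ.len_nonneg 1⟩

/-- The metric of `Γ_G`: the segments from `ε` to `⟨α, f⟩` and to `⟨β, g⟩` have in common an initial
segment of length `min {α, β, c(f, g)}`. -/
def preDist (p q : Φ.PreVertex) : ZLex n :=
  (p.pos - min (min p.pos q.pos) (Φ.com p.elt q.elt)) +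
    (q.pos - min (min p.pos q.pos) (Φ.com p.elt q.elt))

theorem min_com_le {p p' q q' : Φ.PreVertex} (hp : p ≈ p') (hq : q ≈ q') :
    min (min p.pos q.pos) (Φ.com p.elt q.elt) ≤
      min (min p'.pos q'.pos) (Φ.com p'.elt q'.elt) := by
  obtain ⟨h1, h2⟩ := hp
  obtain ⟨h3, h4⟩ := hq
  rw [← h1, ← h3]
  refine le_min (min_le_left _ _) ?_
  have a1 : min (min p.pos q.pos) (Φ.com p.elt q.elt) ≤ p.pos :=
    (min_le_left _ _).trans (min_le_left _ _)
  have a2 : min (min p.pos q.pos) (Φ.com p.elt q.elt) ≤ q.pos :=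
    (min_le_left _ _).trans (min_le_right _ _)
  have h2' : min (min p.pos q.pos) (Φ.com p.elt q.elt) ≤ Φ.com p'.elt p.elt := by
    rw [Φ.com_comm p'.elt]; exact a1.trans h2
  exact Φ.le_com_trans h2' (Φ.le_com_trans (min_le_right _ _) (a2.trans h4))

theorem preDist_congr (p q p' q' : Φ.PreVertex) (hp : p ≈ p') (hq : q ≈ q') :
    Φ.preDist p q = Φ.preDist p' q' := by
  have h : min (min p.pos q.pos) (Φ.com p.elt q.elt) =
      min (min p'.pos q'.pos) (Φ.com p'.elt q'.elt) :=
    le_antisymm (Φ.min_com_le hp hq) (Φ.min_com_le (Setoid.symm hp) (Setoid.symm hq))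
  rw [preDist, preDist, h, hp.1, hq.1]

/-- The `ℤⁿ`-valued metric of `Γ_G`. -/
def dist : Φ.Tree → Φ.Tree → ZLex n := Quotient.lift₂ Φ.preDist Φ.preDist_congr

open Classical in
/-- The action on pairs: `h · (α, g) = (|h| - α, h)` if `α ≤ c(h⁻¹, g)`, and
`h · (α, g) = (|h| + α - 2 c(h⁻¹, g), h g)` otherwise. -/
def preAct (h : G) (p : Φ.PreVertex) : Φ.PreVertex :=
  if hc : p.pos ≤ Φ.com h⁻¹ p.elt then
    ⟨Φ.len h - p.pos, h,
      sub_nonneg.mpr (hc.trans (by rw [← Φ.len_inv h]; exact Φ.com_le_left _ _)),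
      sub_le_self _ p.pos_nonneg⟩
  else
    ⟨(Φ.len h - Φ.com h⁻¹ p.elt) + (p.pos - Φ.com h⁻¹ p.elt), h * p.elt,
      add_nonneg (sub_nonneg.mpr (by rw [← Φ.len_inv h]; exact Φ.com_le_left _ _))
        (sub_nonneg.mpr (le_of_not_ge hc)),
      by
        rw [len_mul]
        calc (Φ.len h - Φ.com h⁻¹ p.elt) + (p.pos - Φ.com h⁻¹ p.elt)
            ≤ (Φ.len h - Φ.com h⁻¹ p.elt) + (Φ.len p.elt - Φ.com h⁻¹ p.elt) := by
              gcongr; exact p.pos_le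
          _ = _ := by abel⟩

theorem com_min_left (h g k : G) : min (Φ.com h g) (Φ.com h k) ≤ Φ.com g k :=
  Φ.le_com_trans (g := h) (by rw [Φ.com_comm g h]; exact min_le_left _ _) (min_le_right _ _)

theorem com_min_mid (h g k : G) : min (Φ.com h g) (Φ.com g k) ≤ Φ.com h k :=
  Φ.le_com_trans (g := g) (min_le_left _ _) (min_le_right _ _)

theorem com_min_right (h g k : G) : min (Φ.com h k) (Φ.com g k) ≤ Φ.com h g :=
  Φ.le_com_trans (g := k) (min_le_left _ _) (by rw [Φ.com_comm k g]; exact min_le_right _ _)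

theorem preDist_comm (p q : Φ.PreVertex) : Φ.preDist p q = Φ.preDist q p := by
  rw [preDist, preDist, Φ.com_comm p.elt, min_comm p.pos, add_comm]

theorem preDist_preAct_aux (h : G) (p q : Φ.PreVertex) (hp : p.pos ≤ Φ.com h⁻¹ p.elt)
    (hq : ¬ q.pos ≤ Φ.com h⁻¹ q.elt) :
    Φ.preDist (Φ.preAct h p) (Φ.preAct h q) = Φ.preDist p q := by
  unfold preDist preAct
  rw [dif_pos hp, dif_neg hq]
  simp only [com_mul_left]
  exact tripod_aux₂ _ _ _ _ _ _ (Φ.com_min_left _ _ _) (Φ.com_min_mid _ _ _) hp hq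

/-- The action preserves the metric. -/
theorem preDist_preAct (h : G) (p q : Φ.PreVertex) :
    Φ.preDist (Φ.preAct h p) (Φ.preAct h q) = Φ.preDist p q := by
  by_cases hp : p.pos ≤ Φ.com h⁻¹ p.elt <;> by_cases hq : q.pos ≤ Φ.com h⁻¹ q.elt
  · unfold preDist preAct
    rw [dif_pos hp, dif_pos hq]
    simp only [com_self]
    have h0 : 0 ≤ min p.pos q.pos := le_min p.pos_nonneg q.pos_nonneg
    exact tripod_aux₁ _ _ _ _ _ _ (Φ.com_min_left _ _ _) h0 hp hq
  · exact Φ.preDist_preAct_aux h p q hp hq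
  · rw [preDist_comm, Φ.preDist_preAct_aux h q p hq hp, preDist_comm]
  · unfold preDist preAct
    rw [dif_neg hp, dif_neg hq]
    simp only [com_mul_mul]
    exact tripod_aux₃ _ _ _ _ _ _ (Φ.com_min_left _ _ _) (Φ.com_min_mid _ _ _)
      (Φ.com_min_right _ _ _) hp hq

theorem preDist_eq_zero (p q : Φ.PreVertex) : Φ.preDist p q = 0 ↔ p ≈ q := by
  have h1 : min (min p.pos q.pos) (Φ.com p.elt q.elt) ≤ p.pos :=
    (min_le_left _ _).trans (min_le_left _ _)
  have h2 : min (min p.pos q.pos) (Φ.com p.elt q.elt) ≤ q.pos :=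
    (min_le_left _ _).trans (min_le_right _ _)
  rw [preDist, add_eq_zero_iff_of_nonneg (sub_nonneg.mpr h1) (sub_nonneg.mpr h2), sub_eq_zero,
    sub_eq_zero]
  constructor
  · rintro ⟨h3, h4⟩
    exact ⟨h3.trans h4.symm, h3.le.trans (min_le_right _ _)⟩
  · rintro ⟨h3, h4⟩
    rw [← h3, min_self, min_eq_left h4]
    exact ⟨rfl, rfl⟩

/-- The action of `h ∈ G` on the universal tree `Γ_G`. -/
def act (h : G) : Φ.Tree → Φ.Tree :=
  Quotient.map (Φ.preAct h) fun p q hpq => by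
    rw [← preDist_eq_zero] at hpq ⊢
    rwa [preDist_preAct]

theorem dist_act (h : G) (v w : Φ.Tree) : Φ.dist (Φ.act h v) (Φ.act h w) = Φ.dist v w :=
  Quotient.inductionOn₂ v w fun p q => Φ.preDist_preAct h p q

end CDREmbedding

/-! ### Ends and the compactification of a `ℤⁿ`-tree -/

section Compactification

variable {n : ℕ} {V : Type*} (d : V → V → ZLex n)

/-- An isometry `[0, ∞)_{ℤᵏ} → V`. -/
structure ZRay (k : ℕ) where
  toFun : ZLex.halfLine n k → V
  isometry : ∀ s t, d (toFun s) (toFun t) = |(s : ZLex n) - (t : ZLex n)|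

/-- Points of a `ℤⁿ`-tree, and rays of `ℤᵏ`-type with `1 ≤ k ≤ n`. -/
inductive PrePoint
  | vertex (v : V)
  | ray (k : ℕ) (hk : 1 ≤ k ∧ k ≤ n) (γ : ZRay d k)

/-- The identifications between rays: `tail` identifies two rays of `ℤᵏ`-type that coincide from
some point on (so that they define the same end), and `facing` identifies the ends `α_T` and `α_T'`
of `ℤᵏ`-type of two adjacent `ℤᵏ`-subtrees `T` and `T'` (for `k < n`) that correspond to the edge
between `T` and `T'`. The latter means that `T` and `T'` are at distance `1` in the simplicial
tree of `ℤᵏ`-subtrees of a `ℤᵏ⁺¹`-subtree, and that for suitable rays `γ` and `γ'` in these classes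
the segment from `γ 0` to `γ' 0` is the ray `γ` followed by the ray `γ'` traversed backwards. -/
inductive PrePoint.Rel : PrePoint d → PrePoint d → Prop
  | tail (k : ℕ) (hk : 1 ≤ k ∧ k ≤ n) (γ γ' : ZRay d k) (s s' : ZLex.halfLine n k)
      (h : ∀ t, γ.toFun (s + t) = γ'.toFun (s' + t)) : Rel (.ray k hk γ) (.ray k hk γ')
  | facing (k : ℕ) (hk : 1 ≤ k ∧ k ≤ n) (hkn : k < n) (γ γ' : ZRay d k) (δ : ZLex n)
      (h1 : ZLex.coord δ k = 1) (h0 : ZLex.InZ (k + 1) δ)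
      (h : ∀ s t, d (γ.toFun s) (γ'.toFun t) = δ - (s : ZLex n) - (t : ZLex n)) :
      Rel (.ray k hk γ) (.ray k hk γ')

/-- The set `Γ̄ = Γ ∪ (∂Γ / ∼)`. -/
def ZCompletion : Type _ := Quot (PrePoint.Rel d)

/-- The set `∂ₙΓ` of ends of `ℤⁿ`-type, as a subset of `Γ̄`. -/
def topBoundary : Set (ZCompletion d) :=
  {x | ∃ (hk : 1 ≤ n ∧ n ≤ n) (γ : ZRay d n), x = Quot.mk _ (PrePoint.ray n hk γ)}

variable {d}

/-- The map of rays induced by an isometry of `Γ`. -/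
def ZRay.map {k : ℕ} (f : V → V) (hf : ∀ v w, d (f v) (f w) = d v w) (γ : ZRay d k) : ZRay d k where
  toFun := f ∘ γ.toFun
  isometry s t := (hf _ _).trans (γ.isometry s t)

/-- The map of points and rays induced by an isometry of `Γ`. -/
def PrePoint.map (f : V → V) (hf : ∀ v w, d (f v) (f w) = d v w) : PrePoint d → PrePoint d
  | .vertex v => .vertex (f v)
  | .ray k hk γ => .ray k hk (γ.map f hf)

/-- The map of `Γ̄` induced by an isometry of `Γ`. -/
def ZCompletion.map (f : V → V) (hf : ∀ v w, d (f v) (f w) = d v w) :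
    ZCompletion d → ZCompletion d :=
  Quot.map (PrePoint.map f hf) fun a b hab => by
    cases hab with
    | tail k hk γ γ' s s' h => exact .tail k hk _ _ s s' fun t => congrArg f (h t)
    | facing k hk hkn γ γ' δ h1 h0 h =>
      exact .facing k hk hkn _ _ δ h1 h0 fun s t => (hf _ _).trans (h s t)

/-- The vertices near a vertex `v` (only `v` itself), and the vertices far along a ray. -/
def PrePoint.filter : PrePoint d → Filter V
  | .vertex v => pure v
  | .ray _ _ γ => Filter.map γ.toFun Filter.atTop

/-- The vertex `p` lies on the geodesic `[x, y]`, where `x, y ∈ Γ̄`: it lies on `[u, w]` for all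
vertices `u` and `w` far along the rays that represent `x` and `y`. -/
def OnGeodesic (p : V) (x y : ZCompletion d) : Prop :=
  ∃ a b : PrePoint d, Quot.mk _ a = x ∧ Quot.mk _ b = y ∧
    ∀ᶠ u in a.filter, ∀ᶠ w in b.filter, d u w = d u p + d p w

variable (d)

/-- `S` is a `ℤᵏ`-subtree: a class of the relation `d(v, w) ∈ ℤᵏ`. -/
def IsZSubtree (k : ℕ) (S : Set V) : Prop := ∃ v, S = {w | ZLex.InZ k (d v w)}

/-- The distance from the `ℤᵏ`-subtree of `v` to the `ℤᵏ`-subtree `T` in the simplicial tree of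
`ℤᵏ`-subtrees of a `ℤᵏ⁺¹`-subtree: it is the coordinate number `k` (counted from `0`) of `d(v, t)`,
for every `t ∈ T`. -/
def subtreeLevel (k : ℕ) (v : V) (T : Set V) : ℕ :=
  sInf {m | ∃ t ∈ T, ZLex.coord (d v t) k = m}

/-- The choices that enter in the construction of the metric on `Γ̄`. In each `ℤ`-subtree `S` one
chooses a base vertex `base 1 S`. In each `ℤᵏ⁺¹`-subtree `S` with `k ≥ 1` one chooses a
`ℤᵏ`-subtree `T₀`, namely that of the vertex `base (k + 1) S`, and enumerates the `ℤᵏ`-subtrees of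
`S` on each level with respect to `T₀`: the number of `T` is `index k T`. -/
structure MetricData where
  base : ℕ → Set V → V
  base_mem : ∀ k S, IsZSubtree d k S → base k S ∈ S
  index : ℕ → Set V → ℕ
  index_inj : ∀ k S, IsZSubtree d (k + 1) S → ∀ T T', IsZSubtree d k T → IsZSubtree d k T' →
    T ⊆ S → T' ⊆ S →
    subtreeLevel d k (base (k + 1) S) T = subtreeLevel d k (base (k + 1) S) T' →
    index k T = index k T' → T = T'

namespace MetricData

variable {d} (D : MetricData d)

open Classical in
/-- The factor by which the metric of the `ℤᵏ`-subtree `T` is rescaled in the `ℤᵏ⁺¹`-subtree `S`: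
`1` for `T₀` and `2 ^ -(l + i)` for the `i`-th subtree of level `l` otherwise. -/
def scale (k : ℕ) (S T : Set V) : ℝ≥0∞ :=
  if D.base (k + 1) S ∈ T then 1
  else 2⁻¹ ^ (subtreeLevel d k (D.base (k + 1) S) T + D.index k T)

open Classical in
/-- `D.subDist k S x y` is the distance in the compactification of the `ℤᵏ`-subtree `S` between the
points at which the geodesic `[x, y]` enters and leaves it; it is `0` if `[x, y]` does not meet `S`.

For `k = 1` the distance between `a ≠ b` is `exp (-(a · b)_w)`, where `w` is the base vertex and
where the Gromov product `(a · b)_w` is the distance from `w` to the geodesic `[a, b]` of the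
simplicial tree `S`. In a `ℤᵏ⁺¹`-subtree, one adds up the rescaled distances over the
`ℤᵏ`-subtrees `T` that the geodesic crosses, between the points at which it enters and leaves `T`;
the other subtrees contribute `0`. -/
def subDist : ℕ → Set V → ZCompletion d → ZCompletion d → ℝ≥0∞
  | 0, _, _, _ => 0
  | 1, S, x, y =>
    if x = y then 0
    else ⨆ p ∈ {p | p ∈ S ∧ OnGeodesic p x y},
      ENNReal.ofReal (Real.exp (-(ZLex.coord (d (D.base 1 S) p) 0 : ℝ)))
  | k + 2, S, x, y =>
    ∑' T : {T : Set V // IsZSubtree d (k + 1) T ∧ T ⊆ S},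
      D.scale (k + 1) S T * subDist (k + 1) T x y

/-- The metric `d_Γ̄` on `Γ̄`. -/
def dist (x y : ZCompletion d) : ℝ≥0∞ := D.subDist n Set.univ x y

/-- The set `Γ̄`, with the topology of the metric `D.dist` and its Borel sets. -/
def Space (_ : MetricData d) : Type _ := ZCompletion d

instance : TopologicalSpace D.Space where
  IsOpen U := ∀ x ∈ U, ∃ ε > 0, ∀ y, D.dist x y < ε → y ∈ U
  isOpen_univ := fun _ _ => ⟨1, one_pos, fun _ _ => trivial⟩
  isOpen_inter := by
    rintro U U' hU hU' x ⟨hx, hx'⟩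
    obtain ⟨ε, hε, h⟩ := hU x hx
    obtain ⟨ε', hε', h'⟩ := hU' x hx'
    exact ⟨min ε ε', lt_min hε hε', fun y hy =>
      ⟨h y (hy.trans_le (min_le_left _ _)), h' y (hy.trans_le (min_le_right _ _))⟩⟩
  isOpen_sUnion := by
    rintro 𝒰 h𝒰 x ⟨U, hU, hx⟩
    obtain ⟨ε, hε, h⟩ := h𝒰 U hU x hx
    exact ⟨ε, hε, fun y hy => ⟨U, hU, h y hy⟩⟩

instance : MeasurableSpace D.Space := borel _

instance : BorelSpace D.Space := ⟨rfl⟩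

/-- `∂ₙΓ`, as a subset of the space `Γ̄`. -/
def topEnds : Set D.Space := topBoundary d

end MetricData

end Compactification

namespace CDREmbedding

variable {n : ℕ} [NeZero n] {X G : Type*} [Group G] (Φ : CDREmbedding n X G)

/-- The action of `g ∈ G` on `Γ̄_G`. -/
def actBar (D : MetricData Φ.dist) (g : G) : D.Space → D.Space :=
  ZCompletion.map (Φ.act g) (Φ.dist_act g)

/-- `ν` is `μ`-stationary: `∑_g μ(g) (g · ν) = ν`, where `(g · ν)(E) = ν(g⁻¹ · E)`. -/
def IsStationary (D : MetricData Φ.dist) (μ : PMF G) (ν : MeasureTheory.Measure D.Space) : Prop :=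
  ∀ E, MeasurableSet E → ∑' g, μ g * ν (Φ.actBar D g ⁻¹' E) = ν E

end CDREmbedding

end

open scoped ENNReal

noncomputable section

set_option linter.unusedSectionVars false

/-! ### Coordinates, convex subgroups and infinitely large elements of `ℤⁿ` -/

namespace ZLex

variable {n : ℕ}

/-! The proof rests on the maximum principle `exists_finite_invariant`: stationary masses that
exceed any given positive bound only finitely often attain their maximum on a finite invariant set.

For (i), it turns an atom into a finite invariant set in `Γ̄`. A point of `Γ̄` is represented by at
most two filters of vertices (`finite_filters`), so a normal subgroup of finite index fixes such a
filter. This subgroup is trivial or acts by shifts far along a ray; the action is free, so it is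
abelian. Conjugation preserves translation lengths, so it takes each of its elements to itself or to
its inverse. In a torsion-free group this forces commutativity (`comm_of_finite_invariant`).

For (ii), the complement of the ends of `ℤⁿ`-type is the union of the countably many closures of
`ℤⁿ⁻¹`-subtrees. Two of them meet only in glued ends, which are countable and hence null by (i). If
a closure had positive mass, the maximum principle would give a finite invariant set of
`ℤⁿ⁻¹`-subtrees. The orbit of its centre consists of one subtree or of two adjacent ones. In the
second case the edge between them yields a fixed point of `Γ̄`, or an inversion if `n = 1`; both are
impossible. So a `ℤⁿ⁻¹`-subtree is fixed (`exists_fixed_class`), and the words along the segments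
from one of its vertices to the translates (`rebase`) conjugate `G` into `CDR(ℤⁿ⁻¹, X)`, against
irreducibility.

For (iii), if `E` were null, so would be the union of its translates. By (i) two distinct points lie
outside this union, and the geodesic between them contains a vertex `p` (`exists_onGeodesic`). The
set `E` contains everything beyond some vertex of a ray of `ℤⁿ`-type, and a translate of `p` lies
there (`exists_onSeg_smul`). Then one of the two translated points is there too, a contradiction.

Only two properties of the metric matter: the distance is bounded below by a constant depending on a
vertex of the geodesic (`exists_le_dist`), and it is small if the geodesic stays far from the base
vertex (`exists_dist_lt`). The words enter through the tree axioms (`isZTree`) and through cyclic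
decompositions, which give `|g| < |g * g|` and hence an axis for each `g ≠ 1`; therefore the action
is free and `G` is torsion-free. -/

@[simp] theorem coord_zero (j : ℕ) : coord (0 : ZLex n) j = 0 := by
  unfold coord; split <;> rfl

theorem coord_add (a b : ZLex n) (j : ℕ) : coord (a + b) j = coord a j + coord b j := by
  unfold coord; split
  · rfl
  · rfl

theorem coord_neg (a : ZLex n) (j : ℕ) : coord (-a) j = -coord a j := by
  unfold coord; split <;> rfl

theorem coord_sub (a b : ZLex n) (j : ℕ) : coord (a - b) j = coord a j - coord b j := by
  rw [sub_eq_add_neg, coord_add, coord_neg, sub_eq_add_neg]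

theorem coord_of_le {a : ZLex n} {j : ℕ} (h : n ≤ j) : coord a j = 0 := by
  unfold coord; rw [dif_neg (by omega)]

theorem coord_ext {a b : ZLex n} (h : ∀ j < n, coord a j = coord b j) : a = b := by
  funext i
  have := h i i.2
  unfold coord at this
  rw [dif_pos i.2, dif_pos i.2] at this
  exact this

theorem pos_iff {a : ZLex n} :
    0 < a ↔ ∃ i < n, (∀ j, i < j → coord a j = 0) ∧ 0 < coord a i := by
  rw [lt_iff]
  constructor
  · rintro ⟨i, h1, h2⟩
    refine ⟨i, i.2, fun j hj => ?_, ?_⟩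
    · unfold coord; split
      · rename_i h
        exact (h1 ⟨j, h⟩ hj).symm
      · rfl
    · unfold coord; rw [dif_pos i.2]; exact h2
  · rintro ⟨i, hi, h1, h2⟩
    refine ⟨⟨i, hi⟩, fun j hj => ?_, ?_⟩
    · have := h1 j hj
      unfold coord at this; rw [dif_pos j.2] at this
      exact this.symm
    · unfold coord at h2; rw [dif_pos hi] at h2; exact h2

theorem InZ.add {k : ℕ} {a b : ZLex n} (ha : InZ k a) (hb : InZ k b) : InZ k (a + b) :=
  fun j hj => by rw [coord_add, ha j hj, hb j hj, add_zero]

theorem InZ.neg {k : ℕ} {a : ZLex n} (ha : InZ k a) : InZ k (-a) :=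
  fun j hj => by rw [coord_neg, ha j hj, neg_zero]

theorem InZ.sub {k : ℕ} {a b : ZLex n} (ha : InZ k a) (hb : InZ k b) : InZ k (a - b) :=
  fun j hj => by rw [coord_sub, ha j hj, hb j hj, sub_zero]

theorem InZ.mono {k l : ℕ} (h : k ≤ l) {a : ZLex n} (ha : InZ k a) : InZ l a :=
  fun j hj => ha j (h.trans hj)

theorem inZ_zero (k : ℕ) : InZ k (0 : ZLex n) := fun j _ => coord_zero j

theorem inZ_top (a : ZLex n) : InZ n a := fun _ hj => coord_of_le hj

theorem inZ_zero_iff {a : ZLex n} : InZ 0 a ↔ a = 0 :=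
  ⟨fun h => coord_ext fun j _ => by rw [h j (Nat.zero_le _), coord_zero], by
    rintro rfl; exact inZ_zero 0⟩

/-- The leading coordinate of `b` has index at least `k`, where all coordinates of `a` vanish. -/
theorem lt_of_not_inZ {k : ℕ} {a b : ZLex n} (hb : 0 ≤ b) (hbk : ¬ InZ k b) (ha : InZ k a) :
    a < b := by
  have hb0 : 0 < b := lt_of_le_of_ne hb (by rintro rfl; exact hbk (inZ_zero k))
  obtain ⟨i, hi, h1, h2⟩ := pos_iff.mp hb0
  have hki : k ≤ i := by
    by_contra hlt
    exact hbk fun j hj => h1 j (by omega)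
  rw [← sub_pos, pos_iff]
  refine ⟨i, hi, fun j hj => ?_, ?_⟩
  · rw [coord_sub, h1 j hj, ha j (by omega), sub_zero]
  · rw [coord_sub, ha i hki, sub_zero]; exact h2

theorem InZ.of_le {k : ℕ} {a b : ZLex n} (hb : InZ k b) (h0 : 0 ≤ a) (hab : a ≤ b) : InZ k a := by
  by_contra h
  exact absurd (lt_of_not_inZ h0 h hb) (not_lt.mpr hab)

theorem coord_nonneg_of_inZ {k : ℕ} {a : ZLex n} (h0 : 0 ≤ a) (ha : InZ (k + 1) a) :
    0 ≤ coord a k := by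
  rcases h0.eq_or_lt with rfl | h0
  · rw [coord_zero]
  · obtain ⟨i, hi, h1, h2⟩ := pos_iff.mp h0
    have hik : i ≤ k := by
      by_contra hlt
      rw [ha i (by omega)] at h2
      exact absurd h2 (lt_irrefl _)
    rcases hik.eq_or_lt with rfl | h
    · exact h2.le
    · rw [h1 k h]

theorem inZ_of_coord {k : ℕ} {a : ZLex n} (ha : InZ (k + 1) a) (h : coord a k = 0) : InZ k a := by
  intro j hj
  rcases hj.eq_or_lt with rfl | hj
  · exact h
  · exact ha j hj

theorem coord_pos_of_inZ {k : ℕ} {a : ZLex n} (h0 : 0 ≤ a) (ha : InZ (k + 1) a) (h : ¬ InZ k a) :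
    0 < coord a k :=
  lt_of_le_of_ne (coord_nonneg_of_inZ h0 ha) fun h' => h (inZ_of_coord ha h'.symm)

theorem nonneg_of_coord_pos {k : ℕ} {a : ZLex n} (ha : InZ (k + 1) a) (h : 0 < coord a k) :
    0 < a := by
  rw [pos_iff]
  refine ⟨k, ?_, fun j hj => ha j hj, h⟩
  by_contra hk
  rw [coord_of_le (by omega)] at h
  exact absurd h (lt_irrefl _)

/-- The `k`-th unit vector. -/
def unit (n k : ℕ) : ZLex n := toColex fun i => if (i : ℕ) = k then 1 else 0

theorem coord_unit {k : ℕ} (hk : k < n) (j : ℕ) : coord (unit n k) j = if j = k then 1 else 0 := by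
  unfold coord unit
  split
  · rfl
  · rw [if_neg (by omega)]

theorem inZ_unit {k : ℕ} (hk : k < n) : InZ (k + 1) (unit n k) :=
  fun j hj => by rw [coord_unit hk, if_neg (by omega)]

theorem not_inZ_unit {k : ℕ} (hk : k < n) : ¬ InZ k (unit n k) := fun h => by
  have := h k le_rfl
  rw [coord_unit hk, if_pos rfl] at this
  exact one_ne_zero this

theorem unit_pos {k : ℕ} (hk : k < n) : 0 < unit n k :=
  nonneg_of_coord_pos (inZ_unit hk) (by rw [coord_unit hk, if_pos rfl]; exact Int.one_pos)

theorem one_eq_unit [NeZero n] : (one : ZLex n) = unit n 0 := by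
  unfold one unit
  congr 1
  funext i
  simp only [Fin.ext_iff, Fin.val_zero]

theorem inZ_one [NeZero n] {k : ℕ} (hk : 1 ≤ k) : InZ k (one : ZLex n) := by
  rw [one_eq_unit]
  exact (inZ_unit (NeZero.pos n)).mono hk

/-- Otherwise `D + 1` would be an element of the half-line above its bound `D`. -/
theorem not_inZ_of_forall_le [NeZero n] {k : ℕ} (hk : 1 ≤ k) {D : ZLex n}
    (h : ∀ s : halfLine n k, (s : ZLex n) ≤ D) : ¬ InZ k D := fun hD => by
  have h0 : 0 ≤ D := h 0
  have := h ⟨D + one, add_nonneg h0 one_pos.le, hD.add (inZ_one hk)⟩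
  exact absurd (this : D + one ≤ D) (not_le.mpr (lt_add_of_pos_right _ one_pos))

/-- An element `D` of `ℤⁿ` that is infinitely large compared with `ℤᵏ` and `ℤˡ` splits into two
such parts, unless `k = l` and `D` is a successor modulo `ℤᵏ`. -/
theorem exists_split {k l : ℕ} {D : ZLex n} (h0 : 0 ≤ D) (hk : ¬ InZ k D) (hl : ¬ InZ l D)
    (hkl : ¬ (k = l ∧ InZ (k + 1) D ∧ coord D k = 1)) :
    ∃ x, 0 ≤ x ∧ x ≤ D ∧ ¬ InZ k x ∧ ¬ InZ l (D - x) := by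
  have lt_n : ∀ {m}, ¬ InZ m D → m < n := fun {m} h => by
    by_contra hm
    exact h ((inZ_top D).mono (by omega))
  have hkn := lt_n hk
  have hln := lt_n hl
  -- The unit vector of the smaller index is cut off at the end that needs only this much; it is
  -- negligible for the other end. If `k = l`, a remainder in `ℤᵏ` is exactly the excluded case.
  rcases lt_trichotomy k l with h | h | h
  · refine ⟨unit n k, (unit_pos hkn).le, (lt_of_not_inZ h0 hl ((inZ_unit hkn).mono h)).le,
      not_inZ_unit hkn, fun h' => hl ?_⟩
    have := h'.add ((inZ_unit hkn).mono h)
    rwa [sub_add_cancel] at this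
  · subst h
    have hD : ¬ InZ k (D - unit n k) := fun h' => hkl ⟨rfl, by
        have := (h'.mono (Nat.le_succ k)).add (inZ_unit hkn)
        rwa [sub_add_cancel] at this, by
        have := h' k le_rfl
        rw [coord_sub, coord_unit hkn, if_pos rfl] at this
        omega⟩
    refine ⟨unit n k, (unit_pos hkn).le, ?_, not_inZ_unit hkn, hD⟩
    by_cases hD1 : InZ (k + 1) D
    · have h1 := coord_pos_of_inZ h0 hD1 hk
      have h2 : coord D k ≠ 1 := fun h => hkl ⟨rfl, hD1, h⟩
      refine sub_nonneg.mp (nonneg_of_coord_pos (hD1.sub (inZ_unit hkn)) ?_).le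
      rw [coord_sub, coord_unit hkn, if_pos rfl]
      omega
    · exact (lt_of_not_inZ h0 hD1 (inZ_unit hkn)).le
  · refine ⟨D - unit n l, sub_nonneg.mpr
      (lt_of_not_inZ h0 hk ((inZ_unit hln).mono h)).le, sub_le_self _ (unit_pos hln).le,
      fun h' => hk ?_, ?_⟩
    · have := h'.add ((inZ_unit hln).mono h)
      rwa [sub_add_cancel] at this
    · rw [sub_sub_cancel]; exact not_inZ_unit hln

/-! ### The half-line of `ℤᵏ` -/

theorem halfLine_exists_add {k : ℕ} {s t : halfLine n k} (h : s ≤ t) : ∃ u, t = s + u :=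
  ⟨⟨(t : ZLex n) - s, sub_nonneg.mpr h, t.2.2.sub s.2.2⟩, Subtype.ext (by
    change (t : ZLex n) = s + (t - s); abel)⟩

theorem halfLine_le_add {k : ℕ} (s t : halfLine n k) : s ≤ s + t :=
  le_add_of_nonneg_right (α := ZLex n) t.2.1

/-- Tails of the half-line are its translates; statements about ends are unfolded in this form. -/
theorem halfLine_eventually {k : ℕ} {p : halfLine n k → Prop} :
    (∀ᶠ s in Filter.atTop, p s) ↔ ∃ s₀, ∀ s, p (s₀ + s) := by
  rw [Filter.eventually_atTop]
  refine exists_congr fun s₀ => ⟨fun h s => h _ (halfLine_le_add _ _), fun h s hs => ?_⟩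
  obtain ⟨u, rfl⟩ := halfLine_exists_add hs
  exact h u

end ZLex

/-! ### Segments and rays in `ℤⁿ`-trees -/

open ZLex Filter

/-- `z` lies on the segment `[u, w]`. -/
def OnSeg {n : ℕ} {V : Type*} (d : V → V → ZLex n) (u z w : V) : Prop := d u w = d u z + d z w

/-- The axioms of a `ℤⁿ`-tree. -/
structure IsZTree {n : ℕ} {V : Type*} (d : V → V → ZLex n) : Prop where
  self : ∀ v, d v v = 0
  eq_of : ∀ v w, d v w = 0 → v = w
  symm : ∀ v w, d v w = d w v
  four : ∀ a b c e, d a b + d c e ≤ max (d a c + d b e) (d a e + d b c)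
  geod : ∀ u w x, 0 ≤ x → x ≤ d u w → ∃ z, d u z = x ∧ OnSeg d u z w
  median : ∀ a b c, ∃ m, OnSeg d a m b ∧ OnSeg d b m c ∧ OnSeg d a m c

namespace IsZTree

variable {n : ℕ} {V : Type*} {d : V → V → ZLex n} (T : IsZTree d)

include T

theorem triangle (a b c : V) : d a c ≤ d a b + d b c := by
  have := T.four a c b b
  rw [T.self, add_zero, max_self, T.symm c b] at this
  exact this

theorem nonneg (a b : V) : 0 ≤ d a b := by
  have h1 := T.triangle a b a
  rw [T.self, T.symm b a] at h1
  grind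

theorem onSeg_symm {u z w : V} (h : OnSeg d u z w) : OnSeg d w z u := by
  unfold OnSeg at *
  rw [T.symm w u, h, T.symm w z, T.symm z u, add_comm]

theorem onSeg_left (u w : V) : OnSeg d u u w := by
  unfold OnSeg; rw [T.self, zero_add]

theorem onSeg_right (u w : V) : OnSeg d u w w := by
  unfold OnSeg; rw [T.self, add_zero]

theorem le_of_onSeg {u z w : V} (h : OnSeg d u z w) : d u z ≤ d u w := by
  rw [h]; exact le_add_of_nonneg_right (T.nonneg _ _)

/-- A point of a side of a triangle lies on one of the other two sides. -/
theorem cut {o z w : V} (h : OnSeg d o z w) (u : V) : OnSeg d o z u ∨ OnSeg d u z w := by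
  -- After substituting `d o w = d o z + d z w`, the two terms of the maximum give the two
  -- alternatives.
  have h1 := T.four o w z u
  have h2 := T.triangle o z u
  have h3 := T.triangle u z w
  have h4 := T.symm z u
  have h5 := T.symm z w
  have h6 := T.symm u w
  unfold OnSeg at *
  grind

theorem onSeg_trans {o a b c : V} (h1 : OnSeg d o b c) (h2 : OnSeg d o a b) : OnSeg d o a c := by
  have h3 := T.triangle o a c
  have h4 := T.triangle a b c
  unfold OnSeg at *
  grind

theorem onSeg_trans' {o a b c : V} (h1 : OnSeg d o b c) (h2 : OnSeg d o a b) : OnSeg d a b c := by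
  have h3 := T.triangle o a c
  have h4 := T.triangle a b c
  unfold OnSeg at *
  grind

/-- Two points of a segment are ordered by their distances from an endpoint. -/
theorem onSeg_of_le {o a b c : V} (h1 : OnSeg d o a c) (h2 : OnSeg d o b c) (h : d o a ≤ d o b) :
    OnSeg d o a b := by
  rcases T.cut h1 b with h3 | h3
  · exact h3
  · have h4 := T.nonneg b a
    have h5 : d b a = 0 := by
      unfold OnSeg at *
      grind
    rw [T.eq_of _ _ h5]
    exact T.onSeg_right _ _

theorem eq_of_onSeg {o a b c : V} (h1 : OnSeg d o a c) (h2 : OnSeg d o b c) (h : d o a = d o b) :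
    a = b := by
  have h3 := T.onSeg_of_le h1 h2 h.le
  refine T.eq_of _ _ ?_
  unfold OnSeg at h3
  rw [h, left_eq_add] at h3
  exact h3

/-- The region beyond `q`, seen from `o`, is convex. If `p` were outside it, the paths from `p` to
`u` and to `w` would both pass through `q`, so `[u, w]` would make a detour from `q` to `p` and
back. -/
theorem onSeg_convex {o q u w p : V} (hu : OnSeg d o q u) (hw : OnSeg d o q w) (hp : OnSeg d u p w) :
    OnSeg d o q p := by
  rcases T.cut hu p with h | h1
  · exact h
  rcases T.cut hw p with h | h2
  · exact h
  have h3 := T.triangle u q w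
  have h4 := T.symm p u
  have h5 := T.symm u q
  have h7 := T.nonneg p q
  have h6 : d p q = 0 := by
    unfold OnSeg at *
    grind
  rw [T.eq_of _ _ h6]
  exact T.onSeg_right _ _

theorem inZ_symm {k : ℕ} {u v : V} (h : InZ k (d u v)) : InZ k (d v u) := by
  rwa [T.symm]

theorem inZ_trans {k : ℕ} {u v w : V} (h1 : InZ k (d u v)) (h2 : InZ k (d v w)) :
    InZ k (d u w) :=
  (h1.add h2).of_le (T.nonneg _ _) (T.triangle _ _ _)

theorem inZ_self (k : ℕ) (u : V) : InZ k (d u u) := by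
  rw [T.self]; exact inZ_zero k

/-- Points of the same `ℤᵏ`-subtree have the same distance to another point, modulo `ℤᵏ`. -/
theorem inZ_sub_dist {k : ℕ} {v w : V} (h : InZ k (d v w)) (u : V) : InZ k (d u v - d u w) := by
  have h1 := T.triangle u v w
  have h2 := T.triangle u w v
  rw [T.symm w v] at h2
  rcases le_total (d u v) (d u w) with h3 | h3
  · have := h.of_le (sub_nonneg.mpr h3) (sub_le_iff_le_add'.mpr h1)
    have h4 := this.neg
    rwa [neg_sub] at h4
  · exact h.of_le (sub_nonneg.mpr h3) (sub_le_iff_le_add'.mpr h2)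

/-! ### Rays -/

theorem ray_dist {k : ℕ} (γ : ZRay d k) (s t : halfLine n k) :
    d (γ.toFun s) (γ.toFun (s + t)) = t := by
  rw [γ.isometry]
  have : (s : ZLex n) - ((s + t : halfLine n k) : ZLex n) = -(t : ZLex n) := by
    change (s : ZLex n) - (s + t) = _; abel
  rw [this, abs_neg, abs_of_nonneg t.2.1]

theorem ray_dist_zero {k : ℕ} (γ : ZRay d k) (t : halfLine n k) :
    d (γ.toFun 0) (γ.toFun t) = t := by
  have := T.ray_dist γ 0 t
  rwa [zero_add] at this

theorem ray_inZ {k : ℕ} (γ : ZRay d k) (s t : halfLine n k) :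
    InZ k (d (γ.toFun s) (γ.toFun t)) := by
  rw [γ.isometry]
  have h := s.2.2.sub t.2.2
  rcases abs_choice ((s : ZLex n) - t) with h' | h' <;> rw [h']
  · exact h
  · exact h.neg

/-- The distance from a vertex to the points of a ray either increases eventually or decreases
forever. -/
theorem ray_dichotomy {k : ℕ} (γ : ZRay d k) (v : V) :
    (∃ s₀, ∀ t, d v (γ.toFun (s₀ + t)) = d v (γ.toFun s₀) + t) ∨
      ∀ t, d v (γ.toFun t) = d v (γ.toFun 0) - t := by
  by_cases H : ∀ t, d v (γ.toFun t) = d v (γ.toFun 0) - t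
  · exact Or.inr H
  left
  push Not at H
  -- Any parameter at which the decrease fails can serve as `s₀`: the four-point condition then
  -- forces the increase from there on.
  obtain ⟨t, hst⟩ := H
  refine ⟨t, fun u => ?_⟩
  have h1 := T.four v (γ.toFun t) (γ.toFun 0) (γ.toFun (t + u))
  have h2 := T.ray_dist_zero γ t
  have h3 := T.ray_dist γ t u
  have h4 : d (γ.toFun 0) (γ.toFun (t + u)) = t + u := T.ray_dist_zero γ (t + u)
  have h5 := T.triangle v (γ.toFun t) (γ.toFun (t + u))
  have h6 := T.triangle v (γ.toFun t) (γ.toFun 0)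
  have h7 := T.symm (γ.toFun t) (γ.toFun 0)
  grind

theorem ray_decreasing_add {k : ℕ} {γ : ZRay d k} {v : V}
    (h : ∀ t, d v (γ.toFun t) = d v (γ.toFun 0) - t) (s t : halfLine n k) :
    d v (γ.toFun (s + t)) = d v (γ.toFun s) - t := by
  rw [h, h s]
  change _ - ((s : ZLex n) + t) = _
  abel

theorem ray_increasing_add {k : ℕ} {γ : ZRay d k} {v : V} {s₀ : halfLine n k}
    (h : ∀ t, d v (γ.toFun (s₀ + t)) = d v (γ.toFun s₀) + t) (s t : halfLine n k) :
    d v (γ.toFun (s₀ + s + t)) = d v (γ.toFun (s₀ + s)) + t := by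
  rw [add_assoc, h, h s]
  change _ + ((s : ZLex n) + t) = _
  abel

/-- A ray of `ℤᵏ`-type ends up on one side of a point `q`, seen from a point `o`. -/
theorem ray_eventually_onSeg {k : ℕ} (γ : ZRay d k) {o q : V}
    (h : ∃ᶠ s in atTop, OnSeg d o q (γ.toFun s)) : ∀ᶠ s in atTop, OnSeg d o q (γ.toFun s) := by
  rw [halfLine_eventually]
  rw [frequently_atTop] at h
  rcases T.ray_dichotomy γ q with ⟨s₀, h1⟩ | h1
  · refine ⟨s₀, fun t => ?_⟩
    obtain ⟨s, hs, h2⟩ := h (s₀ + t)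
    obtain ⟨u, rfl⟩ := halfLine_exists_add hs
    have h3 := T.ray_increasing_add h1 t u
    have h4 := T.triangle o q (γ.toFun (s₀ + t))
    have h5 := T.triangle o (γ.toFun (s₀ + t)) (γ.toFun (s₀ + t + u))
    have h6 := T.ray_dist γ (s₀ + t) u
    unfold OnSeg at *
    grind
  · rcases T.ray_dichotomy γ o with ⟨s₀, h2⟩ | h2
    · obtain ⟨s, hs, h3⟩ := h s₀
      obtain ⟨u, rfl⟩ := halfLine_exists_add hs
      refine ⟨s₀ + u, fun t => ?_⟩
      obtain ⟨s', hs', h4⟩ := h (s₀ + u + t)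
      obtain ⟨t', rfl⟩ := halfLine_exists_add hs'
      have h5 := T.ray_decreasing_add h1 (s₀ + u) (t + t')
      have h6 := T.ray_increasing_add h2 u (t + t')
      rw [← add_assoc] at h5 h6
      have h7 : ((t + t' : halfLine n k) : ZLex n) = t + t' := rfl
      have h8 := t.2.1
      have h9 := t'.2.1
      -- The difference of the distances from `o` and from `q` equals `d o q` at both parameters,
      -- but it grows by `2 (t + t')` between them.
      have h10 : t = 0 := by
        apply Subtype.ext
        change (t : ZLex n) = 0
        unfold OnSeg at *
        grind
      rw [h10, add_zero]
      exact h3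
    · obtain ⟨s, -, h3⟩ := h 0
      refine ⟨s, fun t => ?_⟩
      have h5 := T.ray_decreasing_add h1 s t
      have h6 := T.ray_decreasing_add h2 s t
      unfold OnSeg at *
      grind

end IsZTree

/-! ### Ends as filters of vertices -/

section Rays

variable {n : ℕ} {V : Type*} {d : V → V → ZLex n}

/-- Two rays coincide from some points on. -/
def Cofinal {k : ℕ} (γ γ' : ZRay d k) : Prop :=
  ∃ s s', ∀ t, γ.toFun (s + t) = γ'.toFun (s' + t)

/-- Two rays of `ℤᵏ`-type run through the same edge of the tree of `ℤᵏ`-subtrees, from its two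
sides. -/
def Facing {k : ℕ} (γ γ' : ZRay d k) : Prop :=
  ∃ δ, coord δ k = 1 ∧ InZ (k + 1) δ ∧
    ∀ s t, d (γ.toFun s) (γ'.toFun t) = δ - (s : ZLex n) - (t : ZLex n)

/-- The ray `γ` is an initial part of the segments from its origin to `w`. -/
def Toward {k : ℕ} (γ : ZRay d k) (w : V) : Prop := ∀ s, OnSeg d (γ.toFun 0) (γ.toFun s) w

/-- The type of a point: `0` for vertices, `k` for ends of `ℤᵏ`-type. -/
def PrePoint.type : PrePoint d → ℕ
  | .vertex _ => 0
  | .ray k _ _ => k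

theorem PrePoint.Rel.type_eq {a b : PrePoint d} (h : PrePoint.Rel d a b) : a.type = b.type := by
  cases h <;> rfl

/-- The type of a point of the completion. -/
def ZCompletion.type : ZCompletion d → ℕ := Quot.lift PrePoint.type fun _ _ h => h.type_eq

theorem ray_filter_eventually {k : ℕ} (hk : 1 ≤ k ∧ k ≤ n) (γ : ZRay d k) {p : V → Prop} :
    (∀ᶠ u in (PrePoint.ray k hk γ).filter, p u) ↔ ∃ s, ∀ t, p (γ.toFun (s + t)) := by
  change (∀ᶠ u in Filter.map γ.toFun atTop, p u) ↔ _
  rw [eventually_map, halfLine_eventually]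

theorem vertex_filter_eventually (v : V) {p : V → Prop} :
    (∀ᶠ u in (PrePoint.vertex (d := d) v).filter, p u) ↔ p v := by
  change (∀ᶠ u in pure v, p u) ↔ _
  rw [eventually_pure]

instance PrePoint.filter_neBot (a : PrePoint d) : a.filter.NeBot := by
  cases a with
  | vertex v => exact pure_neBot
  | ray k hk γ => exact Filter.map_neBot

theorem Cofinal.symm {k : ℕ} {γ γ' : ZRay d k} (h : Cofinal γ γ') : Cofinal γ' γ := by
  obtain ⟨s, s', h⟩ := h
  exact ⟨s', s, fun t => (h t).symm⟩

theorem Cofinal.filter_le {k : ℕ} {γ γ' : ZRay d k} (h : Cofinal γ γ') :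
    Filter.map γ'.toFun atTop ≤ Filter.map γ.toFun atTop := by
  obtain ⟨s, s', h⟩ := h
  intro A hA
  change ∀ᶠ t in atTop, γ.toFun t ∈ A at hA
  change ∀ᶠ t in atTop, γ'.toFun t ∈ A
  rw [halfLine_eventually] at *
  obtain ⟨t, ht⟩ := hA
  refine ⟨s' + t, fun u => ?_⟩
  rw [add_assoc, ← h, ← add_assoc, add_comm s t, add_assoc]
  exact ht _

theorem Cofinal.filter_eq {k : ℕ} {γ γ' : ZRay d k} (h : Cofinal γ γ') :
    Filter.map γ.toFun atTop = Filter.map γ'.toFun atTop :=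
  le_antisymm h.symm.filter_le h.filter_le

theorem mk_eq_of_cofinal {k : ℕ} (hk : 1 ≤ k ∧ k ≤ n) {γ γ' : ZRay d k} (h : Cofinal γ γ') :
    (Quot.mk _ (.ray k hk γ) : ZCompletion d) = Quot.mk _ (.ray k hk γ') := by
  obtain ⟨s, s', h⟩ := h
  exact Quot.sound (.tail k hk γ γ' s s' h)

theorem mk_eq_of_facing {k : ℕ} (hk : 1 ≤ k ∧ k ≤ n) (hkn : k < n) {γ γ' : ZRay d k}
    (h : Facing γ γ') :
    (Quot.mk _ (.ray k hk γ) : ZCompletion d) = Quot.mk _ (.ray k hk γ') := by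
  obtain ⟨δ, h1, h2, h3⟩ := h
  exact Quot.sound (.facing k hk hkn γ γ' δ h1 h2 h3)

variable [NeZero n]

/-- The element `1` of the half-line of `ℤᵏ`. -/
def halfLineOne {k : ℕ} (hk : 1 ≤ k) : halfLine n k := ⟨one, one_pos.le, inZ_one hk⟩

/-- A ray that runs in the trace of another ray from some point on is cofinal with it. -/
theorem cofinal_of_subset {k : ℕ} (hk : 1 ≤ k) {γ γ' : ZRay d k} {s : halfLine n k}
    (h : ∀ t, ∃ τ, γ.toFun (s + t) = γ'.toFun τ) : Cofinal γ γ' := by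
  choose τ hτ using h
  have h1 : ∀ t u, |(τ t : ZLex n) - τ u| = |(t : ZLex n) - u| := fun t u => by
    rw [← γ'.isometry, ← hτ, ← hτ, γ.isometry]
    congr 1
    change ((s : ZLex n) + t) - (s + u) = _
    abel
  refine ⟨s, τ 0, fun t => ?_⟩
  rw [hτ]
  congr 1
  apply Subtype.ext
  change (τ t : ZLex n) = τ 0 + t
  have h2 := h1 t 0
  -- The parameter change `τ` preserves distances, so `τ t` is `τ 0 + t` or `τ 0 - t`. At a
  -- parameter larger than `τ 0` the minus sign is impossible; comparison with such a parameter
  -- excludes it at `t` as well.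
  have h3 := h1 (τ 0 + t + halfLineOne hk) 0
  have h4 := h1 (τ 0 + t + halfLineOne hk) t
  have e1 : ((τ 0 + t + halfLineOne hk : halfLine n k) : ZLex n) = (τ 0 : ZLex n) + (t : ZLex n) + one := rfl
  have e2 : ((0 : halfLine n k) : ZLex n) = 0 := rfl
  rw [e1] at h3 h4
  rw [e2] at h2 h3
  have h5 := t.2.1
  have h6 := (τ 0).2.1
  have h7 := (τ (τ 0 + t + halfLineOne hk)).2.1
  have h8 := (τ t).2.1
  have h9 : (0 : ZLex n) < one := one_pos
  generalize (τ (τ 0 + t + halfLineOne hk) : ZLex n) = a at *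
  generalize (τ t : ZLex n) = b at *
  generalize (τ 0 : ZLex n) = c at *
  generalize (t : ZLex n) = e at *
  generalize (one : ZLex n) = o at *
  simp only [abs_eq_max_neg] at *
  grind

/-- With `Cofinal.filter_eq`, this lets an end be replaced by its filter of vertices, on which the
group acts without any quotient. -/
theorem cofinal_of_filter_eq {k : ℕ} (hk : 1 ≤ k) {γ γ' : ZRay d k}
    (h : Filter.map γ.toFun atTop = Filter.map γ'.toFun atTop) : Cofinal γ γ' := by
  have h1 : ∀ᶠ u in Filter.map γ'.toFun atTop, ∃ τ, u = γ'.toFun τ := by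
    rw [eventually_map]
    exact Eventually.of_forall fun t => ⟨t, rfl⟩
  rw [← h, eventually_map, halfLine_eventually] at h1
  obtain ⟨s, hs⟩ := h1
  exact cofinal_of_subset hk hs

end Rays

/-! ### Rays on the two sides of an edge between subtrees, and the identifications they cause -/

namespace IsZTree

variable {n : ℕ} [NeZero n] {V : Type*} {d : V → V → ZLex n} (T : IsZTree d)

include T

theorem facing_symm {k : ℕ} {γ γ' : ZRay d k} (h : Facing γ γ') : Facing γ' γ := by
  obtain ⟨δ, h1, h2, h3⟩ := h
  refine ⟨δ, h1, h2, fun s t => ?_⟩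
  rw [T.symm, h3]; abel

theorem toward_of_facing {k : ℕ} {γ γ' : ZRay d k} (h : Facing γ γ') (t : halfLine n k) :
    Toward γ (γ'.toFun t) := by
  obtain ⟨δ, h1, h2, h3⟩ := h
  intro s
  unfold OnSeg
  rw [T.ray_dist_zero, h3, h3]
  change δ - 0 - t = _
  abel

theorem toward_iff {k : ℕ} {γ : ZRay d k} {w : V} :
    Toward γ w ↔ ∀ t, d w (γ.toFun t) = d w (γ.toFun 0) - t := by
  unfold Toward OnSeg
  refine forall_congr' fun s => ?_
  rw [T.ray_dist_zero, T.symm w, T.symm w, eq_sub_iff_add_eq', eq_comm]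

theorem not_inZ_of_toward {k : ℕ} (hk : 1 ≤ k) {γ : ZRay d k} {w : V} (h : Toward γ w) :
    ¬ InZ k (d (γ.toFun 0) w) :=
  not_inZ_of_forall_le hk fun s => by
    have := T.le_of_onSeg (h s)
    rwa [T.ray_dist_zero] at this

/-- The points of `[v, w]` at distances in `ℤᵏ` from `v` form the ray, since `d v w` exceeds all of
`ℤᵏ`. -/
theorem exists_toward {k : ℕ} {v w : V} (h : ¬ InZ k (d v w)) :
    ∃ γ : ZRay d k, γ.toFun 0 = v ∧ Toward γ w := by
  have pts : ∀ t : halfLine n k, ∃ z, d v z = t ∧ OnSeg d v z w := fun t =>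
    T.geod _ _ _ t.2.1 (lt_of_not_inZ (T.nonneg _ _) h t.2.2).le
  choose z hz1 hz2 using pts
  have h0 : z 0 = v := (T.eq_of _ _ (hz1 0)).symm
  refine ⟨⟨z, fun s t => ?_⟩, h0, fun s => ?_⟩
  · rcases le_total (s : ZLex n) t with h | h
    · have := T.onSeg_of_le (hz2 s) (hz2 t) (by rwa [hz1, hz1])
      unfold OnSeg at this
      rw [hz1, hz1] at this
      rw [abs_sub_comm, abs_of_nonneg (sub_nonneg.mpr h), this]; abel
    · have := T.onSeg_of_le (hz2 t) (hz2 s) (by rwa [hz1, hz1])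
      unfold OnSeg at this
      rw [hz1, hz1] at this
      rw [T.symm, abs_of_nonneg (sub_nonneg.mpr h), this]; abel
  · change OnSeg d (z 0) (z s) w
    rw [h0]
    exact hz2 s

/-- Each initial part is shorter than the segment modulo `ℤᵏ`, so the points of the two rays never
pass each other on it. -/
theorem facing_of_toward {k : ℕ} (hk : 1 ≤ k) {γ γ' : ZRay d k} (h : Toward γ (γ'.toFun 0))
    (h' : Toward γ' (γ.toFun 0)) (h1 : InZ (k + 1) (d (γ.toFun 0) (γ'.toFun 0)))
    (h2 : coord (d (γ.toFun 0) (γ'.toFun 0)) k = 1) : Facing γ γ' := by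
  refine ⟨_, h2, h1, fun s t => ?_⟩
  have hle := lt_of_not_inZ (T.nonneg _ _) (T.not_inZ_of_toward hk h) (s.2.2.add t.2.2)
  have e0 := T.toward_iff.mp h' t
  have e1 := T.onSeg_of_le (h s) (T.onSeg_symm (h' t)) (by
    rw [T.ray_dist_zero, e0]
    exact le_sub_iff_add_le.mpr hle.le)
  unfold OnSeg at e1
  rw [e0, T.ray_dist_zero] at e1
  rw [sub_right_comm, e1]; abel

/-- The rays that run between two `ℤᵏ`-subtrees are cofinal. -/
theorem cofinal_of_toward {k : ℕ} (hk : 1 ≤ k) {γ γ' : ZRay d k} {w w' : V} (h : Toward γ w)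
    (h' : Toward γ' w') (h0 : InZ k (d (γ.toFun 0) (γ'.toFun 0))) (hw : InZ k (d w w')) :
    Cofinal γ γ' := by
  -- Beyond this parameter a point of `γ` is too far from `γ 0` to lie on `[γ 0, γ' 0]`, so it lies
  -- on `[γ' 0, w]`. It is not within `ℤᵏ` of `w`, hence not on `[w, w']`, and so it lies on `[γ' 0,
  -- w']`, which starts with `γ'`.
  refine cofinal_of_subset hk (s := ⟨_, T.nonneg _ _, h0⟩ + halfLineOne hk) fun t => ?_
  set s : halfLine n k := ⟨d (γ.toFun 0) (γ'.toFun 0), T.nonneg _ _, h0⟩ + halfLineOne hk + t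
    with hs
  have e1 : (s : ZLex n) = d (γ.toFun 0) (γ'.toFun 0) + one + (t : ZLex n) := rfl
  have h1 : OnSeg d (γ'.toFun 0) (γ.toFun s) w := by
    rcases T.cut (h s) (γ'.toFun 0) with h1 | h1
    · have := T.le_of_onSeg h1
      rw [T.ray_dist_zero, e1, add_assoc] at this
      have h2 : (0 : ZLex n) < one + (t : ZLex n) :=
        add_pos_of_pos_of_nonneg ZLex.one_pos t.2.1
      exact absurd this (not_le.mpr (lt_add_of_pos_right _ h2))
    · exact h1
  have h2 : OnSeg d (γ'.toFun 0) (γ.toFun s) w' := by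
    rcases T.cut (T.onSeg_symm h1) w' with h2 | h2
    · have h3 := hw.of_le (T.nonneg _ _) (T.le_of_onSeg h2)
      exact absurd (T.inZ_trans (T.ray_inZ γ 0 s) (T.inZ_symm h3)) (T.not_inZ_of_toward hk h)
    · exact T.onSeg_symm h2
  have h3 : InZ k (d (γ'.toFun 0) (γ.toFun s)) :=
    T.inZ_trans (T.inZ_symm h0) (T.ray_inZ γ 0 s)
  refine ⟨⟨_, T.nonneg _ _, h3⟩, T.eq_of_onSeg h2 (h' _) ?_⟩
  rw [T.ray_dist_zero]

/-- An end faces at most one end. -/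
theorem cofinal_of_facing {k : ℕ} (hk : 1 ≤ k) {γ₁ γ₂ γ₁' γ₂' : ZRay d k} (h₁ : Facing γ₁ γ₁')
    (h₂ : Facing γ₂ γ₂') (h : Cofinal γ₁ γ₂) : Cofinal γ₁' γ₂' := by
  obtain ⟨s₁, s₂, hs⟩ := h
  have e0 := hs 0
  rw [add_zero, add_zero] at e0
  refine T.cofinal_of_toward hk (T.toward_of_facing (T.facing_symm h₁) s₁)
    (T.toward_of_facing (T.facing_symm h₂) s₂) ?_ (by rw [e0]; exact T.inZ_self k _)
  obtain ⟨δ₁, a1, a2, a3⟩ := h₁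
  obtain ⟨δ₂, b1, b2, b3⟩ := h₂
  set v := γ₁.toFun s₁ with hv
  -- Both segments from `v` follow the whole ray `γ₁`, so they part at a point `m` not within `ℤᵏ`
  -- of `v`. The coordinate `k` of either length is `1`, so what remains after `m` lies in `ℤᵏ`.
  obtain ⟨m, hm1, hm2, hm3⟩ := T.median (γ₁'.toFun 0) v (γ₂'.toFun 0)
  have c1 : d v (γ₁'.toFun 0) = δ₁ - s₁ := by
    rw [hv, a3]; change _ - (0 : ZLex n) = _; abel
  have c2 : d v (γ₂'.toFun 0) = δ₂ - s₂ := by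
    rw [e0, b3]; change _ - (0 : ZLex n) = _; abel
  have hmk : ¬ InZ k (d v m) := not_inZ_of_forall_le hk fun t => by
    have c3 : d v (γ₁.toFun (s₁ + t)) = t := T.ray_dist γ₁ s₁ t
    have c4 : d (γ₁.toFun (s₁ + t)) (γ₁'.toFun 0) = δ₁ - s₁ - t := by
      rw [a3]; change _ - ((s₁ : ZLex n) + t) - (0 : ZLex n) = _; abel
    have c5 : d (γ₁.toFun (s₁ + t)) (γ₂'.toFun 0) = δ₂ - s₂ - t := by
      rw [hs, b3]; change _ - ((s₂ : ZLex n) + t) - (0 : ZLex n) = _; abel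
    have c6 := T.triangle (γ₁'.toFun 0) (γ₁.toFun (s₁ + t)) (γ₂'.toFun 0)
    have c7 := T.symm (γ₁'.toFun 0) (γ₁.toFun (s₁ + t))
    have c8 := T.symm (γ₁'.toFun 0) v
    have c9 := T.symm (γ₁'.toFun 0) m
    have c10 := T.symm m v
    unfold OnSeg at *
    have c11 : d v m + d v m ≥ (t : ZLex n) + t := by grind
    by_contra hlt
    rw [not_le] at hlt
    exact absurd c11 (not_le.mpr (add_lt_add hlt hlt))
  have key : ∀ {w : V} {δ : ZLex n} {s : halfLine n k}, coord δ k = 1 → InZ (k + 1) δ →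
      d v w = δ - s → OnSeg d v m w → InZ k (d m w) := by
    intro w δ s h1 h2 h3 h4
    have i1 : InZ (k + 1) (d v w) := by rw [h3]; exact h2.sub (s.2.2.mono (Nat.le_succ k))
    have i2 : InZ (k + 1) (d v m) := i1.of_le (T.nonneg _ _) (T.le_of_onSeg h4)
    have i3 : InZ (k + 1) (d m w) := i1.of_le (T.nonneg _ _) (by
      rw [h4]; exact le_add_of_nonneg_left (T.nonneg _ _))
    refine inZ_of_coord i3 ?_
    have j1 := coord_pos_of_inZ (T.nonneg _ _) i2 hmk
    have j2 := coord_nonneg_of_inZ (T.nonneg _ _) i3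
    have j3 : coord (d v w) k = 1 := by rw [h3, coord_sub, h1, s.2.2 k le_rfl, sub_zero]
    have j4 : coord (d v w) k = coord (d v m) k + coord (d m w) k := by rw [h4, coord_add]
    omega
  exact T.inZ_trans (T.inZ_symm (key a1 a2 c1 (T.onSeg_symm hm1))) (key b1 b2 c2 hm2)

/-- A point of the completion is represented by at most two filters of vertices. -/
theorem finite_filters (x : ZCompletion d) :
    {f : Filter V | ∃ a : PrePoint d, Quot.mk _ a = x ∧ a.filter = f}.Finite := by
  induction x using Quot.ind with | _ a
  -- The equivalence generated by the relations is controlled through properties invariant under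
  -- each generator: having one of two filters for a glued end, and having the same filter for any
  -- other point.
  by_cases H : ∃ (k : ℕ) (hk : 1 ≤ k ∧ k ≤ n) (γ γ' : ZRay d k), Facing γ γ' ∧
      (Quot.mk _ (.ray k hk γ) : ZCompletion d) = Quot.mk _ a
  · obtain ⟨k, hk, γ, γ', hf, ha⟩ := H
    refine (Set.toFinite {Filter.map γ.toFun atTop, Filter.map γ'.toFun atTop}).subset ?_
    rintro f ⟨b, hb, rfl⟩
    have key : ∀ a b : PrePoint d, Relation.EqvGen (PrePoint.Rel d) a b →
        ((a.type = k ∧ (a.filter = Filter.map γ.toFun atTop ∨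
          a.filter = Filter.map γ'.toFun atTop)) ↔ (b.type = k ∧
        (b.filter = Filter.map γ.toFun atTop ∨ b.filter = Filter.map γ'.toFun atTop))) := by
      intro a b hab
      induction hab with
      | rel a b h =>
        cases h with
        | tail l hl γ₁ γ₂ s s' h =>
          have : (PrePoint.ray l hl γ₁).filter = (PrePoint.ray l hl γ₂).filter :=
            Cofinal.filter_eq ⟨s, s', h⟩
          rw [this]
          exact Iff.rfl
        | facing l hl hln γ₁ γ₂ δ h1 h0 h =>
          have h12 : Facing γ₁ γ₂ := ⟨δ, h1, h0, h⟩
          have main : ∀ γ₁ γ₂ : ZRay d l, Facing γ₁ γ₂ → l = k →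
              (Filter.map γ₁.toFun atTop = Filter.map γ.toFun atTop ∨
              Filter.map γ₁.toFun atTop = Filter.map γ'.toFun atTop) →
              (Filter.map γ₂.toFun atTop = Filter.map γ.toFun atTop ∨
              Filter.map γ₂.toFun atTop = Filter.map γ'.toFun atTop) := by
            rintro γ₁ γ₂ h12 rfl (h | h)
            · exact Or.inr (T.cofinal_of_facing hl.1 h12 hf
                (cofinal_of_filter_eq hl.1 h)).filter_eq
            · exact Or.inl (T.cofinal_of_facing hl.1 h12 (T.facing_symm hf)
                (cofinal_of_filter_eq hl.1 h)).filter_eq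
          exact ⟨fun h => ⟨h.1, main γ₁ γ₂ h12 h.1 h.2⟩,
            fun h => ⟨h.1, main γ₂ γ₁ (T.facing_symm h12) h.1 h.2⟩⟩
      | refl a => exact Iff.rfl
      | symm a b _ ih => exact ih.symm
      | trans a b c _ _ ih1 ih2 => exact ih1.trans ih2
    exact ((key _ _ (Quot.eqvGen_exact (ha.trans hb.symm))).mp ⟨rfl, Or.inl rfl⟩).2
  · refine (Set.finite_singleton a.filter).subset ?_
    rintro f ⟨b, hb, rfl⟩
    have key : ∀ a b : PrePoint d, Relation.EqvGen (PrePoint.Rel d) a b →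
        (¬ ∃ (k : ℕ) (hk : 1 ≤ k ∧ k ≤ n) (γ γ' : ZRay d k), Facing γ γ' ∧
          (Quot.mk _ (.ray k hk γ) : ZCompletion d) = Quot.mk _ a) → a.filter = b.filter := by
      intro a b hab
      induction hab with
      | rel a b h =>
        intro H
        cases h with
        | tail l hl γ₁ γ₂ s s' h =>
          exact Cofinal.filter_eq ⟨s, s', h⟩
        | facing l hl hln γ₁ γ₂ δ h1 h0 h =>
          exact absurd ⟨l, hl, γ₁, γ₂, ⟨δ, h1, h0, h⟩, rfl⟩ H
      | refl a => exact fun _ => rfl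
      | symm a b hab ih =>
        intro H
        refine (ih ?_).symm
        rwa [Quot.eqvGen_sound hab]
      | trans a b c hab _ ih1 ih2 =>
        intro H
        refine (ih1 H).trans (ih2 ?_)
        rwa [← Quot.eqvGen_sound hab]
    exact (key _ _ (Quot.eqvGen_exact hb.symm) H).symm

/-- The points of the completion beyond a vertex `q`, seen from `o`, do not depend on their
representatives. -/
theorem beyond_of_rel {o q : V} {a b : PrePoint d} (h : (Quot.mk _ a : ZCompletion d) = Quot.mk _ b)
    (ha : ∀ᶠ u in a.filter, OnSeg d o q u) : ∀ᶠ u in b.filter, OnSeg d o q u := by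
  have main : ∀ {k : ℕ} (hk : 1 ≤ k ∧ k ≤ n) {γ₁ γ₂ : ZRay d k}, Facing γ₁ γ₂ →
      (∀ᶠ u in (PrePoint.ray k hk γ₁).filter, OnSeg d o q u) →
      ∀ᶠ u in (PrePoint.ray k hk γ₂).filter, OnSeg d o q u := by
    intro k hk γ₁ γ₂ hf h
    obtain ⟨δ, h1, h0, hd⟩ := hf
    rw [ray_filter_eventually] at h ⊢
    obtain ⟨s, hs⟩ := h
    by_contra H
    push Not at H
    have near : ∀ t, ¬ OnSeg d o q (γ₂.toFun t) → ∀ u,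
        OnSeg d (γ₂.toFun t) q (γ₁.toFun (s + u)) := fun t ht u =>
      (T.cut (hs u) (γ₂.toFun t)).resolve_left ht
    obtain ⟨t, ht⟩ := H 0
    -- The vertex `q` precedes all points of `γ₁` from `s` on, seen from `γ₂`. The jump between the
    -- rays is `1` in the coordinate `k` and is used up after `q`.
    have h2 : InZ k (d (γ₂.toFun (0 + t)) q) := by
      have hsmall : ∀ u : halfLine n k,
          (u : ZLex n) ≤ δ - ((0 + t : halfLine n k) : ZLex n) - s - d (γ₂.toFun (0 + t)) q := by
        intro u
        have e1 := T.le_of_onSeg (near _ ht u)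
        rw [T.symm _ (γ₁.toFun _), hd] at e1
        have e2 : ((s + u : halfLine n k) : ZLex n) = s + u := rfl
        rw [e2] at e1
        grind
      have hbig := not_inZ_of_forall_le hk.1 hsmall
      by_contra hx
      have i0 := T.nonneg (γ₂.toFun (0 + t)) q
      have i1 : InZ (k + 1) (δ - ((0 + t : halfLine n k) : ZLex n) - (s : ZLex n)) :=
        (h0.sub ((0 + t : halfLine n k).2.2.mono (Nat.le_succ k))).sub (s.2.2.mono (Nat.le_succ k))
      have i2 : InZ (k + 1) (d (γ₂.toFun (0 + t)) q) :=
        i1.of_le i0 (sub_nonneg.mp (hsmall 0))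
      have j1 := coord_pos_of_inZ i0 i2 hx
      have j2 := coord_pos_of_inZ (hsmall 0) (i1.sub i2) hbig
      rw [coord_sub, coord_sub, coord_sub, h1, s.2.2 k le_rfl,
        (0 + t : halfLine n k).2.2 k le_rfl] at j2
      omega
    -- Moving along `γ₂` by more than its distance to `q` would carry it past `q`, which is
    -- incompatible with `q` still lying between the two rays.
    obtain ⟨t', ht'⟩ := H (0 + t + ⟨_, T.nonneg _ _, h2⟩ + halfLineOne hk.1)
    have e1 := near _ ht 0
    have e2 := near _ ht' 0
    have e3 := T.nonneg (γ₂.toFun (0 + t + ⟨_, T.nonneg _ _, h2⟩ + halfLineOne hk.1 + t')) q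
    unfold OnSeg at e1 e2
    rw [T.symm _ (γ₁.toFun _), hd] at e1 e2
    have e4 : (((0 + t + ⟨_, T.nonneg _ _, h2⟩ + halfLineOne hk.1 + t' : halfLine n k)) : ZLex n) =
      ((0 + t : halfLine n k) : ZLex n) + d (γ₂.toFun (0 + t)) q + one + (t' : ZLex n) := rfl
    rw [e4] at e2
    have e5 := t'.2.1
    have e6 : (0 : ZLex n) < one := one_pos
    grind
  have key : ∀ a b : PrePoint d, Relation.EqvGen (PrePoint.Rel d) a b →
      ((∀ᶠ u in a.filter, OnSeg d o q u) ↔ ∀ᶠ u in b.filter, OnSeg d o q u) := by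
    intro a b hab
    induction hab with
    | rel a b h =>
      cases h with
      | tail l hl γ₁ γ₂ s s' h =>
        have : (PrePoint.ray l hl γ₁).filter = (PrePoint.ray l hl γ₂).filter :=
          Cofinal.filter_eq ⟨s, s', h⟩
        rw [this]
      | facing l hl hln γ₁ γ₂ δ h1 h0 h =>
        have h12 : Facing γ₁ γ₂ := ⟨δ, h1, h0, h⟩
        exact ⟨main hl h12, main hl (T.facing_symm h12)⟩
    | refl a => exact Iff.rfl
    | symm a b _ ih => exact ih.symm
    | trans a b c _ _ ih1 ih2 => exact ih1.trans ih2
  exact (key _ _ (Quot.eqvGen_exact h)).mp ha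

end IsZTree

/-! ### Geodesics between points of the completion -/

namespace IsZTree

variable {n : ℕ} [NeZero n] {V : Type*} {d : V → V → ZLex n} (T : IsZTree d)

include T

theorem ray_onSeg {k : ℕ} (γ : ZRay d k) {s t : halfLine n k} (h : s ≤ t) :
    OnSeg d (γ.toFun 0) (γ.toFun s) (γ.toFun t) := by
  obtain ⟨u, rfl⟩ := halfLine_exists_add h
  unfold OnSeg
  rw [T.ray_dist_zero, T.ray_dist_zero, T.ray_dist]
  rfl

/-- If the segments from `γ' 0` to `γ` run through all points of `γ'` and vice versa, and if the
distances increase, then `γ` runs in the trace of `γ'` from some point on. -/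
theorem subset_of_increasing {k l : ℕ} (hl : 1 ≤ l) {γ : ZRay d k} {γ' : ZRay d l}
    (h1 : ∀ t, ∀ᶠ s in atTop, OnSeg d (γ'.toFun 0) (γ'.toFun t) (γ.toFun s))
    (h2 : ∀ s, ∀ᶠ t in atTop, OnSeg d (γ.toFun 0) (γ.toFun s) (γ'.toFun t))
    {s₀ : halfLine n k} {t₀ : halfLine n l}
    (h3 : ∀ s, d (γ'.toFun 0) (γ.toFun (s₀ + s)) = d (γ'.toFun 0) (γ.toFun s₀) + s)
    (h4 : ∀ t, d (γ.toFun 0) (γ'.toFun (t₀ + t)) = d (γ.toFun 0) (γ'.toFun t₀) + t)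
    (s : halfLine n k) : ∃ τ, γ.toFun (s₀ + s) = γ'.toFun τ := by
  obtain ⟨t₁, ht₁⟩ := halfLine_eventually.mp (h2 (s₀ + s))
  have compare : ∀ t, ∃ z, OnSeg d (γ'.toFun 0) (γ'.toFun t) z ∧
      OnSeg d (γ'.toFun 0) (γ.toFun (s₀ + s)) z := by
    intro t
    obtain ⟨s₁, hs₁⟩ := halfLine_eventually.mp (h1 t)
    refine ⟨γ.toFun (s₁ + (s₀ + s)), hs₁ _, ?_⟩
    have e := T.ray_increasing_add h3 s s₁
    have e2 := T.ray_dist γ (s₀ + s) s₁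
    rw [add_comm s₁]
    unfold OnSeg
    rw [e, e2]
  by_cases H : ∃ t : halfLine n l, d (γ'.toFun 0) (γ.toFun (s₀ + s)) ≤ t
  · obtain ⟨t, ht⟩ := H
    obtain ⟨z, hz1, hz2⟩ := compare t
    have h5 := T.onSeg_of_le hz2 hz1 (by rwa [T.ray_dist_zero])
    have h6 : InZ l (d (γ'.toFun 0) (γ.toFun (s₀ + s))) := t.2.2.of_le (T.nonneg _ _) ht
    have h7 : (⟨_, T.nonneg _ _, h6⟩ : halfLine n l) ≤ t := ht
    exact ⟨_, T.eq_of_onSeg h5 (T.ray_onSeg γ' h7) (by rw [T.ray_dist_zero])⟩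
  -- All points of `γ'` would come before `γ (s₀ + s)`, so along `γ'` the distance from `γ 0` would
  -- eventually decrease, against `h4`.
  · exfalso
    push Not at H
    have h5 : ∀ u, d (γ.toFun 0) (γ'.toFun (t₀ + (t₁ + u))) =
        (s₀ + s : halfLine n k) + (d (γ'.toFun 0) (γ.toFun (s₀ + s)) -
          (t₀ + (t₁ + u) : halfLine n l)) := by
      intro u
      obtain ⟨z, hz1, hz2⟩ := compare (t₀ + (t₁ + u))
      have h6 := T.onSeg_of_le hz1 hz2 (by rw [T.ray_dist_zero]; exact (H _).le)
      have h7 := ht₁ (t₀ + u)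
      rw [← add_assoc, add_comm t₁, add_assoc] at h7
      unfold OnSeg at h6 h7
      rw [T.ray_dist_zero] at h6 h7
      rw [h7, h6, T.symm (γ.toFun _)]
      abel
    have e1 := h5 0
    have e2 := h5 (halfLineOne hl)
    rw [h4] at e1 e2
    have e3 : ((t₁ + 0 : halfLine n l) : ZLex n) = t₁ := by rw [add_zero]
    have e4 : ((t₁ + halfLineOne hl : halfLine n l) : ZLex n) = (t₁ : ZLex n) + one := rfl
    have e5 : ((t₀ + (t₁ + 0) : halfLine n l) : ZLex n) = (t₀ : ZLex n) + t₁ := by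
      rw [add_zero]; rfl
    have e6 : ((t₀ + (t₁ + halfLineOne hl) : halfLine n l) : ZLex n) =
      (t₀ : ZLex n) + ((t₁ : ZLex n) + one) := rfl
    have e7 : (0 : ZLex n) < one := ZLex.one_pos
    rw [e3, e5] at e1
    rw [e4, e6] at e2
    grind

theorem le_of_ray_subset {k l : ℕ} (hk : k ≤ n) {γ : ZRay d k} {γ' : ZRay d l} {s₀ : halfLine n k}
    (h : ∀ s, ∃ τ, γ.toFun (s₀ + s) = γ'.toFun τ) : k ≤ l := by
  by_contra hlt
  rw [not_le] at hlt
  have hln : l < n := by omega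
  obtain ⟨τ, hτ⟩ := h ⟨unit n l, (unit_pos hln).le, (inZ_unit hln).mono hlt⟩
  obtain ⟨τ', hτ'⟩ := h 0
  rw [add_zero] at hτ'
  have h1 := T.ray_dist γ s₀ ⟨unit n l, (unit_pos hln).le, (inZ_unit hln).mono hlt⟩
  rw [hτ, hτ'] at h1
  have h2 := T.ray_inZ γ' τ' τ
  rw [h1] at h2
  exact not_inZ_unit hln h2

/-- The geodesic between two distinct points of the completion contains a vertex. -/
theorem exists_onGeodesic {x y : ZCompletion d} (hxy : x ≠ y) : ∃ p, OnGeodesic p x y := by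
  induction x using Quot.ind with | _ a
  induction y using Quot.ind with | _ b
  by_contra H
  have H' : ∀ p, ¬ ∀ᶠ u in a.filter, ∀ᶠ w in b.filter, OnSeg d u p w := fun p hp =>
    H ⟨p, a, b, rfl, rfl, hp⟩
  cases a with
  | vertex v =>
    refine H' v ?_
    rw [vertex_filter_eventually]
    exact Eventually.of_forall fun w => T.onSeg_left v w
  | ray k hk γ =>
  cases b with
  | vertex v =>
    refine H' v (Eventually.of_forall fun w => ?_)
    rw [vertex_filter_eventually]
    exact T.onSeg_right w v
  | ray l hl γ' =>
  -- A point of `γ'` that is not eventually between `γ' 0` and `γ` would lie on the geodesic.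
  have h1 : ∀ t, ∀ᶠ s in atTop, OnSeg d (γ'.toFun 0) (γ'.toFun t) (γ.toFun s) := by
    intro t
    refine T.ray_eventually_onSeg γ fun h => H' (γ'.toFun t) ?_
    obtain ⟨s₀, hs₀⟩ := halfLine_eventually.mp h
    rw [ray_filter_eventually]
    refine ⟨s₀, fun s => ?_⟩
    rw [ray_filter_eventually]
    refine ⟨t, fun u => ?_⟩
    exact (T.cut (T.ray_onSeg γ' (halfLine_le_add t u)) _).resolve_left (hs₀ s)
  have h2 : ∀ s, ∀ᶠ t in atTop, OnSeg d (γ.toFun 0) (γ.toFun s) (γ'.toFun t) := by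
    intro s
    refine T.ray_eventually_onSeg γ' fun h => H' (γ.toFun s) ?_
    obtain ⟨t₀, ht₀⟩ := halfLine_eventually.mp h
    rw [ray_filter_eventually]
    refine ⟨s, fun u => ?_⟩
    rw [ray_filter_eventually]
    refine ⟨t₀, fun t => ?_⟩
    exact T.onSeg_symm ((T.cut (T.ray_onSeg γ (halfLine_le_add s u)) _).resolve_left (ht₀ t))
  -- If `γ'` runs toward `γ 0`, then all points of `γ` lie on `[γ 0, γ' 0]`, so `γ` cannot move away
  -- from `γ' 0`.
  have mixed : ∀ {k l : ℕ}, 1 ≤ k → ∀ {γ : ZRay d k} {γ' : ZRay d l},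
      (∀ s, ∀ᶠ t in atTop, OnSeg d (γ.toFun 0) (γ.toFun s) (γ'.toFun t)) →
      (∃ s₀, ∀ s, d (γ'.toFun 0) (γ.toFun (s₀ + s)) = d (γ'.toFun 0) (γ.toFun s₀) + s) →
      (∀ t, d (γ.toFun 0) (γ'.toFun t) = d (γ.toFun 0) (γ'.toFun 0) - t) → False := by
    rintro k l hk γ γ' h2 ⟨s₀, h3⟩ h4
    have h5 : ∀ s, OnSeg d (γ.toFun 0) (γ.toFun s) (γ'.toFun 0) := fun s => by
      obtain ⟨t, ht⟩ := (h2 s).exists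
      refine T.onSeg_trans (T.onSeg_symm ?_) ht
      exact T.toward_iff.mpr h4 t
    have e1 := h5 s₀
    have e2 := h5 (s₀ + halfLineOne hk)
    unfold OnSeg at e1 e2
    rw [T.symm _ (γ'.toFun 0), T.symm _ (γ'.toFun 0), T.ray_dist_zero] at e1 e2
    rw [h3] at e2
    have e3 : ((s₀ + halfLineOne hk : halfLine n k) : ZLex n) = (s₀ : ZLex n) + one := rfl
    have e4 : ((halfLineOne hk : halfLine n k) : ZLex n) = one := rfl
    have e7 : (0 : ZLex n) < one := ZLex.one_pos
    rw [e3, e4] at e2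
    grind
  -- Two rays that eventually recede from each other's origins are cofinal. Two rays that run toward
  -- each other are facing, or leave room for a vertex between them.
  rcases T.ray_dichotomy γ (γ'.toFun 0) with ⟨s₀, h3⟩ | h3 <;>
    rcases T.ray_dichotomy γ' (γ.toFun 0) with ⟨t₀, h4⟩ | h4
  · have i1 := T.subset_of_increasing hl.1 h1 h2 h3 h4
    have i2 := T.subset_of_increasing hk.1 h2 h1 h4 h3
    obtain rfl := le_antisymm (T.le_of_ray_subset hk.2 i1) (T.le_of_ray_subset hl.2 i2)
    exact hxy (mk_eq_of_cofinal hk (cofinal_of_subset hk.1 i1))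
  · exact mixed hk.1 h2 ⟨s₀, h3⟩ h4
  · exact mixed hl.1 h1 ⟨t₀, h4⟩ h3
  · set D := d (γ.toFun 0) (γ'.toFun 0) with hD
    have seg1 : ∀ s, OnSeg d (γ.toFun 0) (γ.toFun s) (γ'.toFun 0) := T.toward_iff.mpr h3
    have seg2 : ∀ t, OnSeg d (γ.toFun 0) (γ'.toFun t) (γ'.toFun 0) := fun t =>
      T.onSeg_symm (T.toward_iff.mpr h4 t)
    have hle : ∀ (s : halfLine n k) (t : halfLine n l), (s : ZLex n) ≤ D - t := by
      intro s t
      obtain ⟨t₁, ht₁⟩ := halfLine_eventually.mp (h2 s)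
      have e1 := T.le_of_onSeg (ht₁ t)
      rw [T.ray_dist_zero, h4] at e1
      refine e1.trans (sub_le_sub_left ?_ _)
      exact le_add_of_nonneg_left t₁.2.1
    have hkD : ¬ InZ k D := not_inZ_of_forall_le hk.1 fun s =>
      (hle s 0).trans (sub_le_self _ le_rfl)
    have hlD : ¬ InZ l D := not_inZ_of_forall_le hl.1 fun t => by
      have := sub_nonneg.mpr (hle 0 t)
      exact sub_nonneg.mp (this.trans (sub_le_self _ le_rfl))
    by_cases hsplit : k = l ∧ InZ (k + 1) D ∧ coord D k = 1
    · obtain ⟨rfl, hD1, hD2⟩ := hsplit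
      refine hxy (mk_eq_of_facing hk ?_ (T.facing_of_toward hk.1 seg1
        (T.toward_iff.mpr h4) hD1 hD2))
      by_contra hkn
      exact hkD ((inZ_top D).mono (by omega))
    · obtain ⟨x, hx0, hxD, hxk, hxl⟩ := exists_split (T.nonneg _ _) hkD hlD hsplit
      obtain ⟨p, hp1, hp2⟩ := T.geod _ _ x hx0 hxD
      have hpD : d p (γ'.toFun 0) = D - x := by rw [hD, hp2, hp1]; abel
      have main : ∀ s t, OnSeg d (γ.toFun s) p (γ'.toFun t) := fun s t => by
        have e1 : OnSeg d (γ.toFun 0) (γ.toFun s) p := T.onSeg_of_le (seg1 s) hp2 (by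
          rw [T.ray_dist_zero, hp1]; exact (lt_of_not_inZ hx0 hxk s.2.2).le)
        refine T.onSeg_trans' (T.onSeg_of_le hp2 (seg2 t) ?_) e1
        have := lt_of_not_inZ (sub_nonneg.mpr hxD) hxl t.2.2
        rw [h4, hp1]
        exact (le_sub_comm.mp this.le)
      refine H' p ?_
      rw [ray_filter_eventually]
      refine ⟨0, fun s => ?_⟩
      rw [ray_filter_eventually]
      exact ⟨0, fun t => main _ _⟩

/-! ### The metric of the completion -/

theorem isZSubtree_class (k : ℕ) (v : V) : IsZSubtree d k {w | InZ k (d v w)} := ⟨v, rfl⟩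

theorem class_eq {k : ℕ} {S : Set V} (hS : IsZSubtree d k S) {v : V} (hv : v ∈ S) :
    S = {w | InZ k (d v w)} := by
  obtain ⟨u, rfl⟩ := hS
  ext w
  exact ⟨fun h => T.inZ_trans (T.inZ_symm hv) h, fun h => T.inZ_trans hv h⟩

theorem isZSubtree_univ [Nonempty V] : IsZSubtree d n Set.univ :=
  ⟨Classical.arbitrary V, (Set.eq_univ_of_forall fun _ => inZ_top _).symm⟩

theorem scale_ne_zero (D : MetricData d) (k : ℕ) (S S' : Set V) : D.scale k S S' ≠ 0 := by
  unfold MetricData.scale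
  split
  · exact one_ne_zero
  · exact pow_ne_zero _ (by simp)

/-- The distance of two points is bounded below in terms of any vertex between them. -/
theorem exists_le_subDist (D : MetricData d) (p : V) (k : ℕ) (S : Set V)
    (hS : IsZSubtree d (k + 1) S) (hp : p ∈ S) :
    ∃ c > 0, ∀ x y : ZCompletion d, x ≠ y → OnGeodesic p x y → c ≤ D.subDist (k + 1) S x y := by
  induction k generalizing S with
  | zero =>
    refine ⟨ENNReal.ofReal (Real.exp (-(coord (d (D.base 1 S) p) 0 : ℝ))),
      ENNReal.ofReal_pos.mpr (Real.exp_pos _), fun x y hxy h => ?_⟩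
    rw [MetricData.subDist, if_neg hxy]
    exact le_iSup₂ (f := fun q _ => ENNReal.ofReal (Real.exp (-(coord (d (D.base 1 S) q) 0 : ℝ))))
      p ⟨hp, h⟩
  | succ k ih =>
    obtain ⟨c, hc, h⟩ := ih _ (T.isZSubtree_class (k + 1) p) (T.inZ_self _ p)
    refine ⟨D.scale (k + 1) S {w | InZ (k + 1) (d p w)} * c,
      pos_iff_ne_zero.mpr (mul_ne_zero (T.scale_ne_zero _ _ _ _) hc.ne'), fun x y hxy hp' => ?_⟩
    have hsub : {w | InZ (k + 1) (d p w)} ⊆ S := by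
      rw [T.class_eq hS hp]
      exact fun w hw => InZ.mono (Nat.le_succ _) hw
    rw [MetricData.subDist]
    refine le_trans ?_ (ENNReal.le_tsum ⟨_, T.isZSubtree_class (k + 1) p, hsub⟩)
    exact mul_le_mul_right (h x y hxy hp') _

theorem exists_le_dist (D : MetricData d) (p : V) :
    ∃ c > 0, ∀ x y : ZCompletion d, x ≠ y → OnGeodesic p x y → c ≤ D.dist x y := by
  have : Nonempty V := ⟨p⟩
  unfold MetricData.dist
  obtain ⟨k, hk⟩ := Nat.exists_eq_succ_of_ne_zero (NeZero.ne n)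
  have := T.exists_le_subDist D p k Set.univ (hk ▸ T.isZSubtree_univ) trivial
  rwa [← Nat.succ_eq_add_one, ← hk] at this

/-- The vertex `p` bounds the distance from `x` to all of `C` below by one constant. Open sets are
defined by balls around each of their points, so no triangle inequality for `D.dist` is needed. -/
theorem isClosed_of_onGeodesic (D : MetricData d) (C : Set D.Space)
    (h : ∀ x : ZCompletion d, x ∉ C → ∃ p, ∀ y : ZCompletion d, y ∈ C → OnGeodesic p x y) :
    IsClosed C := by
  rw [← isOpen_compl_iff]
  intro x hx
  obtain ⟨p, hp⟩ := h x hx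
  obtain ⟨c, hc, hle⟩ := T.exists_le_dist D p
  refine ⟨c, hc, fun y hy hyC => ?_⟩
  have hxy : (x : ZCompletion d) ≠ y := by rintro rfl; exact hx hyC
  exact absurd hy (not_lt.mpr (hle x y hxy (hp y hyC)))

theorem isClosed_singleton (D : MetricData d) (y : D.Space) : IsClosed ({y} : Set D.Space) := by
  refine T.isClosed_of_onGeodesic D _ fun x hx => ?_
  obtain ⟨p, hp⟩ := T.exists_onGeodesic (x := x) (y := (y : ZCompletion d)) hx
  refine ⟨p, fun z hz => ?_⟩
  obtain rfl : z = y := hz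
  exact hp

/-- The subtree level of a `ℤᵏ`-subtree is computed from any of its points. -/
theorem subtreeLevel_eq {k : ℕ} {v p : V} {S : Set V} (hS : IsZSubtree d k S) (hp : p ∈ S)
    (h : InZ (k + 1) (d v p)) : (subtreeLevel d k v S : ℤ) = coord (d v p) k := by
  have h1 : ∀ t ∈ S, coord (d v t) k = coord (d v p) k := fun t ht => by
    rw [T.class_eq hS hp] at ht
    have := T.inZ_sub_dist (T.inZ_symm ht) v k le_rfl
    rw [coord_sub] at this
    omega
  obtain ⟨m, hm⟩ := Int.eq_ofNat_of_zero_le (coord_nonneg_of_inZ (T.nonneg _ _) h)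
  have h2 : {m : ℕ | ∃ t ∈ S, coord (d v t) k = m} = {m} := by
    ext m'
    constructor
    · rintro ⟨t, ht, h3⟩
      rw [h1 t ht, hm] at h3
      exact (Int.ofNat_inj.mp h3).symm
    · rintro rfl
      exact ⟨p, hp, hm⟩
  unfold subtreeLevel
  rw [h2, csInf_singleton, hm]

/-- The weights `2 ^ -(l + i)` of the `ℤᵏ`-subtrees of a `ℤᵏ⁺¹`-subtree, weighted by level. -/
theorem tsum_weight_le (D : MetricData d) {k : ℕ} {S : Set V} (hS : IsZSubtree d (k + 1) S)
    (f : ℕ → ℝ≥0∞) :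
    ∑' S' : {S' : Set V // IsZSubtree d k S' ∧ S' ⊆ S},
      f (subtreeLevel d k (D.base (k + 1) S) S') * 2⁻¹ ^ (D.index k S') ≤ (∑' l, f l) * 2 := by
  -- Level and number determine the subtree, so the sum is bounded by one over `ℕ × ℕ`; the factor
  -- `2` is the sum of the weights `2⁻¹ ^ i`.
  have hinj : Function.Injective fun S' : {S' : Set V // IsZSubtree d k S' ∧ S' ⊆ S} =>
      (subtreeLevel d k (D.base (k + 1) S) S', D.index k S') := by
    rintro ⟨S₁, h1, h1'⟩ ⟨S₂, h2, h2'⟩ h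
    obtain ⟨h3, h4⟩ := Prod.mk.inj h
    exact Subtype.ext (D.index_inj k S hS S₁ S₂ h1 h2 h1' h2' h3 h4)
  refine (ENNReal.tsum_comp_le_tsum_of_injective hinj
    fun q : ℕ × ℕ => f q.1 * 2⁻¹ ^ q.2).trans ?_
  rw [ENNReal.tsum_prod (f := fun l i => f l * 2⁻¹ ^ i)]
  simp only [ENNReal.tsum_mul_left, ENNReal.tsum_mul_right, ENNReal.tsum_geometric,
    ENNReal.one_sub_inv_two, inv_inv]
  exact le_rfl

/-- The subtree `T₀` contributes `1` and the others at most `2 * 2`, the product of two geometric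
series. -/
theorem tsum_scale_le (D : MetricData d) {k : ℕ} {S : Set V} (hS : IsZSubtree d (k + 1) S) :
    ∑' S' : {S' : Set V // IsZSubtree d k S' ∧ S' ⊆ S}, D.scale k S S' ≤ 5 := by
  have hb := D.base_mem (k + 1) S hS
  have hsub : {w | InZ k (d (D.base (k + 1) S) w)} ⊆ S := by
    intro w hw
    rw [T.class_eq hS hb]
    exact InZ.mono (Nat.le_succ _) hw
  classical
  have h1 : ∀ S' : {S' : Set V // IsZSubtree d k S' ∧ S' ⊆ S}, D.scale k S S' ≤
      (if S' = ⟨_, T.isZSubtree_class k (D.base (k + 1) S), hsub⟩ then 1 else 0) +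
      2⁻¹ ^ (subtreeLevel d k (D.base (k + 1) S) S') * 2⁻¹ ^ (D.index k S') := by
    intro S'
    unfold MetricData.scale
    split
    · rename_i h
      rw [if_pos (Subtype.ext (T.class_eq S'.2.1 h))]
      exact le_self_add
    · rw [pow_add]
      exact le_add_self
  refine (ENNReal.tsum_le_tsum h1).trans ?_
  rw [ENNReal.tsum_add, tsum_ite_eq]
  refine (add_le_add_right (T.tsum_weight_le D hS fun l => 2⁻¹ ^ l) _).trans ?_
  rw [ENNReal.tsum_geometric, ENNReal.one_sub_inv_two, inv_inv]
  norm_num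

/-- The metric of a `ℤ`-subtree is at most `1`, and each further level multiplies the bound by the
total weight `5`. -/
theorem subDist_le (D : MetricData d) (k : ℕ) (S : Set V) (hS : IsZSubtree d (k + 1) S)
    (x y : ZCompletion d) : D.subDist (k + 1) S x y ≤ 5 ^ k := by
  induction k generalizing S with
  | zero =>
    rw [MetricData.subDist, pow_zero]
    split
    · exact zero_le
    · refine iSup₂_le fun p hp => ?_
      rw [ENNReal.ofReal_le_one, Real.exp_le_one_iff, neg_nonpos]
      have h1 : InZ (0 + 1) (d (D.base 1 S) p) := by
        have := hp.1
        rwa [T.class_eq hS (D.base_mem _ S hS)] at this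
      exact_mod_cast coord_nonneg_of_inZ (T.nonneg _ _) h1
  | succ k ih =>
    rw [MetricData.subDist]
    calc _ ≤ ∑' S' : {S' : Set V // IsZSubtree d (k + 1) S' ∧ S' ⊆ S}, D.scale (k + 1) S S' * 5 ^ k :=
          ENNReal.tsum_le_tsum fun S' => mul_le_mul_right (ih S' S'.2.1) _
      _ ≤ 5 * 5 ^ k := by
          rw [ENNReal.tsum_mul_right]
          exact mul_le_mul_left (T.tsum_scale_le D hS) _
      _ = 5 ^ (k + 1) := by rw [pow_succ']

theorem exists_mem_of_subDist_ne_zero (D : MetricData d) (k : ℕ) (S : Set V) (x y : ZCompletion d)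
    (h : D.subDist k S x y ≠ 0) : ∃ p ∈ S, OnGeodesic p x y := by
  induction k using Nat.twoStepInduction generalizing S with
  | zero => exact absurd rfl h
  | one =>
    rw [MetricData.subDist] at h
    split at h
    · exact absurd rfl h
    · by_contra H
      push Not at H
      refine h (le_antisymm (iSup₂_le fun p hp => ?_) zero_le)
      exact absurd hp.2 (H p hp.1)
  | more k _ ih =>
    rw [MetricData.subDist, ne_eq, ENNReal.tsum_eq_zero] at h
    push Not at h
    obtain ⟨S', hS'⟩ := h
    obtain ⟨p, hp, hp'⟩ := ih S' (right_ne_zero_of_mul hS')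
    exact ⟨p, S'.2.2 hp, hp'⟩

end IsZTree

theorem ENNReal.tendsto_tsum_ite_le_atTop_zero (f : ℕ → ℝ≥0∞) (hf : ∑' l, f l ≠ ∞) :
    Tendsto (fun L => ∑' l, if L ≤ l then f l else 0) atTop (nhds 0) := by
  refine (ENNReal.tendsto_sum_nat_add f hf).congr fun L => ?_
  rw [← ENNReal.summable.sum_add_tsum_nat_add' (f := fun l => if L ≤ l then f l else 0) (k := L)]
  rw [Finset.sum_eq_zero, zero_add]
  · exact tsum_congr fun l => (if_pos (Nat.le_add_left _ _)).symm
  · intro l hl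
    exact if_neg (not_le.mpr (Finset.mem_range.mp hl))

namespace IsZTree

variable {n : ℕ} [NeZero n] {V : Type*} {d : V → V → ZLex n} (T : IsZTree d)

include T

/-- Points of the completion are close if the geodesic between them is far from the base point. -/
theorem exists_dist_lt (D : MetricData d) {ε : ℝ≥0∞} (hε : 0 < ε) : ∃ L : ℕ, ∀ x y : ZCompletion d,
    (∀ p, OnGeodesic p x y → (L : ℤ) ≤ coord (d (D.base n Set.univ) p) (n - 1)) →
    D.dist x y < ε := by
  obtain ⟨k, hk⟩ := Nat.exists_eq_succ_of_ne_zero (NeZero.ne n)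
  have : Nonempty V := ⟨D.base n Set.univ⟩
  have huniv : IsZSubtree d (k + 1) Set.univ := by
    rw [show k + 1 = n from hk.symm]
    exact T.isZSubtree_univ
  unfold MetricData.dist
  rw [show D.subDist n = D.subDist (k + 1) from congrArg D.subDist hk,
    show D.base n = D.base (k + 1) from congrArg D.base hk, show n - 1 = k by omega]
  clear hk
  cases k with
  | zero =>
    have h1 : Tendsto (fun L : ℕ => ENNReal.ofReal (Real.exp (-(L : ℝ)))) atTop (nhds 0) := by
      rw [← ENNReal.ofReal_zero]
      refine ENNReal.tendsto_ofReal ?_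
      exact Real.tendsto_exp_neg_atTop_nhds_zero.comp tendsto_natCast_atTop_atTop
    obtain ⟨L, hL⟩ := (h1.eventually_lt_const hε).exists
    refine ⟨L, fun x y h => lt_of_le_of_lt ?_ hL⟩
    rw [MetricData.subDist]
    split
    · exact zero_le
    · refine iSup₂_le fun p hp => ENNReal.ofReal_le_ofReal (Real.exp_le_exp.mpr ?_)
      have := h p hp.2
      rw [neg_le_neg_iff]
      exact_mod_cast this
  | succ k =>
    have hf : ∑' l : ℕ, (2⁻¹ : ℝ≥0∞) ^ l ≠ ∞ := by
      rw [ENNReal.tsum_geometric, ENNReal.one_sub_inv_two, inv_inv]; exact ENNReal.ofNat_ne_top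
    have h1 := ENNReal.Tendsto.mul_const (b := 2 * 5 ^ k)
      (ENNReal.tendsto_tsum_ite_le_atTop_zero _ hf) (Or.inr (by finiteness))
    rw [zero_mul] at h1
    -- The level of a subtree met by the geodesic is the last coordinate of the distance from the
    -- base vertex, so only a tail of the series of weights remains. The condition `1 ≤ L` keeps out
    -- `T₀`, whose factor is `1`.
    obtain ⟨L, hL, hL1⟩ := ((h1.eventually_lt_const hε).and (eventually_ge_atTop 1)).exists
    refine ⟨L, fun x y h => lt_of_le_of_lt ?_ hL⟩
    rw [MetricData.subDist]
    set b := D.base (k + 1 + 1) Set.univ with hb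
    have hbnd : ∀ S' : {S' : Set V // IsZSubtree d (k + 1) S' ∧ S' ⊆ Set.univ},
        D.scale (k + 1) Set.univ S' * D.subDist (k + 1) S' x y ≤
        ((if L ≤ subtreeLevel d (k + 1) b S' then 2⁻¹ ^ subtreeLevel d (k + 1) b S' else 0) *
          2⁻¹ ^ D.index (k + 1) S') * 5 ^ k := by
      intro S'
      by_cases h0 : D.subDist (k + 1) S' x y = 0
      · rw [h0, mul_zero]; exact zero_le
      · obtain ⟨p, hp, hxy⟩ := T.exists_mem_of_subDist_ne_zero D _ _ x y h0
        have hclass : ∀ q, InZ (k + 1 + 1) (d b q) := fun q => by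
          have := huniv
          have h2 := T.class_eq huniv (Set.mem_univ b)
          have h3 : q ∈ (Set.univ : Set V) := trivial
          rwa [h2] at h3
        have h2 := T.subtreeLevel_eq S'.2.1 hp (hclass p)
        have h3 := h p hxy
        have h4 : L ≤ subtreeLevel d (k + 1) b S' := by omega
        rw [if_pos h4]
        refine mul_le_mul' ?_ (T.subDist_le D k S' S'.2.1 x y)
        unfold MetricData.scale
        rw [if_neg, pow_add]
        intro hmem
        have h5 := T.subtreeLevel_eq S'.2.1 hmem (hclass b)
        rw [T.self, coord_zero] at h5
        omega
    refine (ENNReal.tsum_le_tsum hbnd).trans ?_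
    rw [ENNReal.tsum_mul_right, ← mul_assoc]
    exact mul_le_mul_left (T.tsum_weight_le D huniv
      fun l => if L ≤ l then 2⁻¹ ^ l else 0) _

/-! ### The closures of the `ℤⁿ⁻¹`-subtrees -/

end IsZTree

/-- A vertex of the `ℤⁿ⁻¹`-subtree of `v`, or a ray in this subtree. -/
def PrePoint.InClass {n : ℕ} {V : Type*} {d : V → V → ZLex n} (v : V) : PrePoint d → Prop
  | .vertex w => InZ (n - 1) (d v w)
  | .ray k _ γ => k < n ∧ InZ (n - 1) (d v (γ.toFun 0))

/-- The closure of the `ℤⁿ⁻¹`-subtree of `v` in the completion. -/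
def classClosure {n : ℕ} {V : Type*} (d : V → V → ZLex n) (v : V) : Set (ZCompletion d) :=
  {x | ∃ a : PrePoint d, Quot.mk _ a = x ∧ a.InClass v}

namespace IsZTree

variable {n : ℕ} [NeZero n] {V : Type*} {d : V → V → ZLex n} (T : IsZTree d)

include T

theorem eventually_inZ_of_inClass {v : V} {a : PrePoint d} (h : a.InClass v) :
    ∀ᶠ w in a.filter, InZ (n - 1) (d v w) := by
  cases a with
  | vertex w => rwa [vertex_filter_eventually]
  | ray k hk γ =>
    rw [ray_filter_eventually]
    exact ⟨0, fun t => T.inZ_trans h.2 ((T.ray_inZ γ 0 _).mono (by have := h.1; omega))⟩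

/-- A point outside the closure of a `ℤⁿ⁻¹`-subtree is separated from it by a vertex. -/
theorem exists_separating {v : V} {x : ZCompletion d} (hx : x ∉ classClosure d v) :
    ∃ p, ∀ y ∈ classClosure d v, OnGeodesic p x y := by
  induction x using Quot.ind with | _ a
  -- It is enough to find a vertex outside the subtree beyond which `x` lies, seen from `v`.
  have suff : ∀ p, ¬ InZ (n - 1) (d v p) → (∀ᶠ u in a.filter, OnSeg d v p u) →
      ∃ p, ∀ y ∈ classClosure d v, OnGeodesic p (Quot.mk _ a) y := by
    rintro p hp hu
    refine ⟨p, ?_⟩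
    rintro _ ⟨b, rfl, hb⟩
    refine ⟨a, b, rfl, rfl, ?_⟩
    filter_upwards [hu] with u hu
    filter_upwards [T.eventually_inZ_of_inClass hb] with w hw
    rcases T.cut hu w with h | h
    · exact absurd (hw.of_le (T.nonneg _ _) (T.le_of_onSeg h)) hp
    · exact T.onSeg_symm h
  cases a with
  | vertex u =>
    refine suff u (fun h => hx ⟨_, rfl, h⟩) ?_
    rw [vertex_filter_eventually]
    exact T.onSeg_right _ _
  | ray k hk γ =>
  rcases T.ray_dichotomy γ v with ⟨s₀, h1⟩ | h1
  · have key : ∃ s, ¬ InZ (n - 1) (d v (γ.toFun (s₀ + s))) := by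
      by_cases hkn : k < n
      · refine ⟨0, fun h => hx ⟨_, rfl, hkn, T.inZ_trans h ?_⟩⟩
        exact (T.ray_inZ γ _ _).mono (by omega)
      · obtain rfl : k = n := le_antisymm hk.2 (by omega)
        have hlt : k - 1 < k := by omega
        refine ⟨⟨unit k (k - 1), (unit_pos hlt).le, inZ_top _⟩, fun h => not_inZ_unit hlt ?_⟩
        refine h.of_le (unit_pos hlt).le ?_
        rw [h1]
        exact le_add_of_nonneg_left (T.nonneg _ _)
    obtain ⟨s, hs⟩ := key
    refine suff _ hs ?_
    rw [ray_filter_eventually]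
    refine ⟨s₀ + s, fun t => ?_⟩
    unfold OnSeg
    rw [T.ray_increasing_add h1, T.ray_dist]
  · have h2 : Toward γ v := T.toward_iff.mpr h1
    have hDk := T.not_inZ_of_toward hk.1 h2
    set D := d (γ.toFun 0) v with hD
    have hkn : k < n := by
      by_contra hkn
      exact hDk ((inZ_top D).mono (by omega))
    have hDn : ¬ InZ (n - 1) D := fun h => hx ⟨_, rfl, hkn, T.inZ_symm h⟩
    -- When no separating vertex fits between, `γ` faces a ray that starts at `v`; then its end is
    -- glued to an end of the subtree of `v`.
    by_cases hsplit : k = n - 1 ∧ InZ (k + 1) D ∧ coord D k = 1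
    · exfalso
      obtain ⟨rfl, hD1, hD2⟩ := hsplit
      rw [hD, T.symm] at hDk
      obtain ⟨γ', h0, h3⟩ := T.exists_toward hDk
      rw [← h0] at h2
      refine hx ⟨.ray (n - 1) hk γ', (mk_eq_of_facing hk hkn (T.facing_of_toward hk.1 h2 h3
        (by rwa [h0]) (by rwa [h0]))).symm, hkn, ?_⟩
      rw [h0]
      exact T.inZ_self _ _
    · obtain ⟨x, hx0, hxD, hxk, hxl⟩ := exists_split (T.nonneg _ _) hDk hDn hsplit
      obtain ⟨p, hp1, hp2⟩ := T.geod _ _ x hx0 hxD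
      refine suff p (fun h => hxl ?_) ?_
      · rw [T.symm] at h
        rw [hp2, hp1, add_sub_cancel_left]
        exact h
      · rw [ray_filter_eventually]
        refine ⟨0, fun t => T.onSeg_symm (T.onSeg_trans' hp2 (T.onSeg_of_le (h2 _) hp2 ?_))⟩
        rw [T.ray_dist_zero, hp1]
        exact (lt_of_not_inZ hx0 hxk (0 + t).2.2).le

theorem isClosed_classClosure (D : MetricData d) (v : V) :
    IsClosed (X := D.Space) (classClosure d v) :=
  T.isClosed_of_onGeodesic D _ fun _ hx => T.exists_separating hx

theorem compl_topBoundary : (topBoundary d)ᶜ = ⋃ v, classClosure d v := by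
  ext x
  rw [Set.mem_compl_iff, Set.mem_iUnion]
  constructor
  · intro h
    induction x using Quot.ind with | _ a
    cases a with
    | vertex v => exact ⟨v, _, rfl, T.inZ_self _ v⟩
    | ray k hk γ =>
      refine ⟨γ.toFun 0, _, rfl, ?_, T.inZ_self _ _⟩
      refine lt_of_le_of_ne hk.2 ?_
      rintro rfl
      exact h ⟨hk, γ, rfl⟩
  · rintro ⟨v, b, hb, hv⟩ ⟨hk, γ, ha⟩
    have h1 := congrArg ZCompletion.type (hb.trans ha)
    change b.type = n at h1
    cases b with
    | vertex w => exact NeZero.ne n h1.symm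
    | ray k hk γ => exact hv.1.ne h1

end IsZTree

/-! ### Groups with a finite invariant set of points or of subtrees -/

/-- A torsion-free group is abelian if it has a normal abelian subgroup of finite index on which
every inner automorphism takes each element to itself or to its inverse. -/
theorem comm_of_normal_finiteIndex {G : Type*} [Group G]
    (htf : ∀ (g : G) (m : ℕ), m ≠ 0 → g ^ m = 1 → g = 1) (H : Subgroup G) [H.FiniteIndex]
    (hcomm : ∀ h ∈ H, ∀ k ∈ H, h * k = k * h)
    (hconj : ∀ g, ∀ h ∈ H, g * h * g⁻¹ = h ∨ g * h * g⁻¹ = h⁻¹) (a b : G) : a * b = b * a := by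
  have sq : ∀ g : G, g * g = 1 → g = 1 := fun g h => htf g 2 two_ne_zero (by rwa [pow_two])
  have hcent : ∀ g, ∀ h ∈ H, g * h * g⁻¹ = h := by
    intro g h hh
    rcases hconj g h hh with h1 | h1
    · exact h1
    obtain ⟨m, hm, -, hgm⟩ := Subgroup.exists_pow_mem_of_index_ne_zero
      (Subgroup.FiniteIndex.index_ne_zero (H := H)) g
    by_cases hg : g ^ m = 1
    · rw [htf g m hm.ne' hg]; group
    -- If `g` inverts `h`, the element `h * g ^ m` of `H` is mapped to `h⁻¹ * g ^ m`. This is the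
    -- element itself only if `h ^ 2 = 1`, and its inverse only if `g ^ (2 * m) = 1`.
    have h2 : g * (h * g ^ m) * g⁻¹ = h⁻¹ * g ^ m := by
      rw [← h1]; group
    rcases hconj g _ (H.mul_mem hh hgm) with h3 | h3 <;> rw [h2] at h3
    · have h4 := mul_right_cancel h3
      have h5 : h = 1 := sq h (by nth_rewrite 1 [← h4]; exact inv_mul_cancel h)
      rw [h5]; group
    · rw [hcomm h hh _ hgm, mul_inv_rev] at h3
      have h4 := mul_left_cancel h3
      exact absurd (sq _ (by nth_rewrite 1 [h4]; exact inv_mul_cancel _)) hg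
  have hle : H ≤ Subgroup.center G := fun h hh => by
    rw [Subgroup.mem_center_iff]
    intro g
    have := hcent g h hh
    rwa [mul_inv_eq_iff_eq_mul] at this
  have : (Subgroup.center G).FiniteIndex := Subgroup.finiteIndex_of_le hle
  -- The transfer to the centre is a power map and has abelian image, so a power of each commutator
  -- is trivial.
  have h1 : MonoidHom.transferCenterPow G (a * b * (b * a)⁻¹) = 1 := by
    rw [map_mul, map_inv, map_mul, map_mul, mul_inv_eq_one]
    exact Subtype.ext (Subgroup.mem_center_iff.mp (MonoidHom.transferCenterPow G b).2 _)
  have h2 := congrArg Subtype.val h1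
  rw [MonoidHom.transferCenterPow_apply] at h2
  exact mul_inv_eq_one.mp (htf _ _ Subgroup.FiniteIndex.index_ne_zero h2)

namespace IsZTree

variable {n : ℕ} [NeZero n] {V : Type*} {d : V → V → ZLex n} (T : IsZTree d)
  {G : Type*} [Group G] [MulAction G V]

include T

/-- The displacement of an isometry that shifts a ray is minimal on the ray. -/
theorem abs_le_dist_of_shift {k : ℕ} {γ : ZRay d k} {f : V → V}
    (hf : ∀ v w, d (f v) (f w) = d v w) {s s' : halfLine n k}
    (h : ∀ t, f (γ.toFun (s + t)) = γ.toFun (s' + t)) (v : V) :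
    |(s : ZLex n) - s'| ≤ d v (f v) := by
  -- Replacing `v` by `f v` changes a distance by at most the displacement of `v`. On a suitable
  -- tail the two distances from `v` differ by exactly `|s - s'|`.
  have key : ∀ t, |d v (γ.toFun (s + t)) - d v (γ.toFun (s' + t))| ≤ d v (f v) := fun t => by
    rw [← hf v (γ.toFun (s + t)), h, abs_le]
    have h1 := T.triangle v (f v) (γ.toFun (s' + t))
    have h2 := T.triangle (f v) v (γ.toFun (s' + t))
    have h3 := T.symm v (f v)
    constructor <;> grind
  rcases T.ray_dichotomy γ v with ⟨s₀, h1⟩ | h1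
  · have h2 := key s₀
    rw [add_comm s, add_comm s', h1, h1, add_sub_add_left_eq_sub] at h2
    exact h2
  · have h2 := key 0
    rw [add_zero, add_zero, h1, h1 s', sub_sub_sub_cancel_left, abs_sub_comm] at h2
    exact h2

open scoped Pointwise in
/-- A torsion-free group that acts freely by isometries on a `ℤⁿ`-tree and leaves invariant a finite
set of points of the completion is abelian. -/
theorem comm_of_finite_invariant (hd : ∀ (g : G) v w, d (g • v) (g • w) = d v w)
    (hfree : ∀ (g : G) (v : V), g • v = v → g = 1)
    (htf : ∀ (g : G) (m : ℕ), m ≠ 0 → g ^ m = 1 → g = 1) {F : Set (ZCompletion d)} (hF : F.Finite)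
    (hne : F.Nonempty) (hinv : ∀ (g : G), ∀ x ∈ F, ZCompletion.map (g • ·) (hd g) x ∈ F) (a b : G) :
    a * b = b * a := by
  -- A glued end has two filters and its sides may be exchanged. The kernel of the action on the
  -- finite set of all filters involved fixes each side separately.
  let E : SubMulAction G (Filter V) :=
    { carrier := {f | ∃ a : PrePoint d, Quot.mk _ a ∈ F ∧ a.filter = f}
      smul_mem' := by
        rintro g _ ⟨a, ha, rfl⟩
        refine ⟨a.map (g • ·) (hd g), hinv g _ ha, ?_⟩
        cases a with
        | vertex v => exact (Filter.map_pure _ _).symm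
        | ray k hk γ => exact Filter.map_map.symm }
  have hE : Finite E := by
    have : (⋃ x ∈ F, {f : Filter V | ∃ a : PrePoint d, Quot.mk _ a = x ∧ a.filter = f}).Finite :=
      hF.biUnion fun x _ => T.finite_filters x
    refine (this.subset ?_).to_subtype
    rintro f ⟨a, ha, rfl⟩
    exact Set.mem_biUnion ha ⟨a, rfl, rfl⟩
  let H : Subgroup G := (MulAction.toPermHom G E).ker
  obtain ⟨x, hx⟩ := hne
  induction x using Quot.ind with | _ p
  have hfix : ∀ h ∈ H, Filter.map (h • ·) p.filter = p.filter := by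
    intro h hh
    have h1 := DFunLike.congr_fun (MonoidHom.mem_ker.mp hh) (⟨p.filter, p, hx, rfl⟩ : E)
    exact congrArg Subtype.val h1
  have hnormal : ∀ g, ∀ h ∈ H, g * h * g⁻¹ ∈ H := fun g h hh =>
    (inferInstance : H.Normal).conj_mem h hh g
  have hfi : H.FiniteIndex := Subgroup.finiteIndex_ker _
  refine comm_of_normal_finiteIndex htf H ?_ ?_ a b
  · intro h hh k hk
    cases p with
    | vertex v =>
      rw [hfree h v (Filter.pure_injective ((Filter.map_pure _ _).symm.trans (hfix h hh)))]
      rw [one_mul, mul_one]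
    | ray l hl γ =>
      obtain ⟨s, s', hs⟩ : Cofinal (γ.map (h • ·) (hd h)) γ :=
        cofinal_of_filter_eq hl.1 (Filter.map_map.symm.trans (hfix h hh))
      obtain ⟨r, r', hr⟩ : Cofinal (γ.map (k • ·) (hd k)) γ :=
        cofinal_of_filter_eq hl.1 (Filter.map_map.symm.trans (hfix k hk))
      replace hs : ∀ t, h • γ.toFun (s + t) = γ.toFun (s' + t) := hs
      replace hr : ∀ t, k • γ.toFun (r + t) = γ.toFun (r' + t) := hr
      -- Both elements shift `γ`, and shifts commute, so the two products agree at a vertex; the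
      -- action is free.
      refine inv_mul_eq_one.mp (hfree _ (γ.toFun (r + s)) ?_)
      rw [mul_smul, inv_smul_eq_iff, mul_smul, add_comm r s, hs, add_comm s' r, hr, mul_smul,
        add_comm s r, hr, add_comm r' s, hs, add_comm]
  · intro g h hh
    cases p with
    | vertex v =>
      rw [hfree h v (Filter.pure_injective ((Filter.map_pure _ _).symm.trans (hfix h hh)))]
      left; group
    | ray l hl γ =>
      obtain ⟨s, s', hs⟩ : Cofinal (γ.map (h • ·) (hd h)) γ :=
        cofinal_of_filter_eq hl.1 (Filter.map_map.symm.trans (hfix h hh))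
      obtain ⟨r, r', hr⟩ : Cofinal (γ.map ((g * h * g⁻¹) • ·) (hd _)) γ :=
        cofinal_of_filter_eq hl.1 (Filter.map_map.symm.trans (hfix _ (hnormal g h hh)))
      replace hs : ∀ t, h • γ.toFun (s + t) = γ.toFun (s' + t) := hs
      replace hr : ∀ t, (g * h * g⁻¹) • γ.toFun (r + t) = γ.toFun (r' + t) := hr
      -- The conjugate moves `g • γ s` exactly as far as `h` moves `γ s`, and symmetrically for `γ
      -- r`. As displacements are minimal on the ray, the two shifts have the same absolute value.
      have h1 := T.abs_le_dist_of_shift (hd _) hr (g • γ.toFun s)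
      have h2 := T.abs_le_dist_of_shift (hd _) hs (g⁻¹ • γ.toFun r)
      have e1 : (g * h * g⁻¹) • g • γ.toFun s = g • γ.toFun s' := by
        have := hs 0
        rw [add_zero, add_zero] at this
        rw [smul_smul, inv_mul_cancel_right, mul_smul, this]
      have e2 : h • g⁻¹ • γ.toFun r = g⁻¹ • γ.toFun r' := by
        have := hr 0
        rw [add_zero, add_zero] at this
        rw [← this, smul_smul, smul_smul]
        congr 1
        group
      rw [e1, hd, γ.isometry] at h1
      rw [e2, hd, γ.isometry] at h2
      rcases abs_eq_abs.mp (le_antisymm h1 h2) with h3 | h3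
      · left
        refine inv_mul_eq_one.mp (hfree _ (γ.toFun (s + r)) ?_) |>.symm
        rw [mul_smul, inv_smul_eq_iff, hs, add_comm s r, hr]
        congr 1
        apply Subtype.ext
        change (r' : ZLex n) + s = s' + r
        grind
      · right
        rw [eq_inv_iff_mul_eq_one]
        refine hfree _ (γ.toFun (s + r)) ?_
        rw [mul_smul, hs, add_comm s' r, hr]
        congr 1
        apply Subtype.ext
        change (r' : ZLex n) + s' = s + r
        grind

/-- A torsion-free group that acts freely by isometries on a `ℤⁿ`-tree and leaves invariant a finite
set of `ℤⁿ⁻¹`-subtrees fixes a `ℤⁿ⁻¹`-subtree, unless it is abelian. -/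
theorem exists_fixed_class (hd : ∀ (g : G) v w, d (g • v) (g • w) = d v w)
    (hfree : ∀ (g : G) (v : V), g • v = v → g = 1)
    (htf : ∀ (g : G) (m : ℕ), m ≠ 0 → g ^ m = 1 → g = 1) (hna : ¬ ∀ a b : G, a * b = b * a)
    (F : Finset V) (hne : F.Nonempty)
    (hinv : ∀ (g : G), ∀ f ∈ F, ∃ f' ∈ F, InZ (n - 1) (d (g • f) f')) :
    ∃ v, ∀ g : G, InZ (n - 1) (d v (g • v)) := by
  have hn : n - 1 + 1 = n := Nat.sub_add_cancel (NeZero.pos n)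
  have hlt : n - 1 < n := by have := NeZero.pos n; omega
  have htop : ∀ a : ZLex n, InZ (n - 1 + 1) a := fun a => by rw [hn]; exact inZ_top a
  set l : V → V → ℤ := fun v w => coord (d v w) (n - 1) with hl
  have l_nonneg : ∀ v w, 0 ≤ l v w := fun v w => coord_nonneg_of_inZ (T.nonneg _ _) (htop _)
  have l_symm : ∀ v w, l v w = l w v := fun v w => by simp only [hl, T.symm v w]
  have l_zero : ∀ {v w}, l v w = 0 ↔ InZ (n - 1) (d v w) := fun {v w} =>
    ⟨fun h => inZ_of_coord (htop _) h, fun h => h _ le_rfl⟩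
  have l_seg : ∀ {u z w}, OnSeg d u z w → l u w = l u z + l z w := fun {u z w} h => by
    simp only [hl]; rw [h, coord_add]
  have l_congr : ∀ {v w} u, InZ (n - 1) (d v w) → l u v = l u w := fun {v w} u h => by
    have := T.inZ_sub_dist h u _ le_rfl
    rw [coord_sub] at this
    simp only [hl]
    omega
  have l_smul : ∀ (g : G) v w, l (g • v) (g • w) = l v w := fun g v w => by simp only [hl, hd]
  -- Here `l` is the distance in the simplicial tree of `ℤⁿ⁻¹`-subtrees, and `R` is the radius of
  -- the finite set seen from a vertex. Its minimum defines the centre.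
  let R : V → ℕ := fun v => F.sup fun f => (l v f).toNat
  have : Nonempty V := ⟨hne.choose⟩
  obtain ⟨v, hv⟩ : ∃ v, ∀ w, R v ≤ R w :=
    ⟨Function.argmin R, fun w => Function.argmin_le R w⟩
  have hR : ∀ g : G, R (g • v) ≤ R v := by
    intro g
    refine Finset.sup_le fun f hf => ?_
    obtain ⟨f', hf', h⟩ := hinv g⁻¹ f hf
    have h1 : l (g • v) f = l v f' := by
      rw [← l_congr v h, ← l_smul g v, smul_inv_smul]
    rw [h1]
    exact Finset.le_sup (f := fun f => (l v f).toNat) hf'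
  -- Between two centres at distance at least `2`, the subtree one step from `v` would have a
  -- smaller radius.
  have hle : ∀ v w, (∀ u, R v ≤ R u) → R w ≤ R v → l v w ≤ 1 := by
    intro v w hv hw
    by_contra hgt
    rw [not_le] at hgt
    have h1 : InZ (n - 1 + 1) (d v w - unit n (n - 1)) := htop _
    obtain ⟨z, hz1, hz2⟩ := T.geod v w (unit n (n - 1)) (unit_pos hlt).le (by
      refine sub_nonneg.mp (nonneg_of_coord_pos h1 ?_).le
      rw [coord_sub, coord_unit hlt, if_pos rfl]
      exact sub_pos.mpr hgt)
    have hvz : l v z = 1 := by simp only [hl]; rw [hz1, coord_unit hlt, if_pos rfl]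
    have hzw : l z w = l v w - 1 := by rw [l_seg hz2, hvz]; ring
    have hbound : ∀ f ∈ F, l v f ≤ R v ∧ l w f ≤ R v := fun f hf => by
      have h2 : (l v f).toNat ≤ R v := Finset.le_sup (f := fun f => (l v f).toNat) hf
      have h3 : (l w f).toNat ≤ R w := Finset.le_sup (f := fun f => (l w f).toNat) hf
      omega
    have hz : ∀ f ∈ F, l z f ≤ R v - 1 := fun f hf => by
      obtain ⟨h2, h3⟩ := hbound f hf
      rcases T.cut hz2 f with h4 | h4
      · have := l_seg h4; omega
      · have := l_seg h4; rw [l_symm f w, l_symm f z] at this; omega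
    have hpos : 0 < R v := by
      obtain ⟨f, hf⟩ := hne
      have := hz f hf
      have := l_nonneg z f
      omega
    have : R z < R v := by
      rw [Finset.sup_lt_iff (by exact hpos)]
      intro f hf
      have := hz f hf
      omega
    exact absurd (hv z) (not_le.mpr this)
  refine ⟨v, fun g => ?_⟩
  by_contra hg
  refine hna ?_
  have hmin : ∀ g : G, ∀ u, R (g • v) ≤ R u := fun g u => (hR g).trans (hv u)
  have hl1 : ∀ g h : G, l (g • v) (h • v) ≤ 1 := fun g h =>
    hle _ _ (hmin g) (hmin h _)
  have hvg : l v (g • v) = 1 := by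
    have h1 := hl1 1 g
    rw [one_smul] at h1
    have h2 := l_nonneg v (g • v)
    have h3 : l v (g • v) ≠ 0 := fun h => hg (l_zero.mp h)
    omega
  -- Three subtrees cannot be pairwise adjacent: the distances from their median would be integers
  -- with all pairwise sums equal to `1`.
  have two : ∀ h : G, InZ (n - 1) (d v (h • v)) ∨ InZ (n - 1) (d (g • v) (h • v)) := by
    intro h
    by_contra H
    push Not at H
    obtain ⟨H1, H2⟩ := H
    rw [← l_zero] at H1 H2
    have h1 := hl1 1 h
    rw [one_smul] at h1
    have h2 := hl1 g h
    have h3 := l_nonneg v (h • v)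
    have h4 := l_nonneg (g • v) (h • v)
    obtain ⟨m, m1, m2, m3⟩ := T.median v (g • v) (h • v)
    have e1 := l_seg m1
    have e2 := l_seg m2
    have e3 := l_seg m3
    rw [l_symm (g • v) m] at e2
    omega
  have hgv : ¬ InZ (n - 1) (d v (g • v)) := hg
  -- For `n = 1` the subtrees are vertices and `g` would invert an edge, so `g ^ 2` would fix a
  -- vertex. For larger `n` the edge is a point of the completion.
  rcases Nat.eq_zero_or_pos (n - 1) with hn1 | hn1
  · exfalso
    rw [hn1] at hgv two
    simp only [inZ_zero_iff] at hgv two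
    have hg1 : g ≠ 1 := by
      rintro rfl
      rw [one_smul] at hgv
      exact hgv (T.self v)
    rcases two (g * g) with h1 | h1
    · have h2 := hfree (g * g) v (T.eq_of _ _ h1).symm
      exact hg1 (htf g 2 two_ne_zero (by rwa [pow_two]))
    · rw [mul_smul, hd] at h1
      exact hgv h1
  · have hk : 1 ≤ n - 1 ∧ n - 1 ≤ n := ⟨hn1, hlt.le⟩
    obtain ⟨γ, hγ0, hγ⟩ := T.exists_toward hgv
    obtain ⟨γ', hγ'0, hγ'⟩ := T.exists_toward (v := g • v) (w := v) (by rwa [T.symm])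
    have hfacing : Facing γ γ' := T.facing_of_toward hn1 (by rwa [hγ'0]) (by rwa [hγ0])
      (htop _) (by rw [hγ0, hγ'0]; exact hvg)
    refine T.comm_of_finite_invariant hd hfree htf
      (F := {Quot.mk _ (.ray (n - 1) hk γ)}) (Set.finite_singleton _) ⟨_, rfl⟩ ?_
    rintro h _ rfl
    have hh : Toward (γ.map (h • ·) (hd h)) ((h * g) • v) := by
      intro s
      change OnSeg d (h • γ.toFun 0) (h • γ.toFun s) ((h * g) • v)
      unfold OnSeg
      rw [mul_smul, hd, hd, hd]
      exact hγ s
    have hh0 : (γ.map (h • ·) (hd h)).toFun 0 = h • v := congrArg (h • ·) hγ0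
    have hne : ¬ InZ (n - 1) (d (h • v) ((h * g) • v)) := by rwa [mul_smul, hd]
    change (Quot.mk _ (.ray (n - 1) hk (γ.map (h • ·) (hd h))) : ZCompletion d) =
      Quot.mk _ (.ray (n - 1) hk γ)
    -- The element `h` either preserves the sides of the edge or exchanges them. In the second case
    -- it takes `γ` to `γ'`, which represents the same point.
    rcases two h with h1 | h1
    · have h2 : InZ (n - 1) (d (g • v) ((h * g) • v)) := (two (h * g)).resolve_left fun h2 =>
        hne (T.inZ_trans (T.inZ_symm h1) h2)
      refine mk_eq_of_cofinal hk (T.cofinal_of_toward hn1 hh hγ ?_ (T.inZ_symm h2))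
      rw [hh0, hγ0]
      exact T.inZ_symm h1
    · have h2 : InZ (n - 1) (d v ((h * g) • v)) := (two (h * g)).resolve_right fun h2 =>
        hne (T.inZ_trans (T.inZ_symm h1) h2)
      rw [mk_eq_of_facing hk hlt hfacing]
      refine mk_eq_of_cofinal hk (T.cofinal_of_toward hn1 hh hγ' ?_ (T.inZ_symm h2))
      rw [hh0, hγ'0]
      exact T.inZ_symm h1

end IsZTree

/-! ### Axes of isometries -/

namespace IsZTree

variable {n : ℕ} [NeZero n] {V : Type*} {d : V → V → ZLex n} (T : IsZTree d)
  {G : Type*} [Group G] [MulAction G V]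

include T

/-- Segments that overlap in a nondegenerate segment fit together, because a tree has no room for
turning back: this is the four-point condition for `a`, `c`, `b`, `e`. -/
theorem onSeg_concat {a b c e : V} (h1 : OnSeg d a b c) (h2 : OnSeg d b c e) (hbc : b ≠ c) :
    OnSeg d a c e := by
  have h3 := T.four a c b e
  have h4 := T.triangle a c e
  have h5 : 0 < d b c := lt_of_le_of_ne (T.nonneg _ _) fun h => hbc (T.eq_of _ _ h.symm)
  have h6 := T.symm c b
  unfold OnSeg at *
  grind

theorem smul_onSeg (hd : ∀ (g : G) v w, d (g • v) (g • w) = d v w) (g : G) {u z w : V}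
    (h : OnSeg d u z w) : OnSeg d (g • u) (g • z) (g • w) := by
  unfold OnSeg at *
  rw [hd, hd, hd, h]

/-- An isometry `g` with `d(p, g p) < d(p, g² p)` has an axis, which the segment from `p` to `g p`
meets. -/
theorem exists_axis (hd : ∀ (g : G) v w, d (g • v) (g • w) = d v w) {g : G} {p : V}
    (h : d p (g • p) < d p (g • g • p)) : ∃ m, OnSeg d p m (g • m) ∧
      OnSeg d p (g • m) (g • p) ∧ OnSeg d (g⁻¹ • m) m (g • m) ∧ m ≠ g • m := by
  -- The median is the projection of `p` to the future axis. The hypothesis says that `2 * d p m < d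
  -- p (g • p)`, so `m` comes before `g • m` on `[p, g • p]`.
  obtain ⟨m, m1, m2, m3⟩ := T.median (g⁻¹ • p) p (g • p)
  have k1 : OnSeg d (g • p) (g • m) p := by
    have := T.smul_onSeg hd g (T.onSeg_symm m1)
    rwa [smul_inv_smul] at this
  have k2 : OnSeg d (g⁻¹ • p) (g⁻¹ • m) p := by
    have := T.smul_onSeg hd g⁻¹ (T.onSeg_symm m2)
    rw [inv_smul_smul] at this
    exact T.onSeg_symm this
  have e1 : d p (g⁻¹ • p) = d p (g • p) := by
    rw [← hd g, smul_inv_smul, T.symm]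
  have e2 : d (g⁻¹ • p) (g • p) = d p (g • g • p) := by
    rw [← hd g, smul_inv_smul]
  have e3 : d (g • p) (g • m) = d p m := hd _ _ _
  have e4 : d (g⁻¹ • p) (g⁻¹ • m) = d p m := hd _ _ _
  have e5 := T.symm (g⁻¹ • p) p
  have e6 := T.symm (g • p) p
  have e7 := T.symm (g • m) p
  have e8 := T.symm (g⁻¹ • p) m
  have e9 := T.symm p m
  have k3 : OnSeg d p m (g • m) := by
    refine T.onSeg_of_le m2 (T.onSeg_symm k1) ?_
    unfold OnSeg at *
    grind
  have k4 : OnSeg d (g⁻¹ • p) (g⁻¹ • m) m := by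
    refine T.onSeg_of_le k2 m1 ?_
    unfold OnSeg at *
    grind
  refine ⟨m, k3, T.onSeg_symm k1, ?_, ?_⟩
  · have k5 := T.onSeg_trans' m3 k4
    have k6 := T.onSeg_trans' (T.onSeg_symm k1) k3
    exact T.onSeg_symm (T.onSeg_trans' (T.onSeg_symm k5) (T.onSeg_symm k6))
  · intro hm
    rw [← hm] at k1
    unfold OnSeg at *
    grind

theorem onSeg_pow (hd : ∀ (g : G) v w, d (g • v) (g • w) = d v w) {g : G} {m : V}
    (h : OnSeg d (g⁻¹ • m) m (g • m)) (hm : m ≠ g • m) (k : ℕ) :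
    OnSeg d m (g ^ k • m) (g ^ (k + 1) • m) := by
  induction k with
  | zero => rw [pow_zero, one_smul]; exact T.onSeg_left _ _
  | succ k ih =>
    refine T.onSeg_concat ih ?_ ?_
    · have := T.smul_onSeg hd (g ^ (k + 1)) h
      rwa [smul_smul, smul_smul, ← pow_succ, pow_succ g k, mul_inv_cancel_right, ← pow_succ] at this
    · intro h'
      rw [pow_succ, mul_smul] at h'
      exact hm (MulAction.injective _ h')

theorem dist_pow (hd : ∀ (g : G) v w, d (g • v) (g • w) = d v w) {g : G} {m : V}
    (h : OnSeg d (g⁻¹ • m) m (g • m)) (hm : m ≠ g • m) (k : ℕ) :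
    d m (g ^ k • m) = k • d m (g • m) := by
  induction k with
  | zero => rw [pow_zero, one_smul, T.self, zero_smul]
  | succ k ih =>
    have h1 := T.onSeg_pow hd h hm k
    unfold OnSeg at h1
    rw [h1, ih, pow_succ, mul_smul, hd, succ_nsmul]

/-- An isometry with an axis has the same translation length at all points. -/
theorem dist_smul_smul (hd : ∀ (g : G) v w, d (g • v) (g • w) = d v w) {g : G} {m : V}
    (h : OnSeg d (g⁻¹ • m) m (g • m)) (hm : m ≠ g • m) (p : V) :
    d p (g • g • p) = d p (g • p) + d m (g • m) := by
  have hl : 0 < d m (g • m) := lt_of_le_of_ne (T.nonneg _ _) fun h => hm (T.eq_of _ _ h.symm)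
  set l := d m (g • m) with hl'
  have hx : ∀ i j : ℕ, d (g ^ i • m) (g ^ (i + j) • m) = j • l := fun i j => by
    rw [pow_add, mul_smul, hd, T.dist_pow hd h hm]
  -- Seen from `g ^ (i + 2) • m`, the distances of `p`, `g • p` and `g • g • p` form an arithmetic
  -- progression with step `±l`; the four-point condition with these points gives the claim.
  have key : ∀ (i : ℕ) (e : ZLex n), (e = l ∨ e = -l) →
      d (g ^ (i + 1) • m) p = d (g ^ i • m) p + e →
      d (g ^ (i + 2) • m) p = d (g ^ (i + 1) • m) p + e →
      d p (g • g • p) = d p (g • p) + l := by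
    intro i e he h1 h2
    have f1 : d (g ^ (i + 2) • m) (g • p) = d (g ^ (i + 1) • m) p := by
      rw [pow_succ' g (i + 1), mul_smul, hd]
    have f0 : d (g ^ (i + 2) • m) (g • g • p) = d (g ^ i • m) p := by
      rw [pow_succ' g (i + 1), mul_smul, hd, pow_succ' g i, mul_smul, hd]
    have f2 : d (g • p) (g • g • p) = d p (g • p) := hd _ _ _
    have q1 := T.four (g ^ (i + 2) • m) p (g • p) (g • g • p)
    have q2 := T.four (g ^ (i + 2) • m) (g • p) p (g • g • p)
    have q3 := T.four (g ^ (i + 2) • m) (g • g • p) p (g • p)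
    have s1 := T.symm p (g • p)
    have s2 := T.symm p (g • g • p)
    have s3 := T.symm (g • p) (g • g • p)
    rw [f0, f1, f2] at *
    generalize d (g ^ (i + 2) • m) p = a at *
    generalize d (g ^ (i + 1) • m) p = b at *
    generalize d (g ^ i • m) p = c at *
    rcases he with rfl | rfl <;> grind
  have x01 := hx 0 1
  have x02 := hx 0 2
  have x12 := hx 1 1
  have x23 := hx 2 1
  have x24 := hx 2 2
  have x34 := hx 3 1
  have x03 := hx 0 3
  have x04 := hx 0 4
  simp only [zero_add, Nat.reduceAdd] at x01 x02 x12 x23 x24 x34 x03 x04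
  have two : (2 : ℕ) • l = l + l := two_nsmul l
  have three : (3 : ℕ) • l = l + l + l := by rw [succ_nsmul, two_nsmul]
  have four : (4 : ℕ) • l = l + l + l + l := by rw [succ_nsmul, three]
  rw [one_smul] at x01 x12 x23 x34
  rw [two] at x02 x24
  rw [three] at x03
  rw [four] at x04
  have t01 := T.triangle (g ^ 0 • m) (g ^ 1 • m) p
  have t12 := T.triangle (g ^ 1 • m) (g ^ 2 • m) p
  have t23 := T.triangle (g ^ 3 • m) (g ^ 2 • m) p
  have t34 := T.triangle (g ^ 4 • m) (g ^ 3 • m) p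
  have q3 := T.four (g ^ 2 • m) p (g ^ 0 • m) (g ^ 3 • m)
  have q4 := T.four (g ^ 2 • m) p (g ^ 0 • m) (g ^ 4 • m)
  have s1 := T.symm p (g ^ 3 • m)
  have s2 := T.symm p (g ^ 4 • m)
  have s3 := T.symm p (g ^ 0 • m)
  have s4 := T.symm (g ^ 2 • m) (g ^ 0 • m)
  have s5 := T.symm (g ^ 2 • m) (g ^ 3 • m)
  have s6 := T.symm (g ^ 3 • m) (g ^ 4 • m)
  have s7 := T.symm (g ^ 2 • m) (g ^ 4 • m)
  -- Along the axis the distance to `p` falls at full speed up to `g ^ 2 • m`, or else it rises at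
  -- full speed from there on.
  by_cases H : d (g ^ 2 • m) p = d (g ^ 0 • m) p - (l + l)
  · refine key 0 (-l) (Or.inr rfl) ?_ ?_ <;> simp only [zero_add] <;> grind
  · refine key 2 l (Or.inl rfl) ?_ ?_ <;> simp only [Nat.reduceAdd] <;> grind

end IsZTree

/-! ### Concatenation and cyclic decompositions of words -/

namespace ZWord

variable {n : ℕ} [NeZero n] {X : Type*}

theorem append_letter_of_le {u v : ZWord n X} {α : ZLex n} (h : α ≤ u.len) :
    (u.append v).letter α = u.letter α := if_pos h

theorem append_letter_of_lt {u v : ZWord n X} {α : ZLex n} (h : u.len < α) :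
    (u.append v).letter α = v.letter (α - u.len) := if_neg (not_le.mpr h)

theorem append_letter_add {u v : ZWord n X} {α : ZLex n} (h : 0 < α) :
    (u.append v).letter (u.len + α) = v.letter α := by
  change (if _ then _ else _) = _
  rw [if_neg (not_le.mpr (lt_add_of_pos_right _ h)), add_sub_cancel_left]

theorem inv_letter (u : ZWord n X) (α : ZLex n) :
    u.inv.letter α = (u.letter (u.len + one - α)).map invLetter := rfl

theorem map_invLetter_map (x : Option (X × Bool)) :
    (x.map invLetter).map invLetter = x := by
  cases x <;> simp [invLetter]

theorem append_assoc (u v w : ZWord n X) : (u.append v).append w = u.append (v.append w) := by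
  ext1
  · exact add_assoc _ _ _
  · funext α
    have e1 : (u.append v).len = u.len + v.len := rfl
    have hv := v.len_nonneg
    rcases le_or_gt α u.len with h1 | h1
    · rw [append_letter_of_le (h1.trans (le_add_of_nonneg_right hv)), append_letter_of_le h1,
        append_letter_of_le h1]
    · rw [append_letter_of_lt h1]
      rcases le_or_gt α (u.len + v.len) with h2 | h2
      · rw [append_letter_of_le (by rwa [e1]), append_letter_of_lt h1,
          append_letter_of_le (sub_le_iff_le_add'.mpr h2)]
      · rw [append_letter_of_lt (by rwa [e1]), append_letter_of_lt (lt_sub_iff_add_lt'.mpr h2), e1,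
          sub_sub]

theorem inv_append (u v : ZWord n X) : (u.append v).inv = v.inv.append u.inv := by
  ext1
  · exact add_comm _ _
  · funext α
    have e0 : (u.append v).len = u.len + v.len := rfl
    have e1 : v.inv.len = v.len := rfl
    have h1 := one_pos (n := n)
    rw [inv_letter, e0]
    rcases le_or_gt α v.len with h | h
    · rw [append_letter_of_lt (by grind), append_letter_of_le (by rwa [e1]), inv_letter]
      congr 2
      abel
    · have h2 := one_le_of_pos (sub_pos.mpr h)
      rw [append_letter_of_le (by grind), append_letter_of_lt (by rwa [e1]), inv_letter, e1]
      congr 2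
      abel

theorem eq_of_len_eq_zero {u v : ZWord n X} (hu : u.len = 0) (hv : v.len = 0) : u = v := by
  have key : ∀ {w : ZWord n X}, w.len = 0 → ∀ α, w.letter α = none := fun {w} hw α =>
    letter_eq_none fun h => absurd (h.1.trans h.2) (by rw [hw]; exact not_le.mpr one_pos)
  ext1
  · rw [hu, hv]
  · funext α
    rw [key hu, key hv]

/-- For a nonempty word with a cyclic decomposition `c⁻¹ ∘ u ∘ c`, the longest common initial
segment of the word and its inverse is `c⁻¹`, and `u` is nonempty. -/
theorem IsCDR.exists_isCom {w : ZWord n X} (hw : w.IsCDR) (h0 : w.len ≠ 0) :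
    ∃ c, IsCom w.inv w c ∧ c.len + c.len < w.len := by
  obtain ⟨hred, c, u, hc, hu, rfl⟩ := hw
  have hlen : ((c.inv.append u).append c).len = c.len + u.len + c.len := rfl
  -- If `u` were empty, the word would be `c⁻¹ ∘ c`, which is not reduced at the junction.
  have hupos : 0 < u.len := by
    refine lt_of_le_of_ne u.len_nonneg fun h => ?_
    rw [hlen, ← h, add_zero] at h0
    have hcpos : 0 < c.len := lt_of_le_of_ne c.len_nonneg fun h' => h0 (by rw [← h', add_zero])
    have h1 : (c.inv.append u).len = c.len := by
      change c.len + u.len = c.len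
      rw [← h, add_zero]
    refine hred c.len (one_le_of_pos hcpos) ?_ ?_
    · rw [hlen, ← h, add_zero]; exact lt_add_of_pos_right _ hcpos
    · have e1 := append_letter_add (u := c.inv.append u) (v := c) (α := one) one_pos
      have e2 := append_letter_of_le (u := c.inv.append u) (v := c) (α := c.len) h1.ge
      have e3 := append_letter_of_le (u := c.inv) (v := u) (α := c.len) le_rfl
      rw [h1] at e1
      rw [e1, e2, e3, inv_letter, add_sub_cancel_left, map_invLetter_map]
  refine ⟨c.inv, ⟨u.inv.append c, u.append c, ?_, ?_, ?_⟩, ?_⟩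
  · rw [inv_append, inv_append, inv_inv_word]
  · rw [append_assoc]
  · intro x hx hx'
    rw [append_letter_of_le (one_le_of_pos hupos)] at hx'
    rw [append_letter_of_le (show one ≤ u.inv.len from one_le_of_pos hupos), inv_letter,
      add_sub_cancel_right] at hx
    refine hu.2 hupos ?_
    rw [hx', ← hx, map_invLetter_map]
  · change c.len + c.len < c.len + u.len + c.len
    grind

end ZWord

namespace CDREmbedding

variable {n : ℕ} [NeZero n] {X G : Type*} [Group G] (Φ : CDREmbedding n X G)

open ZWord

theorem len_one : Φ.len 1 = 0 := by
  have h := Φ.len_mul 1 1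
  rw [inv_one, mul_one, com_self] at h
  grind

/-- The cancellation in `g * g` takes less than half of `g` on either side, by the cyclic
decomposition. -/
theorem len_lt_len_mul_self {g : G} (hg : g ≠ 1) : Φ.len g < Φ.len (g * g) := by
  have h0 : (Φ.word g).len ≠ 0 := fun h =>
    hg (Φ.injective (eq_of_len_eq_zero h Φ.len_one))
  obtain ⟨c, hc, hlt⟩ := (Φ.isCDR g).exists_isCom h0
  rw [len_mul]
  have h1 : Φ.com g⁻¹ g = c.len := by
    unfold com
    rw [map_inv]
    exact comLen_eq hc
  rw [h1]
  change c.len + c.len < Φ.len g at hlt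
  grind

/-! ### The universal tree is a `ℤⁿ`-tree -/

/-- The length of the common initial segment of the segments from `ε` to two points. -/
def meet (p q : Φ.PreVertex) : ZLex n := min (min p.pos q.pos) (Φ.com p.elt q.elt)

theorem preDist_eq (p q : Φ.PreVertex) :
    Φ.preDist p q = (p.pos - Φ.meet p q) + (q.pos - Φ.meet p q) := rfl

theorem meet_comm (p q : Φ.PreVertex) : Φ.meet p q = Φ.meet q p := by
  unfold meet; rw [min_comm p.pos, Φ.com_comm]

theorem meet_le_left (p q : Φ.PreVertex) : Φ.meet p q ≤ p.pos :=
  (min_le_left _ _).trans (min_le_left _ _)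

theorem meet_le_right (p q : Φ.PreVertex) : Φ.meet p q ≤ q.pos :=
  (min_le_left _ _).trans (min_le_right _ _)

theorem meet_nonneg (p q : Φ.PreVertex) : 0 ≤ Φ.meet p q :=
  le_min (le_min p.pos_nonneg q.pos_nonneg) (Φ.com_nonneg _ _)

/-- This ultrametric inequality is the source of the tree axioms: distances are heights minus twice
the height of the branching. -/
theorem meet_ultra (p q r : Φ.PreVertex) : min (Φ.meet p q) (Φ.meet q r) ≤ Φ.meet p r := by
  have h := Φ.com_min_mid p.elt q.elt r.elt
  unfold meet
  grind

/-- The point at height `α` on the segment from `ε` to the endpoint of `q`. -/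
def lower (q : Φ.PreVertex) (α : ZLex n) (h0 : 0 ≤ α) (h : α ≤ q.pos) : Φ.PreVertex :=
  ⟨α, q.elt, h0, h.trans q.pos_le⟩

theorem meet_lower (p q : Φ.PreVertex) {α : ZLex n} (h0 : 0 ≤ α) (h : α ≤ q.pos) :
    Φ.meet (Φ.lower q α h0 h) p = min α (Φ.meet q p) := by
  unfold meet lower
  grind

theorem meet_self (p : Φ.PreVertex) : Φ.meet p p = p.pos := by
  unfold meet
  rw [com_self, min_self, min_eq_left p.pos_le]

/-- Of three points, the two that branch last have their branch point as the median; `r` has left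
them at or below it. -/
theorem median_aux (p q r : Φ.PreVertex) (h1 : Φ.meet p r ≤ Φ.meet p q)
    (h2 : Φ.meet q r ≤ Φ.meet p q) :
    ∃ m, Φ.preDist p q = Φ.preDist p m + Φ.preDist m q ∧
      Φ.preDist p r = Φ.preDist p m + Φ.preDist m r ∧
      Φ.preDist q r = Φ.preDist q m + Φ.preDist m r := by
  refine ⟨Φ.lower p (Φ.meet p q) (Φ.meet_nonneg _ _) (Φ.meet_le_left _ _), ?_⟩
  have e1 := Φ.meet_ultra p q r
  have e2 := Φ.meet_ultra q p r
  simp only [preDist_eq, Φ.meet_comm _ (Φ.lower _ _ _ _), meet_lower, meet_self]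
  have e3 := Φ.meet_le_left p q
  have e4 := Φ.meet_comm p q
  have e5 : (Φ.lower p (Φ.meet p q) (Φ.meet_nonneg _ _) (Φ.meet_le_left _ _)).pos = Φ.meet p q :=
    rfl
  rw [e5]
  grind

theorem isZTree : IsZTree Φ.dist where
  self v := Quotient.inductionOn v fun p => by
    change Φ.preDist p p = 0
    rw [preDist_eq, meet_self, sub_self, add_zero]
  eq_of v w := Quotient.inductionOn₂ v w fun p q h =>
    Quotient.sound ((Φ.preDist_eq_zero p q).mp h)
  symm v w := Quotient.inductionOn₂ v w fun p q => Φ.preDist_comm p q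
  four a b c e := by
    induction a using Quotient.inductionOn with | _ a
    induction b using Quotient.inductionOn with | _ b
    induction c using Quotient.inductionOn with | _ c
    induction e using Quotient.inductionOn with | _ e
    change Φ.preDist a b + Φ.preDist c e ≤
      max (Φ.preDist a c + Φ.preDist b e) (Φ.preDist a e + Φ.preDist b c)
    simp only [preDist_eq]
    have h1 := Φ.meet_ultra a c b
    have h2 := Φ.meet_ultra a e b
    have h3 := Φ.meet_ultra c a e
    have h4 := Φ.meet_ultra c b e
    have h5 := Φ.meet_comm c a
    have h6 := Φ.meet_comm c b
    have h7 := Φ.meet_comm e b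
    generalize Φ.meet a b = ab at *
    generalize Φ.meet a c = ac at *
    generalize Φ.meet a e = ae at *
    generalize Φ.meet b c = bc at *
    generalize Φ.meet b e = be at *
    generalize Φ.meet c e = ce at *
    grind
  geod u w x h0 h := by
    induction u using Quotient.inductionOn with | _ p
    induction w using Quotient.inductionOn with | _ q
    change x ≤ Φ.preDist p q at h
    rw [preDist_eq] at h
    have h1 := Φ.meet_le_left p q
    have h2 := Φ.meet_le_right p q
    have h3 := Φ.meet_nonneg p q
    have h4 := Φ.meet_comm p q
    by_cases hx : x ≤ p.pos - Φ.meet p q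
    · refine ⟨Quotient.mk _ (Φ.lower p (p.pos - x) (by grind) (sub_le_self _ h0)), ?_, ?_⟩
      · change Φ.preDist p _ = x
        rw [preDist_eq, meet_comm, meet_lower, meet_self, min_eq_left (sub_le_self _ h0)]
        change p.pos - (p.pos - x) + (p.pos - x - (p.pos - x)) = x
        abel
      · change Φ.preDist p q = Φ.preDist p _ + Φ.preDist _ q
        simp only [preDist_eq, Φ.meet_comm p (Φ.lower _ _ _ _), meet_lower, meet_self]
        change _ = p.pos - _ + (p.pos - x - _) + (p.pos - x - _ + _)
        grind
    · refine ⟨Quotient.mk _ (Φ.lower q (Φ.meet p q + (x - (p.pos - Φ.meet p q)))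
        (by grind) (by grind)), ?_, ?_⟩
      · change Φ.preDist p _ = x
        rw [preDist_eq, meet_comm, meet_lower, ← h4]
        change p.pos - _ + (Φ.meet p q + (x - (p.pos - Φ.meet p q)) - _) = x
        grind
      · change Φ.preDist p q = Φ.preDist p _ + Φ.preDist _ q
        simp only [preDist_eq, Φ.meet_comm p (Φ.lower _ _ _ _), meet_lower, meet_self]
        change _ = p.pos - _ + (Φ.meet p q + (x - (p.pos - Φ.meet p q)) - _) +
          (Φ.meet p q + (x - (p.pos - Φ.meet p q)) - _ + _)
        grind
  median a b c := by
    induction a using Quotient.inductionOn with | _ p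
    induction b using Quotient.inductionOn with | _ q
    induction c using Quotient.inductionOn with | _ r
    have conv : ∀ {p q m : Φ.PreVertex}, Φ.preDist p q = Φ.preDist p m + Φ.preDist m q →
        OnSeg Φ.dist (Quotient.mk _ p) (Quotient.mk _ m) (Quotient.mk _ q) := fun h => h
    have rev : ∀ {p q m : Φ.PreVertex}, Φ.preDist p q = Φ.preDist p m + Φ.preDist m q →
        OnSeg Φ.dist (Quotient.mk _ q) (Quotient.mk _ m) (Quotient.mk _ p) := fun {p q m} h => by
      change Φ.preDist q p = Φ.preDist q m + Φ.preDist m p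
      rw [preDist_comm, h, preDist_comm, add_comm, Φ.preDist_comm m q]
    have c1 := Φ.meet_comm p q
    have c2 := Φ.meet_comm q r
    have c3 := Φ.meet_comm p r
    rcases le_total (Φ.meet p r) (Φ.meet p q) with h1 | h1
    · rcases le_total (Φ.meet q r) (Φ.meet p q) with h2 | h2
      · obtain ⟨m, m1, m2, m3⟩ := Φ.median_aux p q r h1 h2
        exact ⟨_, conv m1, conv m3, conv m2⟩
      · obtain ⟨m, m1, m2, m3⟩ := Φ.median_aux q r p (by rwa [← c1]) (by
          rw [← c3]; exact h1.trans h2)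
        exact ⟨_, rev m2, conv m1, rev m3⟩
    · rcases le_total (Φ.meet q r) (Φ.meet p r) with h2 | h2
      · obtain ⟨m, m1, m2, m3⟩ := Φ.median_aux p r q h1 (by rwa [← c2])
        exact ⟨_, conv m2, rev m3, conv m1⟩
      · obtain ⟨m, m1, m2, m3⟩ := Φ.median_aux q r p (by rw [← c1]; exact h1.trans h2)
          (by rwa [← c3])
        exact ⟨_, rev m2, conv m1, rev m3⟩

/-! ### The action on the universal tree -/

/-- The point `⟨α, g⟩`. -/
def pt (g : G) (α : ZLex n) (h0 : 0 ≤ α) (h : α ≤ Φ.len g) : Φ.Tree :=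
  Quotient.mk _ ⟨α, g, h0, h⟩

/-- The translate `g ε` of the base point. -/
def orb (g : G) : Φ.Tree := Φ.pt g (Φ.len g) (Φ.len_nonneg g) le_rfl

theorem exists_pt (v : Φ.Tree) : ∃ g α h0 h, v = Φ.pt g α h0 h :=
  Quotient.inductionOn v fun p => ⟨p.elt, p.pos, p.pos_nonneg, p.pos_le, rfl⟩

theorem dist_pt_pt {f g : G} {α β : ZLex n} (h0 h h0' h') :
    Φ.dist (Φ.pt f α h0 h) (Φ.pt g β h0' h') =
      (α - min (min α β) (Φ.com f g)) + (β - min (min α β) (Φ.com f g)) := rfl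

theorem pt_eq_pt {f g : G} {α β : ZLex n} {h0 h h0' h'} :
    Φ.pt f α h0 h = Φ.pt g β h0' h' ↔ α = β ∧ α ≤ Φ.com f g :=
  Quotient.eq

theorem root_eq_orb : Φ.root = Φ.orb 1 := by
  refine Φ.pt_eq_pt.mpr ⟨Φ.len_one.symm, Φ.com_nonneg _ _⟩

theorem dist_root_pt {g : G} {α : ZLex n} (h0 h) : Φ.dist Φ.root (Φ.pt g α h0 h) = α := by
  change (0 - min (min 0 α) _) + (α - min (min 0 α) _) = α
  have := Φ.com_nonneg 1 g
  grind

theorem dist_pt_same {g : G} {α β : ZLex n} (h0 h h0' h') (hαβ : α ≤ β) :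
    Φ.dist (Φ.pt g α h0 h) (Φ.pt g β h0' h') = β - α := by
  rw [dist_pt_pt, com_self]
  grind

theorem onSeg_root_pt {g : G} {α β : ZLex n} (h0 h h0' h') (hαβ : α ≤ β) :
    OnSeg Φ.dist Φ.root (Φ.pt g α h0 h) (Φ.pt g β h0' h') := by
  unfold OnSeg
  rw [dist_root_pt, dist_root_pt, dist_pt_same _ _ _ _ _ hαβ]
  abel

theorem act_orb (h g : G) : Φ.act h (Φ.orb g) = Φ.orb (h * g) := by
  change Quotient.mk _ (Φ.preAct h _) = _
  unfold preAct
  have h1 := Φ.len_mul h g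
  have h2 := Φ.com_mul_left h g
  have h3 := Φ.com_le_right h⁻¹ g
  split
  · rename_i hc
    change Φ.len g ≤ Φ.com h⁻¹ g at hc
    refine Φ.pt_eq_pt.mpr ⟨?_, ?_⟩
    · grind
    · grind
  · refine Φ.pt_eq_pt.mpr ⟨?_, ?_⟩
    · change Φ.len h - Φ.com h⁻¹ g + (Φ.len g - Φ.com h⁻¹ g) = _
      rw [h1]; abel
    · change Φ.len h - Φ.com h⁻¹ g + (Φ.len g - Φ.com h⁻¹ g) ≤ _
      rw [com_self, h1]
      grind

theorem act_onSeg (h : G) {u z w : Φ.Tree} (hz : OnSeg Φ.dist u z w) :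
    OnSeg Φ.dist (Φ.act h u) (Φ.act h z) (Φ.act h w) := by
  unfold OnSeg at *
  rw [dist_act, dist_act, dist_act, hz]

/-- The definition of the action by cases need not be composed with itself: a point of a segment
from `ε` to a translate is determined by its distance from `ε`, so an isometry is known there from
its effect on the orbit of `ε`. -/
instance : MulAction G Φ.Tree where
  smul := Φ.act
  one_smul v := by
    change Φ.act 1 v = v
    obtain ⟨g, α, h0, h, rfl⟩ := Φ.exists_pt v
    have h1 := Φ.onSeg_root_pt h0 h (Φ.len_nonneg g) le_rfl h
    have h2 := Φ.act_onSeg 1 h1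
    change OnSeg _ _ _ (Φ.act 1 (Φ.orb g)) at h2
    rw [act_orb, root_eq_orb, act_orb, one_mul, one_mul, ← root_eq_orb] at h2
    refine Φ.isZTree.eq_of_onSeg h2 h1 ?_
    have h3 := Φ.dist_act 1 Φ.root (Φ.pt g α h0 h)
    rwa [root_eq_orb, act_orb, one_mul, ← root_eq_orb] at h3
  mul_smul f f' v := by
    change Φ.act (f * f') v = Φ.act f (Φ.act f' v)
    obtain ⟨g, α, h0, h, rfl⟩ := Φ.exists_pt v
    have h1 := Φ.onSeg_root_pt h0 h (Φ.len_nonneg g) le_rfl h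
    change OnSeg _ _ _ (Φ.orb g) at h1
    have h2 := Φ.act_onSeg (f * f') h1
    have h3 := Φ.act_onSeg f (Φ.act_onSeg f' h1)
    rw [root_eq_orb] at h2 h3
    simp only [act_orb, ← mul_assoc] at h2 h3
    refine Φ.isZTree.eq_of_onSeg h2 h3 ?_
    have e1 := Φ.dist_act (f * f') (Φ.orb 1) (Φ.pt g α h0 h)
    have e2 := Φ.dist_act f (Φ.act f' (Φ.orb 1)) (Φ.act f' (Φ.pt g α h0 h))
    rw [Φ.dist_act f'] at e2
    rw [act_orb] at e1
    rw [act_orb, act_orb, ← mul_assoc] at e2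
    rw [e1, e2]

theorem dist_smul (g : G) (v w : Φ.Tree) : Φ.dist (g • v) (g • w) = Φ.dist v w := Φ.dist_act g v w

theorem smul_orb (h g : G) : h • Φ.orb g = Φ.orb (h * g) := Φ.act_orb h g

theorem smul_root (g : G) : g • Φ.root = Φ.orb g := by
  rw [root_eq_orb, smul_orb, mul_one]

theorem dist_root_orb (g : G) : Φ.dist Φ.root (Φ.orb g) = Φ.len g := Φ.dist_root_pt _ _

/-- Every nontrivial element of `G` has an axis in the universal tree. -/
theorem dist_lt_dist_smul_smul {g : G} (hg : g ≠ 1) (p : Φ.Tree) :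
    Φ.dist p (g • p) < Φ.dist p (g • g • p) := by
  have h := Φ.len_lt_len_mul_self hg
  rw [← dist_root_orb, ← dist_root_orb, ← smul_root, ← smul_root, mul_smul] at h
  obtain ⟨m, -, -, m1, m2⟩ := Φ.isZTree.exists_axis Φ.dist_smul h
  rw [Φ.isZTree.dist_smul_smul Φ.dist_smul m1 m2]
  exact lt_add_of_pos_right _ (lt_of_le_of_ne (Φ.isZTree.nonneg _ _) fun h =>
    m2 (Φ.isZTree.eq_of _ _ h.symm))

theorem eq_one_of_smul_eq (g : G) (v : Φ.Tree) (h : g • v = v) : g = 1 := by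
  by_contra hg
  have := Φ.dist_lt_dist_smul_smul hg v
  rw [h, h] at this
  exact lt_irrefl _ this

theorem eq_one_of_pow_eq_one (Φ : CDREmbedding n X G) (g : G) (m : ℕ) (hm : m ≠ 0)
    (h : g ^ m = 1) : g = 1 := by
  by_contra hg
  obtain ⟨v, -, -, v1, v2⟩ :=
    Φ.isZTree.exists_axis Φ.dist_smul (Φ.dist_lt_dist_smul_smul hg Φ.root)
  have h1 := Φ.isZTree.dist_pow Φ.dist_smul v1 v2 m
  rw [h, one_smul, Φ.isZTree.self] at h1
  have h2 : 0 < Φ.dist v (g • v) := lt_of_le_of_ne (Φ.isZTree.nonneg _ _) fun h =>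
    v2 (Φ.isZTree.eq_of _ _ h.symm)
  exact absurd h1 (nsmul_pos h2 hm).ne

end CDREmbedding

namespace CDREmbedding

variable {n : ℕ} [NeZero n] {X G : Type*} [Group G] (Φ : CDREmbedding n X G)

open ZWord

/-! ### Labels of edges -/

/-- The last letter on the segment from `ε` to a point. -/
def lastLetter : Φ.Tree → Option (X × Bool) :=
  Quotient.lift (fun p => (Φ.word p.elt).letter p.pos) fun p q h => by
    obtain ⟨h1, h2⟩ := h
    rw [← h1]
    exact ((Φ.le_com_iff _ _ _).mp h2).2.2 _ le_rfl

/-- The label of the edge from `a` to `b`. -/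
def label (a b : Φ.Tree) : Option (X × Bool) :=
  if Φ.dist Φ.root a < Φ.dist Φ.root b then Φ.lastLetter b else (Φ.lastLetter a).map invLetter

/-- Since `1` is the least positive element, one of the two legs from the branch point is trivial;
so an edge lies on the segment of a single word. -/
theorem exists_edge {a b : Φ.Tree} (h : Φ.dist a b = one) :
    (∃ (g : G) (α : ZLex n) (h0 : 0 ≤ α) (h1 : α + one ≤ Φ.len g),
      a = Φ.pt g α h0 ((le_add_of_nonneg_right ZLex.one_pos.le).trans h1) ∧
      b = Φ.pt g (α + one) (add_nonneg h0 ZLex.one_pos.le) h1) ∨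
    (∃ (g : G) (α : ZLex n) (h0 : 0 ≤ α) (h1 : α + one ≤ Φ.len g),
      b = Φ.pt g α h0 ((le_add_of_nonneg_right ZLex.one_pos.le).trans h1) ∧
      a = Φ.pt g (α + one) (add_nonneg h0 ZLex.one_pos.le) h1) := by
  obtain ⟨f, α, h0, h1, rfl⟩ := Φ.exists_pt a
  obtain ⟨g, β, h0', h1', rfl⟩ := Φ.exists_pt b
  rw [dist_pt_pt] at h
  have hc : ∀ {a b : ZLex n}, 0 ≤ a → 0 ≤ b → a + b = one → a = 0 ∨ b = 0 := by
    intro a b ha hb hab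
    rcases ha.eq_or_lt with ha | ha
    · exact Or.inl ha.symm
    rcases hb.eq_or_lt with hb | hb
    · exact Or.inr hb.symm
    have h2 := one_le_of_pos ha
    have h3 := ZLex.one_pos (n := n)
    grind
  have m1 : min (min α β) (Φ.com f g) ≤ α := (min_le_left _ _).trans (min_le_left _ _)
  have m2 : min (min α β) (Φ.com f g) ≤ β := (min_le_left _ _).trans (min_le_right _ _)
  have m3 : min (min α β) (Φ.com f g) ≤ Φ.com f g := min_le_right _ _
  generalize min (min α β) (Φ.com f g) = c at *
  rcases hc (sub_nonneg.mpr m1) (sub_nonneg.mpr m2) h with h2 | h2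
  · left
    obtain rfl : β = α + one := by grind
    exact ⟨g, α, h0, h1', Φ.pt_eq_pt.mpr ⟨rfl, by grind⟩, rfl⟩
  · right
    obtain rfl : α = β + one := by grind
    exact ⟨f, β, h0', h1, Φ.pt_eq_pt.mpr ⟨rfl, by rw [com_comm]; grind⟩, rfl⟩

theorem label_up {g : G} {α : ZLex n} (h0 h h0' h') :
    Φ.label (Φ.pt g α h0 h) (Φ.pt g (α + one) h0' h') = (Φ.word g).letter (α + one) := by
  unfold label
  rw [if_pos]
  · rfl
  · rw [dist_root_pt, dist_root_pt]
    exact lt_add_of_pos_right _ ZLex.one_pos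

theorem label_down {g : G} {α : ZLex n} (h0 h h0' h') :
    Φ.label (Φ.pt g (α + one) h0' h') (Φ.pt g α h0 h) =
      ((Φ.word g).letter (α + one)).map invLetter := by
  unfold label
  rw [if_neg]
  · rfl
  · rw [dist_root_pt, dist_root_pt, not_lt]
    exact le_add_of_nonneg_right ZLex.one_pos.le

theorem label_symm {a b : Φ.Tree} (h : Φ.dist a b = one) :
    Φ.label b a = (Φ.label a b).map invLetter := by
  rcases Φ.exists_edge h with ⟨g, α, h0, h1, rfl, rfl⟩ | ⟨g, α, h0, h1, rfl, rfl⟩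
  · rw [label_up, label_down]
  · rw [label_up, label_down, map_invLetter_map]

theorem label_isSome {a b : Φ.Tree} (h : Φ.dist a b = one) : (Φ.label a b).isSome := by
  have key : ∀ (g : G) (α : ZLex n), 0 ≤ α → α + one ≤ Φ.len g →
      ((Φ.word g).letter (α + one)).isSome := fun g α h0 h1 => by
    rw [isSome_iff]
    exact ⟨le_add_of_nonneg_left h0, h1⟩
  rcases Φ.exists_edge h with ⟨g, α, h0, h1, rfl, rfl⟩ | ⟨g, α, h0, h1, rfl, rfl⟩
  · rw [label_up]; exact key g α h0 h1
  · rw [label_down, Option.isSome_map]; exact key g α h0 h1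

/-- Two edges that start at the same vertex and have the same label are equal. -/
theorem eq_of_label_eq {a b b' : Φ.Tree} (h : Φ.dist a b = one) (h' : Φ.dist a b' = one)
    (hl : Φ.label a b = Φ.label a b') : b = b' := by
  -- An edge away from `ε` and an edge toward `ε` with equal labels would be a cancelling pair in a
  -- reduced word.
  have mixed : ∀ (f g : G) (α β : ZLex n) h0 h1 h0' h1',
      Φ.pt f α h0 ((le_add_of_nonneg_right ZLex.one_pos.le).trans h1) =
        Φ.pt g (β + one) (add_nonneg h0' ZLex.one_pos.le) h1' →
      (Φ.word f).letter (α + one) ≠ ((Φ.word g).letter (β + one)).map invLetter := by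
    intro f g α β h0 h1 h0' h1' hpt hl
    obtain ⟨rfl, h2⟩ := Φ.pt_eq_pt.mp hpt
    have h3 := ((Φ.le_com_iff _ _ _).mp h2).2.2 (β + one) le_rfl
    refine (Φ.isCDR f).1 (β + one) (le_add_of_nonneg_left h0') ?_ ?_
    · exact (lt_add_of_pos_right _ ZLex.one_pos).trans_le h1
    · rw [hl, h3]
  rcases Φ.exists_edge h with ⟨f, α, h0, h1, rfl, rfl⟩ | ⟨f, α, h0, h1, rfl, rfl⟩ <;>
    rcases Φ.exists_edge h' with ⟨g, β, h0', h1', e1, rfl⟩ | ⟨g, β, h0', h1', rfl, e1⟩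
  · obtain ⟨rfl, h2⟩ := Φ.pt_eq_pt.mp e1
    rw [label_up, e1, label_up] at hl
    refine Φ.pt_eq_pt.mpr ⟨rfl, (Φ.le_com_iff _ _ _).mpr ⟨h1, h1', fun γ hγ => ?_⟩⟩
    rcases hγ.eq_or_lt with rfl | hγ
    · exact hl
    · refine ((Φ.le_com_iff _ _ _).mp h2).2.2 γ ?_
      by_contra hlt
      have := one_le_of_pos (sub_pos.mpr (not_le.mp hlt))
      grind
  · refine absurd hl ?_
    rw [label_up, e1, label_down]
    exact mixed _ _ _ _ h0 h1 h0' h1' e1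
  · refine absurd hl ?_
    rw [label_down, e1, label_up]
    exact (mixed _ _ _ _ h0' h1' h0 h1 e1.symm).symm
  · obtain ⟨h2, h3⟩ := Φ.pt_eq_pt.mp e1
    obtain rfl := add_right_cancel h2
    exact Φ.pt_eq_pt.mpr ⟨rfl, (le_add_of_nonneg_right ZLex.one_pos.le).trans h3⟩

/-- An edge in the part of `g` that cancels against `h` is sent to an edge of `h` traversed
backwards, and words of `h⁻¹` and `g` agree there. Any other edge is sent to the final part of `h *
g`, which is copied from `g`. -/
theorem label_act_up (h g : G) {α : ZLex n} (h0 : 0 ≤ α) (h1 : α + one ≤ Φ.len g) :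
    Φ.label (Φ.act h (Φ.pt g α h0 ((le_add_of_nonneg_right ZLex.one_pos.le).trans h1)))
      (Φ.act h (Φ.pt g (α + one) (add_nonneg h0 ZLex.one_pos.le) h1)) =
      (Φ.word g).letter (α + one) := by
  have hpos := ZLex.one_pos (n := n)
  have hC := Φ.com_le_left h⁻¹ g
  rw [len_inv] at hC
  by_cases hc : α + one ≤ Φ.com h⁻¹ g
  · have hc' : α ≤ Φ.com h⁻¹ g := (le_add_of_nonneg_right ZLex.one_pos.le).trans hc
    have e1 : Φ.act h (Φ.pt g α h0 ((le_add_of_nonneg_right ZLex.one_pos.le).trans h1)) =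
        Φ.pt h (Φ.len h - (α + one) + one) (by grind) (by grind) := by
      change Quotient.mk _ (Φ.preAct h _) = _
      unfold preAct
      rw [dif_pos hc']
      exact Φ.pt_eq_pt.mpr ⟨by abel, by rw [com_self]; exact sub_le_self _ h0⟩
    have e2 : Φ.act h (Φ.pt g (α + one) (add_nonneg h0 ZLex.one_pos.le) h1) =
        Φ.pt h (Φ.len h - (α + one)) (by grind) (by grind) := by
      change Quotient.mk _ (Φ.preAct h _) = _
      unfold preAct
      rw [dif_pos hc]
      rfl
    rw [e1, e2, label_down, ← ((Φ.le_com_iff _ _ _).mp hc).2.2 _ le_rfl, map_inv, inv_letter]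
    congr 2
    change _ = Φ.len h + one - (α + one)
    abel
  · have hlt : Φ.com h⁻¹ g ≤ α := by
      by_contra hlt
      have := one_le_of_pos (sub_pos.mpr (not_le.mp hlt))
      grind
    have hlen := Φ.len_mul h g
    have hcm := Φ.com_mul_left h g
    have e1 : Φ.act h (Φ.pt g α h0 ((le_add_of_nonneg_right ZLex.one_pos.le).trans h1)) =
        Φ.pt (h * g) (Φ.len h - Φ.com h⁻¹ g + (α - Φ.com h⁻¹ g)) (by grind) (by grind) := by
      change Quotient.mk _ (Φ.preAct h _) = _
      unfold preAct
      split
      · rename_i hc'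
        change α ≤ Φ.com h⁻¹ g at hc'
        refine Φ.pt_eq_pt.mpr ⟨?_, ?_⟩
        · change Φ.len h - α = _; grind
        · change Φ.len h - α ≤ _; grind
      · rfl
    have e2 : Φ.act h (Φ.pt g (α + one) (add_nonneg h0 ZLex.one_pos.le) h1) =
        Φ.pt (h * g) (Φ.len h - Φ.com h⁻¹ g + (α - Φ.com h⁻¹ g) + one) (by grind) (by grind) := by
      change Quotient.mk _ (Φ.preAct h _) = _
      unfold preAct
      rw [dif_neg hc]
      refine Φ.pt_eq_pt.mpr ⟨?_, ?_⟩
      · change Φ.len h - _ + (α + one - _) = _; abel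
      · change Φ.len h - _ + (α + one - _) ≤ _; rw [com_self]; grind
    rw [e1, e2, label_up]
    obtain ⟨c, a, b, i1, i2, i3, i4⟩ := Φ.map_mul h g
    have j1 : Φ.com h⁻¹ g = c.len := by
      unfold com
      rw [map_inv]
      exact comLen_eq ⟨a, b, i1, i2, i3⟩
    have j2 : Φ.len h = c.len + a.len := congrArg ZWord.len i1
    have j3 : Φ.len h - Φ.com h⁻¹ g + (α - Φ.com h⁻¹ g) + one =
        a.inv.len + (α - c.len + one) := by
      rw [j1, j2]
      change _ = a.len + _
      abel
    have j4 : α + one = c.len + (α - c.len + one) := by abel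
    have j5 : 0 < α - c.len + one :=
      add_pos_of_nonneg_of_pos (sub_nonneg.mpr (j1 ▸ hlt)) ZLex.one_pos
    rw [j3, i4, append_letter_add j5, j4, i2, append_letter_add j5]

theorem label_smul (h : G) {a b : Φ.Tree} (hab : Φ.dist a b = one) :
    Φ.label (h • a) (h • b) = Φ.label a b := by
  rcases Φ.exists_edge hab with ⟨g, α, h0, h1, rfl, rfl⟩ | ⟨g, α, h0, h1, rfl, rfl⟩
  · rw [label_up]
    exact Φ.label_act_up h g h0 h1
  · rw [Φ.isZTree.symm] at hab
    rw [Φ.label_symm (by rwa [dist_smul]), Φ.label_symm hab, label_up]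
    exact congrArg _ (Φ.label_act_up h g h0 h1)

/-! ### The words along the segments of the universal tree -/

/-- The point of the segment `[u, w]` at the distance `x` from `u`. -/
def segPoint (u w : Φ.Tree) (x : ZLex n) : Φ.Tree :=
  if h : 0 ≤ x ∧ x ≤ Φ.dist u w then (Φ.isZTree.geod u w x h.1 h.2).choose else u

theorem segPoint_spec {u w : Φ.Tree} {x : ZLex n} (h0 : 0 ≤ x) (h : x ≤ Φ.dist u w) :
    Φ.dist u (Φ.segPoint u w x) = x ∧ OnSeg Φ.dist u (Φ.segPoint u w x) w := by
  unfold segPoint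
  rw [dif_pos ⟨h0, h⟩]
  exact (Φ.isZTree.geod u w x h0 h).choose_spec

theorem segPoint_dist {u a w : Φ.Tree} (h : OnSeg Φ.dist u a w) :
    Φ.segPoint u w (Φ.dist u a) = a := by
  obtain ⟨h1, h2⟩ := Φ.segPoint_spec (Φ.isZTree.nonneg u a) (Φ.isZTree.le_of_onSeg h)
  exact Φ.isZTree.eq_of_onSeg h2 h h1

theorem segPoint_adjacent {u w : Φ.Tree} {β : ZLex n} (h : one ≤ β ∧ β ≤ Φ.dist u w) :
    Φ.dist (Φ.segPoint u w (β - one)) (Φ.segPoint u w β) = one := by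
  have h1 := ZLex.one_pos (n := n)
  obtain ⟨a1, a2⟩ := Φ.segPoint_spec (u := u) (w := w) (x := β - one) (by grind) (by grind)
  obtain ⟨b1, b2⟩ := Φ.segPoint_spec (u := u) (w := w) (x := β) (by grind) h.2
  have h2 := Φ.isZTree.onSeg_of_le a2 b2 (by rw [a1, b1]; exact sub_le_self _ h1.le)
  unfold OnSeg at h2
  rw [a1, b1] at h2
  grind

open Classical in
/-- The word formed by the labels along the segment `[u, w]`. -/
def pathWord (u w : Φ.Tree) : ZWord n X where
  len := Φ.dist u w
  len_nonneg := Φ.isZTree.nonneg u w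
  letter β := if one ≤ β ∧ β ≤ Φ.dist u w then
    Φ.label (Φ.segPoint u w (β - one)) (Φ.segPoint u w β) else none
  isSome_iff β := by
    split
    · rename_i h
      exact iff_of_true (Φ.label_isSome (Φ.segPoint_adjacent h)) h
    · rename_i h
      exact iff_of_false (by simp) h

theorem pathWord_len (u w : Φ.Tree) : (Φ.pathWord u w).len = Φ.dist u w := rfl

theorem pathWord_letter {u a b w : Φ.Tree} (ha : OnSeg Φ.dist u a w) (hb : OnSeg Φ.dist u b w)
    (hab : Φ.dist u b = Φ.dist u a + one) :
    (Φ.pathWord u w).letter (Φ.dist u b) = Φ.label a b := by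
  change (if _ then _ else _) = _
  rw [if_pos, hab, add_sub_cancel_right, ← hab, Φ.segPoint_dist ha, Φ.segPoint_dist hb]
  refine ⟨?_, Φ.isZTree.le_of_onSeg hb⟩
  rw [hab]
  exact le_add_of_nonneg_left (Φ.isZTree.nonneg _ _)

theorem exists_pathWord_letter {u w : Φ.Tree} {β : ZLex n} (h1 : one ≤ β) (h2 : β ≤ Φ.dist u w) :
    ∃ a b, OnSeg Φ.dist u a w ∧ OnSeg Φ.dist u b w ∧ Φ.dist u b = β ∧
      Φ.dist u b = Φ.dist u a + one ∧ Φ.dist a b = one ∧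
      (Φ.pathWord u w).letter β = Φ.label a b := by
  have h := ZLex.one_pos (n := n)
  obtain ⟨a1, a2⟩ := Φ.segPoint_spec (u := u) (w := w) (x := β - one) (by grind) (by grind)
  obtain ⟨b1, b2⟩ := Φ.segPoint_spec (u := u) (w := w) (x := β) (by grind) h2
  refine ⟨_, _, a2, b2, b1, by rw [a1, b1]; abel, Φ.segPoint_adjacent ⟨h1, h2⟩, ?_⟩
  change (if _ then _ else _) = _
  rw [if_pos ⟨h1, h2⟩]

theorem pathWord_ext {u w : Φ.Tree} {v : ZWord n X} (hlen : v.len = Φ.dist u w)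
    (h : ∀ a b, OnSeg Φ.dist u a w → OnSeg Φ.dist u b w → Φ.dist u b = Φ.dist u a + one →
      Φ.dist a b = one → v.letter (Φ.dist u b) = Φ.label a b) : Φ.pathWord u w = v := by
  ext1
  · exact hlen.symm
  · funext β
    by_cases hβ : one ≤ β ∧ β ≤ Φ.dist u w
    · obtain ⟨a, b, h1, h2, rfl, h4, h5, h6⟩ := Φ.exists_pathWord_letter hβ.1 hβ.2
      rw [h6, h a b h1 h2 h4 h5]
    · rw [letter_eq_none hβ, letter_eq_none (by rwa [hlen])]

theorem pathWord_symm (u w : Φ.Tree) : Φ.pathWord w u = (Φ.pathWord u w).inv := by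
  refine Φ.pathWord_ext (Φ.isZTree.symm u w) fun a b ha hb hab hab' => ?_
  have e1 := Φ.isZTree.onSeg_symm ha
  have e2 := Φ.isZTree.onSeg_symm hb
  have e3 := Φ.isZTree.symm u w
  have e4 := Φ.isZTree.symm a u
  have e5 := Φ.isZTree.symm b u
  have e6 : Φ.dist u a = Φ.dist u b + one := by
    unfold OnSeg at ha hb
    grind
  have e7 : Φ.dist u w + one - Φ.dist w b = Φ.dist u a := by
    unfold OnSeg at ha hb
    grind
  rw [inv_letter, pathWord_len, e7, Φ.pathWord_letter e2 e1 e6]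
  exact (Φ.label_symm (by rw [Φ.isZTree.symm]; exact hab')).symm

theorem pathWord_append {u z w : Φ.Tree} (h : OnSeg Φ.dist u z w) :
    Φ.pathWord u w = (Φ.pathWord u z).append (Φ.pathWord z w) := by
  refine Φ.pathWord_ext h.symm fun a b ha hb hab hab' => ?_
  have hpos := ZLex.one_pos (n := n)
  rcases le_or_gt (Φ.dist u b) (Φ.dist u z) with h1 | h1
  · rw [append_letter_of_le h1]
    refine Φ.pathWord_letter (Φ.isZTree.onSeg_of_le ha h ?_) (Φ.isZTree.onSeg_of_le hb h h1) hab
    exact (by rw [hab]; exact le_add_of_nonneg_right hpos.le : Φ.dist u a ≤ Φ.dist u b).trans h1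
  · have h2 := one_le_of_pos (sub_pos.mpr h1)
    have ka := Φ.isZTree.onSeg_of_le h ha (by grind)
    have kb := Φ.isZTree.onSeg_of_le h hb h1.le
    have e1 : Φ.dist u b = Φ.dist u z + Φ.dist z b := kb
    have e2 : Φ.dist u a = Φ.dist u z + Φ.dist z a := ka
    have e3 : (Φ.pathWord u z).len = Φ.dist u z := rfl
    rw [append_letter_of_lt h1, e3, e1, add_sub_cancel_left]
    exact Φ.pathWord_letter (Φ.isZTree.onSeg_trans' ha ka) (Φ.isZTree.onSeg_trans' hb kb) (by grind)

theorem pathWord_smul (h : G) (u w : Φ.Tree) : Φ.pathWord (h • u) (h • w) = Φ.pathWord u w := by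
  refine (Φ.pathWord_ext (Φ.dist_smul h u w) fun a b ha hb hab hab' => ?_).symm
  rw [← Φ.label_smul h hab', ← Φ.dist_smul h u b]
  refine Φ.pathWord_letter (Φ.isZTree.smul_onSeg Φ.dist_smul h ha)
    (Φ.isZTree.smul_onSeg Φ.dist_smul h hb) ?_
  rw [dist_smul, dist_smul, hab]

theorem pathWord_root_orb (g : G) : Φ.pathWord Φ.root (Φ.orb g) = Φ.word g := by
  refine Φ.pathWord_ext (Φ.dist_root_orb g).symm fun a b ha hb hab hab' => ?_
  have key : ∀ {a}, OnSeg Φ.dist Φ.root a (Φ.orb g) → ∃ α h0 h, a = Φ.pt g α h0 h := fun {a} ha => by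
    have h := Φ.isZTree.le_of_onSeg ha
    rw [dist_root_orb] at h
    refine ⟨Φ.dist Φ.root a, Φ.isZTree.nonneg _ _, h, Φ.isZTree.eq_of_onSeg ha
      (Φ.onSeg_root_pt _ _ (Φ.len_nonneg g) le_rfl h) ?_⟩
    rw [dist_root_pt]
  obtain ⟨α, h0, h, rfl⟩ := key ha
  obtain ⟨β, h0', h', rfl⟩ := key hb
  rw [dist_root_pt, dist_root_pt] at hab
  subst hab
  rw [dist_root_pt, label_up]

/-- The segments from a point to the endpoints of a segment that contains it do not begin with the
same letter. -/
theorem noCommonStart {a m c : Φ.Tree} (h : OnSeg Φ.dist a m c) :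
    NoCommonStart (Φ.pathWord m a) (Φ.pathWord m c) := by
  intro x hx hx'
  have key : ∀ {w}, (Φ.pathWord m w).letter one = some x →
      ∃ b, OnSeg Φ.dist m b w ∧ Φ.dist m b = one ∧ Φ.label m b = some x := fun {w} hw => by
    have h1 : one ≤ Φ.dist m w := by
      have := ((Φ.pathWord m w).isSome_iff one).mp (by rw [hw]; rfl)
      exact this.2
    obtain ⟨a', b, -, h3, h4, h5, h6, h7⟩ := Φ.exists_pathWord_letter le_rfl h1
    rw [h4, right_eq_add] at h5
    obtain rfl := Φ.isZTree.eq_of _ _ h5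
    exact ⟨b, h3, h4, h7.symm.trans hw⟩
  obtain ⟨b, b1, b2, b3⟩ := key hx
  obtain ⟨b', c1, c2, c3⟩ := key hx'
  obtain rfl := Φ.eq_of_label_eq b2 c2 (b3.trans c3.symm)
  have h1 := Φ.isZTree.triangle a b c
  have h2 := Φ.isZTree.symm a m
  have h3 := Φ.isZTree.symm a b
  have h4 := ZLex.one_pos (n := n)
  unfold OnSeg at *
  grind

/-- What cancels is the segment from `b` to the median of the triangle. -/
theorem isProd_pathWord (a b c : Φ.Tree) :
    IsProd (Φ.pathWord a b) (Φ.pathWord b c) (Φ.pathWord a c) := by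
  obtain ⟨m, m1, m2, m3⟩ := Φ.isZTree.median a b c
  refine ⟨Φ.pathWord b m, Φ.pathWord m a, Φ.pathWord m c, ?_, Φ.pathWord_append m2,
    Φ.noCommonStart m3, ?_⟩
  · rw [← pathWord_symm, Φ.pathWord_append (Φ.isZTree.onSeg_symm m1)]
  · rw [← pathWord_symm, Φ.pathWord_append m3]

theorem isReduced_pathWord (u w : Φ.Tree) : (Φ.pathWord u w).IsReduced := by
  intro β h1 h2 h3
  have hpos := ZLex.one_pos (n := n)
  obtain ⟨a, b, a1, a2, a3, a4, a5, a6⟩ := Φ.exists_pathWord_letter h1 h2.le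
  have h4 : β + one ≤ Φ.dist u w := by
    have := one_le_of_pos (sub_pos.mpr h2)
    rw [pathWord_len] at this
    grind
  obtain ⟨b', c, b1, b2, b3, b4, b5, b6⟩ :=
    Φ.exists_pathWord_letter (u := u) (w := w) (β := β + one) (by grind) h4
  obtain rfl := Φ.isZTree.eq_of_onSeg a2 b1 (by grind)
  rw [a6, b6, ← Φ.label_symm a5] at h3
  have h5 := Φ.eq_of_label_eq b5 (by rwa [Φ.isZTree.symm]) h3
  rw [h5] at b4
  grind

/-- At the point where the segments part, their next edges have different labels. -/
theorem eq_of_pathWord_eq {p q q' : Φ.Tree} (h : Φ.pathWord p q = Φ.pathWord p q') : q = q' := by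
  have hlen : Φ.dist p q = Φ.dist p q' := congrArg ZWord.len h
  obtain ⟨m, m1, m2, m3⟩ := Φ.isZTree.median q p q'
  replace m1 := Φ.isZTree.onSeg_symm m1
  have e1 : Φ.dist m q = Φ.dist m q' := by
    unfold OnSeg at *
    grind
  by_contra hne
  have hpos : 0 < Φ.dist m q := by
    refine lt_of_le_of_ne (Φ.isZTree.nonneg _ _) fun h0 => hne ?_
    rw [← Φ.isZTree.eq_of _ _ h0.symm, ← Φ.isZTree.eq_of _ _ (h0.trans e1).symm]
  have k1 := append_letter_add (u := Φ.pathWord p m) (v := Φ.pathWord m q) (ZLex.one_pos (n := n))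
  have k2 := append_letter_add (u := Φ.pathWord p m) (v := Φ.pathWord m q') (ZLex.one_pos (n := n))
  rw [← Φ.pathWord_append m1] at k1
  rw [← Φ.pathWord_append m2, ← h, k1] at k2
  have k3 : ((Φ.pathWord m q).letter one).isSome := by
    rw [isSome_iff]
    exact ⟨le_rfl, one_le_of_pos hpos⟩
  obtain ⟨x, hx⟩ := Option.isSome_iff_exists.mp k3
  exact Φ.noCommonStart m3 x hx (k2 ▸ hx)

/-- The segment from `p` to `g • p` goes to the axis, along it and back. The middle word is
cyclically reduced because the axis does not turn back at `m`. -/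
theorem isCDR_pathWord (p : Φ.Tree) (g : G) : (Φ.pathWord p (g • p)).IsCDR := by
  refine ⟨Φ.isReduced_pathWord _ _, ?_⟩
  by_cases hg : g = 1
  · subst hg
    rw [one_smul]
    have h0 := Φ.isZTree.self p
    refine ⟨Φ.pathWord p p, Φ.pathWord p p, Φ.isReduced_pathWord _ _,
      ⟨Φ.isReduced_pathWord _ _, fun h => ?_⟩, eq_of_len_eq_zero h0 ?_⟩
    · rw [pathWord_len, h0] at h
      exact absurd h (lt_irrefl _)
    · change Φ.dist p p + Φ.dist p p + Φ.dist p p = 0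
      rw [h0, add_zero, add_zero]
  · obtain ⟨m, m1, m2, m3, m4⟩ :=
      Φ.isZTree.exists_axis Φ.dist_smul (Φ.dist_lt_dist_smul_smul hg p)
    refine ⟨Φ.pathWord m p, Φ.pathWord m (g • m), Φ.isReduced_pathWord _ _,
      ⟨Φ.isReduced_pathWord _ _, fun hpos h => ?_⟩, ?_⟩
    · have h1 := Φ.noCommonStart m3
      have h2 : Φ.pathWord m (g⁻¹ • m) = (Φ.pathWord m (g • m)).inv := by
        rw [← pathWord_symm, ← Φ.pathWord_smul g m, smul_inv_smul]
      have h3 : ((Φ.pathWord m (g • m)).letter one).isSome := by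
        rw [isSome_iff]
        exact ⟨le_rfl, one_le_of_pos hpos⟩
      obtain ⟨x, hx⟩ := Option.isSome_iff_exists.mp h3
      refine h1 x ?_ hx
      rw [h2, inv_letter, add_sub_cancel_right, ← h, map_invLetter_map, hx]
    · rw [← pathWord_symm, Φ.pathWord_append m2, Φ.pathWord_append m1, pathWord_smul]

/-- The realization of `G` by the words along the segments from `p` to its translates. -/
def rebase (p : Φ.Tree) : CDREmbedding n X G where
  word g := Φ.pathWord p (g • p)
  injective g h hgh := by
    have h1 := Φ.eq_of_pathWord_eq hgh
    rw [← inv_smul_eq_iff, smul_smul] at h1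
    exact (inv_mul_eq_one.mp (Φ.eq_one_of_smul_eq _ p h1)).symm
  isCDR g := Φ.isCDR_pathWord p g
  map_mul g h := by
    have h1 := Φ.isProd_pathWord p (g • p) ((g * h) • p)
    rwa [mul_smul, pathWord_smul, ← mul_smul] at h1
  map_inv g := by
    rw [← pathWord_symm, ← Φ.pathWord_smul g p, smul_inv_smul]

/-- An irreducible group does not fix a `ℤⁿ⁻¹`-subtree. -/
theorem Irreducible.not_fixed_class (hirr : Φ.Irreducible) :
    ¬ ∃ p : Φ.Tree, ∀ g : G, InZ (n - 1) (Φ.dist p (g • p)) := by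
  rintro ⟨p, hp⟩
  -- The conjugating word leads from `ε` to `p`: the path from `p` through `ε` and `g ε` to `g p` is
  -- the product that defines the conjugate.
  refine hirr ⟨n - 1, by have := NeZero.pos n; omega, Φ.rebase p, Φ.pathWord Φ.root p,
    Φ.isReduced_pathWord _ _, hp, fun g => ⟨Φ.pathWord p (Φ.orb g), ?_, ?_⟩⟩
  · rw [← pathWord_symm, ← pathWord_root_orb]
    exact Φ.isProd_pathWord _ _ _
  · have h1 := Φ.isProd_pathWord p (Φ.orb g) (g • p)
    rwa [← smul_root, pathWord_smul, smul_root] at h1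

end CDREmbedding

/-! ### Stationary functions and measures -/

theorem Group.FG.countable {G : Type*} [Group G] (h : Group.FG G) : Countable G := by
  obtain ⟨S, hS, φ, hφ⟩ := Group.fg_iff_exists_freeGroup_hom_surjective.mp h
  have : Countable S := hS.to_subtype.to_countable
  have : Countable (FreeGroup S) := Quot.mk_surjective.countable
  exact hφ.countable

theorem mem_of_subsemigroup_closure_eq_top {G : Type*} [Group G] {s : Set G}
    (hs : Subsemigroup.closure s = ⊤) {p : G → Prop} (h : ∀ g ∈ s, p g)
    (hmul : ∀ g h, p g → p h → p (g * h)) (g : G) : p g := by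
  have hg : g ∈ Subsemigroup.closure s := hs ▸ Subsemigroup.mem_top g
  exact Subsemigroup.closure_induction h (fun x y _ _ => hmul x y) hg

/-- The maximum principle: the points at which a stationary function that tends to `0` at infinity
has its maximal value form a finite invariant set. -/
theorem exists_finite_invariant {G Ω : Type*} [Group G] [MulAction G Ω] {μ : PMF G}
    (hμ : Subsemigroup.closure μ.support = ⊤) {f : Ω → ℝ≥0∞}
    (hf : ∀ ω, ∑' g, μ g * f (g⁻¹ • ω) = f ω) (hfin : ∀ c ≠ 0, {ω | c ≤ f ω}.Finite)
    (htop : ∀ ω, f ω ≠ ∞) {ω₀ : Ω} (h0 : f ω₀ ≠ 0) :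
    ∃ F : Set Ω, F.Finite ∧ F.Nonempty ∧ ∀ g : G, ∀ ω ∈ F, g • ω ∈ F := by
  obtain ⟨ω₁, h1, hmax⟩ := Set.exists_max_image _ f (hfin _ h0) ⟨ω₀, le_refl (f ω₀)⟩
  have h1' : f ω₀ ≤ f ω₁ := h1
  have hle : ∀ ω, f ω ≤ f ω₁ := fun ω => by
    rcases le_total (f ω₀) (f ω) with h | h
    · exact hmax ω h
    · exact h.trans h1'
  have hpos : f ω₁ ≠ 0 := fun h => h0 (le_antisymm (h ▸ h1') zero_le)
  refine ⟨{ω | f ω₁ ≤ f ω}, hfin _ hpos, ⟨ω₁, le_refl (f ω₁)⟩,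
    mem_of_subsemigroup_closure_eq_top hμ (fun g hg => ?_) fun g h hg hh ω hω => ?_⟩
  -- The maximum at `ω` is an average of values that do not exceed it, so a smaller value with
  -- positive weight is impossible.
  · have hmaps : Set.MapsTo (g⁻¹ • · : Ω → Ω) {ω | f ω₁ ≤ f ω} {ω | f ω₁ ≤ f ω} := by
      intro ω hω
      by_contra hlt
      change ¬ f ω₁ ≤ f (g⁻¹ • ω) at hlt
      have key : ∑' h, μ h * f (h⁻¹ • ω) < ∑' h, μ h * f ω₁ := by
        refine ENNReal.tsum_lt_tsum (i := g) (by rw [hf]; exact htop ω)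
          (fun h => mul_le_mul_right (hle _) _) ?_
        exact (ENNReal.mul_lt_mul_iff_right ((μ.mem_support_iff g).mp hg)
          (μ.apply_ne_top g)).mpr (not_le.mp hlt)
      rw [hf, ENNReal.tsum_mul_right, μ.tsum_coe, one_mul] at key
      exact absurd hω (not_le.mpr key)
    -- Stationarity gives invariance under `g⁻¹` only; on a finite set this injective map is onto,
    -- which gives invariance under `g`.
    have hsurj := ((hfin _ hpos).injOn_iff_bijOn_of_mapsTo hmaps).mp
      (MulAction.injective g⁻¹).injOn |>.surjOn
    intro ω hω
    obtain ⟨ω', h2, rfl⟩ := hsurj hω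
    change g • g⁻¹ • ω' ∈ _
    rwa [smul_inv_smul]
  · rw [mul_smul]
    exact hg _ (hh _ hω)

/-! ### The ends between the `ℤⁿ⁻¹`-subtrees -/

instance {n : ℕ} : Countable (ZLex n) := inferInstanceAs (Countable (Fin n → ℤ))

/-- The points of the completion at which it has been glued. -/
def gluedEnds {n : ℕ} {V : Type*} (d : V → V → ZLex n) : Set (ZCompletion d) :=
  {x | ∃ (k : ℕ) (hk : 1 ≤ k ∧ k ≤ n) (γ γ' : ZRay d k), Facing γ γ' ∧
    Quot.mk _ (PrePoint.ray k hk γ) = x}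

namespace IsZTree

variable {n : ℕ} [NeZero n] {V : Type*} {d : V → V → ZLex n} (T : IsZTree d)

include T

/-- A glued end is the initial part of a segment, so its type and two vertices determine it. -/
theorem countable_gluedEnds [Countable V] : (gluedEnds d).Countable := by
  have h : gluedEnds d ⊆ ⋃ p : ℕ × V × V, {x | ∃ (hk : 1 ≤ p.1 ∧ p.1 ≤ n) (γ : ZRay d p.1),
      γ.toFun 0 = p.2.1 ∧ Toward γ p.2.2 ∧ Quot.mk _ (PrePoint.ray p.1 hk γ) = x} := by
    rintro x ⟨k, hk, γ, γ', h1, h2⟩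
    have h3 := T.toward_of_facing h1 0
    exact Set.mem_iUnion.mpr ⟨(k, γ.toFun 0, γ'.toFun 0), hk, γ, rfl, h3, h2⟩
  refine (Set.countable_iUnion fun p => Set.Subsingleton.countable ?_).mono h
  rintro _ ⟨hk, γ, h1, h2, rfl⟩ _ ⟨_, γ', h1', h2', rfl⟩
  refine mk_eq_of_cofinal hk (T.cofinal_of_toward hk.1 h2 h2' ?_ (T.inZ_self _ _))
  rw [h1, h1']
  exact T.inZ_self _ _

/-- Only the gluing can move a representative to another `ℤⁿ⁻¹`-subtree; cofinal rays stay in the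
same one. Hence distinct closures are disjoint up to a countable set. -/
theorem inClass_iff_of_mk_eq {a b : PrePoint d} (h : (Quot.mk _ a : ZCompletion d) = Quot.mk _ b) :
    Quot.mk _ a ∈ gluedEnds d ∨ ∀ v, a.InClass v ↔ b.InClass v := by
  have h' := Quot.eqvGen_exact h
  clear h
  induction h' with
  | rel a b h =>
    cases h with
    | tail k hk γ γ' s s' h =>
      refine Or.inr fun v => ?_
      have key : k < n → InZ (n - 1) (d (γ.toFun 0) (γ'.toFun 0)) := fun hkn => by
        have h1 := T.ray_inZ γ 0 (s + 0)
        rw [h] at h1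
        exact (T.inZ_trans h1 (T.ray_inZ γ' _ 0)).mono (by omega)
      exact ⟨fun h1 => ⟨h1.1, T.inZ_trans h1.2 (key h1.1)⟩,
        fun h1 => ⟨h1.1, T.inZ_trans h1.2 (T.inZ_symm (key h1.1))⟩⟩
    | facing k hk hkn γ γ' δ h1 h0 h => exact Or.inl ⟨k, hk, γ, γ', ⟨δ, h1, h0, h⟩, rfl⟩
  | refl a => exact Or.inr fun _ => Iff.rfl
  | symm a b h ih =>
    refine ih.imp (fun h1 => ?_) fun h1 v => (h1 v).symm
    rwa [← Quot.eqvGen_sound h]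
  | trans a b c h h' ih ih' =>
    rcases ih with h1 | h1
    · exact Or.inl h1
    · refine ih'.imp (fun h2 => ?_) fun h2 v => (h1 v).trans (h2 v)
      rwa [Quot.eqvGen_sound h]

theorem classClosure_inter_subset {v w : V} (h : ¬ InZ (n - 1) (d v w)) :
    classClosure d v ∩ classClosure d w ⊆ gluedEnds d := by
  rintro x ⟨⟨a, rfl, ha⟩, b, hb, hb'⟩
  rcases T.inClass_iff_of_mk_eq hb with h1 | h1
  · exact hb ▸ h1
  · refine absurd ?_ h
    rw [h1 w] at hb'
    cases a with
    | vertex u => exact T.inZ_trans ha (T.inZ_symm hb')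
    | ray k hk γ => exact T.inZ_trans ha.2 (T.inZ_symm hb'.2)

theorem classClosure_eq {v w : V} (h : InZ (n - 1) (d v w)) :
    classClosure d v = classClosure d w := by
  have key : ∀ {v w : V}, InZ (n - 1) (d v w) → classClosure d v ⊆ classClosure d w := by
    rintro v w h x ⟨a, rfl, ha⟩
    refine ⟨a, rfl, ?_⟩
    cases a with
    | vertex u => exact T.inZ_trans (T.inZ_symm h) ha
    | ray k hk γ => exact ⟨ha.1, T.inZ_trans (T.inZ_symm h) ha.2⟩
  exact (key h).antisymm (key (T.inZ_symm h))

/-- The equivalence relation whose classes are the `ℤᵏ`-subtrees. -/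
def subtreeSetoid (k : ℕ) : Setoid V where
  r v w := InZ k (d v w)
  iseqv := ⟨T.inZ_self k, T.inZ_symm, T.inZ_trans⟩

end IsZTree

namespace CDREmbedding

variable {n : ℕ} [NeZero n] {X G : Type*} [Group G] (Φ : CDREmbedding n X G)

open MeasureTheory

/-! ### The action on the completion -/

theorem countable_tree [Countable G] : Countable Φ.Tree := by
  have h : Countable Φ.PreVertex := by
    refine Function.Injective.countable (f := fun p => (p.pos, p.elt)) fun p q hpq => ?_
    obtain ⟨h1, h2⟩ := Prod.mk.inj hpq
    exact PreVertex.ext h1 h2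
  exact Quotient.mk_surjective.countable

instance (D : MetricData Φ.dist) : MulAction G D.Space where
  smul := Φ.actBar D
  one_smul x := Quot.ind (β := fun x => Φ.actBar D 1 x = x) (fun a => by
    refine congrArg (Quot.mk _) ?_
    cases a with
    | vertex v => exact congrArg PrePoint.vertex (one_smul G v)
    | ray k hk γ =>
      obtain ⟨f, hf⟩ := γ
      refine congrArg (PrePoint.ray k hk) ?_
      unfold ZRay.map
      congr 1
      exact funext fun s => one_smul G (f s)) x
  mul_smul g h x := Quot.ind
    (β := fun x => Φ.actBar D (g * h) x = Φ.actBar D g (Φ.actBar D h x)) (fun a => by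
    refine congrArg (Quot.mk _) ?_
    cases a with
    | vertex v => exact congrArg PrePoint.vertex (mul_smul g h v)
    | ray k hk γ =>
      obtain ⟨f, hf⟩ := γ
      refine congrArg (PrePoint.ray k hk) ?_
      unfold ZRay.map
      congr 1
      exact funext fun s => mul_smul g h (f s)) x

variable {D : MetricData Φ.dist} {μ : PMF G} {ν : Measure D.Space}

theorem smul_mem_classClosure {v : Φ.Tree} {x : D.Space} (g : G)
    (hx : x ∈ classClosure Φ.dist v) : g • x ∈ classClosure Φ.dist (g • v) := by
  obtain ⟨a, rfl, ha⟩ := hx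
  refine ⟨a.map (g • ·) (Φ.dist_smul g), rfl, ?_⟩
  cases a with
  | vertex w =>
    change InZ (n - 1) (Φ.dist (g • v) (g • w))
    rwa [dist_smul]
  | ray k hk γ =>
    refine ⟨ha.1, ?_⟩
    change InZ (n - 1) (Φ.dist (g • v) (g • γ.toFun 0))
    rw [dist_smul]
    exact ha.2

theorem actBar_preimage_classClosure (g : G) (v : Φ.Tree) :
    Φ.actBar D g ⁻¹' classClosure Φ.dist v = (classClosure Φ.dist (g⁻¹ • v) : Set D.Space) := by
  ext x
  constructor
  · intro h
    have h1 := Φ.smul_mem_classClosure (D := D) (x := g • x) g⁻¹ h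
    rwa [inv_smul_smul] at h1
  · intro h
    have h1 := Φ.smul_mem_classClosure g h
    rwa [smul_inv_smul] at h1

theorem actBar_preimage_singleton (g : G) (x : D.Space) :
    Φ.actBar D g ⁻¹' {x} = {g⁻¹ • x} := by
  ext y
  exact smul_eq_iff_eq_inv_smul g

/-! ### Stationary measures -/

/-- An atom of maximal mass would have a finite invariant set of companions, which makes `G`
abelian. -/
theorem measure_singleton (hna : ¬ ∀ a b : G, a * b = b * a)
    (hμ : Subsemigroup.closure μ.support = ⊤) [IsProbabilityMeasure ν]
    (hν : Φ.IsStationary D μ ν) (x : D.Space) : ν {x} = 0 := by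
  by_contra h0
  have hm : ∀ x : D.Space, MeasurableSet ({x} : Set D.Space) := fun x =>
    (Φ.isZTree.isClosed_singleton D x).measurableSet
  obtain ⟨F, hF, hne, hinv⟩ := exists_finite_invariant (f := fun x : D.Space => ν {x}) hμ
    (fun y => by
      refine (hν {y} (hm y)).symm ▸ tsum_congr fun g => ?_
      rw [actBar_preimage_singleton])
    (fun c hc => Measure.finite_const_le_meas_of_disjoint_iUnion ν (pos_iff_ne_zero.mpr hc) hm
      (fun a b hab => Set.disjoint_singleton.mpr hab) (measure_ne_top _ _))
    (fun _ => measure_ne_top _ _) h0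
  exact hna (Φ.isZTree.comm_of_finite_invariant Φ.dist_smul (fun g v => Φ.eq_one_of_smul_eq g v)
    (Φ.eq_one_of_pow_eq_one) hF hne hinv)

/-- The closures are almost everywhere disjoint, since glued ends are null, so only finitely many
can have mass above a positive bound. Irreducibility enters here, through the fixed `ℤⁿ⁻¹`-subtree
that results. -/
theorem measure_classClosure [Countable G] (hna : ¬ ∀ a b : G, a * b = b * a)
    (hirr : Φ.Irreducible) (hμ : Subsemigroup.closure μ.support = ⊤) [IsProbabilityMeasure ν]
    (hν : Φ.IsStationary D μ ν) (v : Φ.Tree) : ν (classClosure Φ.dist v : Set D.Space) = 0 := by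
  by_contra h0
  have := Φ.countable_tree
  have T := Φ.isZTree
  let _ : Setoid Φ.Tree := T.subtreeSetoid (n - 1)
  have hcong : ∀ (g : G) {v w : Φ.Tree}, v ≈ w → g • v ≈ g • w := fun g v w h => by
    change InZ (n - 1) (Φ.dist (g • v) (g • w))
    rw [dist_smul]
    exact h
  let _ : MulAction G (Quotient (T.subtreeSetoid (n - 1))) :=
    { smul := fun g => Quotient.map (g • ·) fun v w h => hcong g h
      one_smul := Quotient.ind fun v => congrArg (Quotient.mk _) (one_smul G v)
      mul_smul := fun g h => Quotient.ind fun v => congrArg (Quotient.mk _) (mul_smul g h v) }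
  let C : Quotient (T.subtreeSetoid (n - 1)) → Set D.Space :=
    Quotient.lift (classClosure Φ.dist) fun v w h => T.classClosure_eq h
  have hm : ∀ ω, MeasurableSet (C ω) := Quotient.ind fun v =>
    (T.isClosed_classClosure D v).measurableSet
  have hglue : ν (gluedEnds Φ.dist : Set D.Space) = 0 := by
    have : NullSingletonClass ν := ⟨Φ.measure_singleton hna hμ hν⟩
    exact Set.Countable.measure_zero (α := D.Space) T.countable_gluedEnds ν
  obtain ⟨F, hF, hne, hinv⟩ := exists_finite_invariant (f := fun ω => ν (C ω)) hμ
    (fun ω => by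
      refine (hν (C ω) (hm ω)).symm ▸ tsum_congr fun g => ?_
      induction ω using Quotient.ind with | _ v
      exact congrArg (fun E => μ g * ν E) (Φ.actBar_preimage_classClosure g v).symm)
    (fun c hc => Measure.finite_const_le_meas_of_disjoint_iUnion₀ ν (pos_iff_ne_zero.mpr hc)
      (fun ω => (hm ω).nullMeasurableSet) (fun a b hab => by
        induction a using Quotient.ind with | _ a
        induction b using Quotient.ind with | _ b
        exact measure_mono_null
          (T.classClosure_inter_subset fun h => hab (Quotient.sound h)) hglue)
      (measure_ne_top _ _))
    (fun _ => measure_ne_top _ _) (ω₀ := Quotient.mk _ v) h0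
  obtain ⟨p, hp⟩ := T.exists_fixed_class Φ.dist_smul (fun g v => Φ.eq_one_of_smul_eq g v)
    (Φ.eq_one_of_pow_eq_one) hna (hF.image Quotient.out).toFinset
    (by rw [Set.Finite.toFinset_nonempty]; exact hne.image _) (fun g f hf => by
      rw [Set.Finite.mem_toFinset] at hf
      obtain ⟨ω, hω, rfl⟩ := hf
      refine ⟨(g • ω).out, ?_, ?_⟩
      · rw [Set.Finite.mem_toFinset]
        exact ⟨_, hinv g ω hω, rfl⟩
      · have h1 : g • ω = Quotient.mk _ (g • ω.out) := by
          conv_lhs => rw [← Quotient.out_eq ω]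
          rfl
        rw [h1]
        exact Setoid.symm (Quotient.mk_out (g • ω.out)))
  exact Irreducible.not_fixed_class Φ hirr ⟨p, hp⟩

theorem compl_topEnds (D : MetricData Φ.dist) :
    D.topEndsᶜ = ⋃ v, (classClosure Φ.dist v : Set D.Space) :=
  Φ.isZTree.compl_topBoundary

theorem measurableSet_topEnds [Countable G] (D : MetricData Φ.dist) : MeasurableSet D.topEnds := by
  have := Φ.countable_tree
  rw [← MeasurableSet.compl_iff, compl_topEnds]
  exact MeasurableSet.iUnion fun v => (Φ.isZTree.isClosed_classClosure D v).measurableSet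

theorem measure_topEnds [Countable G] (hna : ¬ ∀ a b : G, a * b = b * a)
    (hirr : Φ.Irreducible) (hμ : Subsemigroup.closure μ.support = ⊤) [IsProbabilityMeasure ν]
    (hν : Φ.IsStationary D μ ν) : ν D.topEnds = 1 := by
  have := Φ.countable_tree
  rw [← prob_compl_eq_zero_iff (Φ.measurableSet_topEnds D), compl_topEnds]
  exact measure_iUnion_null fun v => Φ.measure_classClosure hna hirr hμ hν v

/-- The translates of a null set are null sets. -/
theorem measure_actBar_preimage (hμ : Subsemigroup.closure μ.support = ⊤)
    (hν : Φ.IsStationary D μ ν) (g : G) :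
    ∀ E : Set D.Space, ν E = 0 → ν (Φ.actBar D g ⁻¹' E) = 0 := by
  refine mem_of_subsemigroup_closure_eq_top hμ
    (p := fun g => ∀ E : Set D.Space, ν E = 0 → ν (Φ.actBar D g ⁻¹' E) = 0)
    (fun g hg E hE => ?_) (fun g h hg hh E hE => ?_) g
  · have h1 := hν _ (measurableSet_toMeasurable ν E)
    rw [measure_toMeasurable, hE, ENNReal.tsum_eq_zero] at h1
    have h2 := (mul_eq_zero.mp (h1 g)).resolve_left ((μ.mem_support_iff g).mp hg)
    exact measure_mono_null (Set.preimage_mono (subset_toMeasurable ν E)) h2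
  · have h1 : Φ.actBar D (g * h) ⁻¹' E = Φ.actBar D h ⁻¹' (Φ.actBar D g ⁻¹' E) := by
      ext x
      change (g * h) • x ∈ E ↔ g • h • x ∈ E
      rw [mul_smul]
    rw [h1]
    exact hh _ (hg _ hE)

end CDREmbedding

/-! ### Neighbourhoods of ends of `ℤⁿ`-type, and positivity on open sets -/

namespace IsZTree

variable {n : ℕ} [NeZero n] {V : Type*} {d : V → V → ZLex n} (T : IsZTree d)

theorem coord_last_mono {a b : ZLex n} (h : a ≤ b) : coord a (n - 1) ≤ coord b (n - 1) := by
  have h1 := coord_nonneg_of_inZ (k := n - 1) (sub_nonneg.mpr h)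
    (by rw [Nat.sub_add_cancel (NeZero.pos n)]; exact inZ_top _)
  rw [coord_sub] at h1
  exact sub_nonneg.mp h1

theorem exists_le_coord_last (N : ℕ) : ∃ s : halfLine n n, (N : ℤ) ≤ coord (s : ZLex n) (n - 1) := by
  induction N with
  | zero => exact ⟨0, (coord_zero _).ge⟩
  | succ N ih =>
    obtain ⟨s, hs⟩ := ih
    have hn : n - 1 < n := Nat.sub_lt (NeZero.pos n) one_pos
    refine ⟨s + ⟨unit n (n - 1), (unit_pos hn).le, inZ_top _⟩, ?_⟩
    change _ ≤ coord ((s : ZLex n) + unit n (n - 1)) (n - 1)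
    rw [coord_add, coord_unit hn, if_pos rfl]
    push_cast
    exact Int.add_le_add_right hs 1

include T

/-- The points that a vertex far along a ray of `ℤⁿ`-type separates from its origin form a small
neighbourhood of its end. -/
theorem exists_forall_mem_of_isOpen (D : MetricData d) {E : Set D.Space} (hE : IsOpen E)
    {hk : 1 ≤ n ∧ n ≤ n} {γ : ZRay d n} (hγ : Quot.mk _ (PrePoint.ray n hk γ) ∈ E) :
    ∃ s : halfLine n n, ∀ t, s ≤ t → ∀ b : PrePoint d,
      (∀ᶠ w in b.filter, OnSeg d (γ.toFun 0) (γ.toFun t) w) → Quot.mk _ b ∈ E := by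
  obtain ⟨ε, hε, h⟩ := hE _ hγ
  obtain ⟨L, hL⟩ := T.exists_dist_lt D hε
  set o := D.base n Set.univ
  -- The summand added to `L` pays for the change of base point from `γ 0` to `o` in the triangle
  -- inequality.
  obtain ⟨s, hs⟩ := exists_le_coord_last (n := n) (L + (coord (d (γ.toFun 0) o) (n - 1)).toNat)
  refine ⟨s, fun t hst b hb => h _ (hL _ _ fun p hp => ?_)⟩
  obtain ⟨a', b', ha', hb', hp⟩ := hp
  have hγt : ∀ᶠ u in (PrePoint.ray n hk γ).filter, OnSeg d (γ.toFun 0) (γ.toFun t) u := by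
    rw [ray_filter_eventually]
    exact ⟨t, fun r => T.ray_onSeg γ (by
      change (t : ZLex n) ≤ t + r
      exact le_add_of_nonneg_right r.2.1)⟩
  -- The geodesic may be witnessed by other representatives of its ends; lying beyond a vertex is
  -- independent of them.
  replace hγt := T.beyond_of_rel ha'.symm hγt
  replace hb := T.beyond_of_rel hb'.symm hb
  have := a'.filter_neBot
  have := b'.filter_neBot
  obtain ⟨u, hu, hu'⟩ := (hp.and hγt).exists
  obtain ⟨w, hw, hw'⟩ := (hu.and hb).exists
  have h1 := T.le_of_onSeg (T.onSeg_convex hu' hw' hw)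
  rw [T.ray_dist_zero] at h1
  have h2 := coord_last_mono
    (((show (s : ZLex n) ≤ t from hst).trans h1).trans (T.triangle _ o p))
  rw [coord_add] at h2
  push_cast at hs
  have h3 := Int.self_le_toNat (coord (d (γ.toFun 0) o) (n - 1))
  linarith

/-- A point of a geodesic that a vertex separates from `o` forces it to separate an end of this
geodesic from `o`. -/
theorem eventually_or_of_onGeodesic {a b : PrePoint d} {p o q : V}
    (h : ∀ᶠ u in a.filter, ∀ᶠ w in b.filter, OnSeg d u p w) (hq : OnSeg d o q p) :
    (∀ᶠ u in a.filter, OnSeg d o q u) ∨ ∀ᶠ w in b.filter, OnSeg d o q w := by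
  have h1 : ∀ᶠ u in a.filter, ∀ᶠ w in b.filter, OnSeg d o q u ∨ OnSeg d o q w := by
    filter_upwards [h] with u hu
    filter_upwards [hu] with w hw
    rcases T.cut hw o with h1 | h1
    · exact Or.inl (T.onSeg_trans (T.onSeg_symm h1) hq)
    · exact Or.inr (T.onSeg_trans h1 hq)
  by_cases h2 : ∀ᶠ u in a.filter, OnSeg d o q u
  · exact Or.inl h2
  · rw [not_eventually] at h2
    obtain ⟨u, hu, hu'⟩ := (h2.and_eventually h1).exists
    exact Or.inr (hu'.mono fun w hw => hw.resolve_left hu)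

end IsZTree

theorem PrePoint.filter_map {n : ℕ} {V : Type*} {d : V → V → ZLex n} (f : V → V)
    (hf : ∀ v w, d (f v) (f w) = d v w) (a : PrePoint d) :
    (a.map f hf).filter = Filter.map f a.filter := by
  cases a with
  | vertex v => exact (Filter.map_pure f v).symm
  | ray k hk γ => exact Filter.map_map.symm

namespace CDREmbedding

variable {n : ℕ} [NeZero n] {X G : Type*} [Group G] (Φ : CDREmbedding n X G)

/-- Every ray of `ℤⁿ`-type has a vertex beyond which it separates from its origin a translate of a
given vertex. -/
theorem exists_onSeg_smul (γ : ZRay Φ.dist n) (s : halfLine n n) (p : Φ.Tree) :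
    ∃ g : G, OnSeg Φ.dist (γ.toFun 0) (γ.toFun s) (g • p) := by
  have T := Φ.isZTree
  let m : halfLine n n := ⟨Φ.dist Φ.root p, T.nonneg _ _, inZ_top _⟩
  -- Either `p` or `f • p` will do. Otherwise both are on the near side of `γ s`. But `z = γ (s +
  -- 2m)` lies on the segment from `ε` to `f ε`, whose endpoints are within `m` of `p` and `f • p`.
  -- The detour of `2m` from `γ s` to `z` makes up for this error and puts `γ s` on `[p, f • p]`, so
  -- one of the two is beyond it after all.
  obtain ⟨f, α, h0, h, hz⟩ := Φ.exists_pt (γ.toFun (s + (m + m)))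
  have h1 : OnSeg Φ.dist Φ.root (γ.toFun (s + (m + m))) (Φ.orb f) := by
    rw [hz]
    exact Φ.onSeg_root_pt _ _ _ _ h
  have h2 : OnSeg Φ.dist (γ.toFun 0) (γ.toFun s) (γ.toFun (s + (m + m))) := T.ray_onSeg γ (by
    change (s : ZLex n) ≤ s + (m + m : halfLine n n)
    exact le_add_of_nonneg_right (m + m).2.1)
  have h3 : Φ.dist (γ.toFun s) (γ.toFun (s + (m + m))) =
      Φ.dist Φ.root p + Φ.dist Φ.root p := T.ray_dist γ s (m + m)
  by_contra hno
  rw [not_exists] at hno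
  have k1 := (T.cut h2 p).resolve_left (by simpa using hno 1)
  have k2 := (T.cut h2 (f • p)).resolve_left (hno f)
  have k3 : ¬ OnSeg Φ.dist p (γ.toFun s) (f • p) := fun hon => by
    rcases T.cut hon (γ.toFun 0) with h4 | h4
    · exact hno 1 (by rw [one_smul]; exact T.onSeg_symm h4)
    · exact hno f h4
  have e1 : Φ.dist (Φ.orb f) (f • p) = Φ.dist Φ.root p := by rw [← smul_root, dist_smul]
  generalize γ.toFun (s + (m + m)) = z at *
  generalize γ.toFun s = q at *
  generalize γ.toFun 0 = o at *
  generalize f • p = p' at *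
  generalize Φ.orb f = r at *
  generalize Φ.root = e at *
  clear hz hno h2
  have t1 := T.triangle e p z
  have t2 := T.triangle r p' z
  have t3 := T.triangle e p r
  have t4 := T.triangle p p' r
  have t5 := T.triangle p q p'
  have t6 := T.triangle z e p
  have t7 := T.triangle z r p'
  have s1 := T.symm z e
  have s2 := T.symm z r
  have s3 := T.symm z p
  have s4 := T.symm z p'
  have s5 := T.symm p' r
  have s6 := T.symm q p'
  unfold OnSeg at *
  grind

open MeasureTheory

variable {D : MetricData Φ.dist} {μ : PMF G} {ν : Measure D.Space}

theorem measure_pos_of_isOpen [Countable G] (hna : ¬ ∀ a b : G, a * b = b * a)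
    (hμ : Subsemigroup.closure μ.support = ⊤) [IsProbabilityMeasure ν]
    (hν : Φ.IsStationary D μ ν) {E : Set D.Space} (hE : IsOpen E)
    (hne : (E ∩ D.topEnds).Nonempty) : 0 < ν E := by
  rw [pos_iff_ne_zero]
  intro h0
  have T := Φ.isZTree
  obtain ⟨_, hx, hk, γ, rfl⟩ := hne
  obtain ⟨s, hs⟩ := T.exists_forall_mem_of_isOpen D hE hx
  have hN : ν (⋃ g, Φ.actBar D g ⁻¹' E) = 0 :=
    measure_iUnion_null fun g => Φ.measure_actBar_preimage hμ hν g E h0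
  -- The complement of a null set has full mass, and without atoms it cannot have fewer than two
  -- points.
  obtain ⟨x, y, hx', hy', hxy⟩ : ∃ x y, x ∉ ⋃ g, Φ.actBar D g ⁻¹' E ∧
      y ∉ ⋃ g, Φ.actBar D g ⁻¹' E ∧ x ≠ y := by
    by_contra! hall
    have hsub : Set.Subsingleton (⋃ g, Φ.actBar D g ⁻¹' E)ᶜ := fun x hx y hy => hall x y hx hy
    have hc : ν (⋃ g, Φ.actBar D g ⁻¹' E)ᶜ = 0 := by
      rcases hsub.eq_empty_or_singleton with h | ⟨x, h⟩
      · rw [h, measure_empty]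
      · rw [h, Φ.measure_singleton hna hμ hν]
    have h1 := measure_union_null hN hc
    rw [Set.union_compl_self, measure_univ] at h1
    exact one_ne_zero h1
  obtain ⟨p, a, b, rfl, rfl, hp⟩ := T.exists_onGeodesic hxy
  obtain ⟨g, hg⟩ := Φ.exists_onSeg_smul γ s p
  -- No translate of a point outside the null set may lie beyond `γ s`, since everything there
  -- belongs to `E`.
  have key : ∀ c : PrePoint Φ.dist, (Quot.mk _ c : D.Space) ∉ ⋃ g, Φ.actBar D g ⁻¹' E →
      ¬ ∀ᶠ u in (c.map (g • ·) (Φ.dist_smul g)).filter,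
        OnSeg Φ.dist (γ.toFun 0) (γ.toFun s) u := fun c hc h =>
    hc (Set.mem_iUnion.mpr ⟨g, hs s le_rfl _ h⟩)
  refine (T.eventually_or_of_onGeodesic (a := a.map (g • ·) (Φ.dist_smul g))
    (b := b.map (g • ·) (Φ.dist_smul g)) ?_ hg).elim (key a hx') (key b hy')
  rw [PrePoint.filter_map, PrePoint.filter_map, eventually_map]
  filter_upwards [hp] with u hu
  rw [eventually_map]
  exact hu.mono fun w hw => T.smul_onSeg Φ.dist_smul g hw

end CDREmbedding

end

theorem mainTheorem5 {n : ℕ} [NeZero n] {X G : Type*} [Group G] (hfg : Group.FG G)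
    (hna : ¬ ∀ a b : G, a * b = b * a) (Φ : CDREmbedding n X G) (hirr : Φ.Irreducible)
    (D : MetricData Φ.dist) (μ : PMF G) (hμ : Subsemigroup.closure μ.support = ⊤)
    (ν : MeasureTheory.Measure D.Space) [MeasureTheory.IsProbabilityMeasure ν]
    (hν : Φ.IsStationary D μ ν) :
    (∀ x, ν {x} = 0) ∧
    (MeasurableSet D.topEnds ∧ ν D.topEnds = 1) ∧
    ∀ E : Set D.Space, IsOpen E → (E ∩ D.topEnds).Nonempty → 0 < ν E := by
  have := hfg.countable
  exact ⟨Φ.measure_singleton hna hμ hν,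
    ⟨Φ.measurableSet_topEnds D, Φ.measure_topEnds hna hirr hμ hν⟩,
    fun E => Φ.measure_pos_of_isOpen hna hμ hν⟩
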